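/- **Proposition 3.1.** For a connected, locally path-connected space $X$ with base point $x_0$ let $\mathcal M(X)=\operatorname{Hom}(\pi_1(X,x_0),\mathbb C^*)$; when $\pi_1(X,x_0)$ is finitely generated this is an algebraic group, isomorphic to the product of a complex torus and a finite abelian group, and it carries its Zariski topology. For $\rho\in\mathcal M(X)$ let $L_\rho$ be the rank one complex local system with monodromy $\rho$, and for $i\ge 0$, $k\ge 1$ put $$\Sigma^i_k(X)=\{\rho\in\mathcal M(X)\;:\;\dim_{\mathbb C}H^i(X,L_\rho)\ge k\}.$$ A *subtorus* of $\mathcal M(X)$ is the image of an injective homomorphism of algebraic groups $(\mathbb C^*)^d\to\mathcal M(X)$, $d\ge 0$. A *translate of a subtorus* $S$ is a set $\rho\cdot S$ with $\rho\in\mathcal M(X)$. Irreducible components are taken in the Zariski topology. Let $U$ be a connected CW complex of finite type (finitely many cells in each dimension), let $\tau\in\mathcal M(U)$ be a torsion element, and let $f:V\to U$ be the finite abelian covering associated with $\tau$, that is, the connected covering with $f_*\pi_1(V)=\ker\bigl(\tau:\pi_1(U)\to\mathbb C^*\bigr)$. Fix $i\ge 0$. Suppose that for every integer $k\ge 1$,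 each irreducible component of $\Sigma^i_k(V)$ containing the trivial character $\mathbf 1$ is a subtorus of $\mathcal M(V)$. Then for every integer $k\ge 1$, each irreducible component of $\Sigma^i_k(U)$ containing $\tau$ is a translate of a subtorus of $\mathcal M(U)$. -/

import Mathlib

open Topology

noncomputable section

/-! ### Character varieties -/

/-- The character variety `Hom(G, ℂ*)` of a group `G`. -/
def CharVar (G : Type*) [Group G] : Type _ := G →* ℂˣ

namespace CharVar

variable {G : Type*} [Group G]

/-- Characters form an abelian group under pointwise multiplication. -/
instance : CommGroup (CharVar G) := inferInstanceAs (CommGroup (G →* ℂˣ))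

/-- A character, as a homomorphism of groups. -/
def toHom (ρ : CharVar G) : G →* ℂˣ := ρ

/-- Evaluation at a character `ρ` of a regular function on `Hom(G, ℂ*)`. The regular functions are
the finite linear combinations `∑ a_g g` of the coordinate functions `ρ ↦ ρ(g)`, that is, they are
given by elements of the group algebra `ℂ[G]`. -/
def evalAt (ρ : CharVar G) : MonoidAlgebra ℂ G →ₐ[ℂ] ℂ :=
  MonoidAlgebra.lift ℂ ℂ G ((Units.coeHom ℂ).comp ρ.toHom)

/-- The common zero locus of a set of regular functions. -/
def zeroLocus (S : Set (MonoidAlgebra ℂ G)) : Set (CharVar G) :=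
  {ρ | ∀ a ∈ S, ρ.evalAt a = 0}

/-- The Zariski topology on `Hom(G, ℂ*)`: the closed sets are the common zero loci of sets of
regular functions. -/
instance : TopologicalSpace (CharVar G) :=
  TopologicalSpace.ofClosed {Z | ∃ S : Set (MonoidAlgebra ℂ G), Z = zeroLocus S}
    ⟨{1}, by ext ρ; simp [zeroLocus]⟩
    (by
      intro A hA
      refine ⟨{a | ∃ S, zeroLocus S ∈ A ∧ a ∈ S}, ?_⟩
      ext ρ
      constructor
      · rintro h a ⟨S, hS, ha⟩
        exact h _ hS a ha
      · intro h Z hZ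
        obtain ⟨S, rfl⟩ := hA hZ
        exact fun a ha => h a ⟨S, hZ, ha⟩)
    (by
      rintro _ ⟨S, rfl⟩ _ ⟨T, rfl⟩
      refine ⟨{c | ∃ a ∈ S, ∃ b ∈ T, c = a * b}, ?_⟩
      ext ρ
      constructor
      · rintro (h | h) c ⟨a, ha, b, hb, rfl⟩
        · rw [map_mul, h a ha, zero_mul]
        · rw [map_mul, h b hb, mul_zero]
      · intro h
        by_contra hc
        simp only [Set.mem_union, not_or] at hc
        obtain ⟨h1, h2⟩ := hc
        simp only [zeroLocus, Set.mem_ofPred_eq, not_forall] at h1 h2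
        obtain ⟨a, ha, ha'⟩ := h1
        obtain ⟨b, hb, hb'⟩ := h2
        have := h (a * b) ⟨a, ha, b, hb, rfl⟩
        rw [map_mul] at this
        exact (mul_ne_zero ha' hb') this)

/-- `T` is an irreducible component of the subset `Z` of a character variety: a maximal irreducible
subset of `Z` for the Zariski topology. -/
def IsIrredComponent (Z T : Set (CharVar G)) : Prop :=
  Maximal (fun W : Set (CharVar G) => IsIrreducible W ∧ W ⊆ Z) T

/-- A subtorus of `Hom(G, ℂ*)`: the image of an injective homomorphism of algebraic groups
`φ : (ℂ*)^d → Hom(G, ℂ*)`. Algebraicity of the group homomorphism `φ` means that every coordinate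
function `t ↦ φ(t)(g)` is a regular homomorphism `(ℂ*)^d → ℂ*`, i.e. a Laurent monomial. -/
def IsSubtorus (S : Set (CharVar G)) : Prop :=
  ∃ (d : ℕ) (φ : (Fin d → ℂˣ) →* CharVar G),
    (∀ g : G, ∃ m : Fin d → ℤ, ∀ t : Fin d → ℂˣ, (φ t).toHom g = ∏ j, t j ^ m j) ∧
    Function.Injective φ ∧ Set.range φ = S

/-- A translate `ρ · S` of a subtorus `S`. -/
def IsSubtorusTranslate (T : Set (CharVar G)) : Prop :=
  ∃ (ρ : CharVar G) (S : Set (CharVar G)), IsSubtorus S ∧ T = (fun χ => ρ * χ) '' S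

end CharVar

/-! ### Cohomology with coefficients in a rank one local system -/

/-- The standard topological `n`-simplex. -/
abbrev Simp (n : ℕ) : Type := stdSimplex ℝ (Fin (n + 1))

/-- The inclusion of the `j`-th face of the standard `(n + 1)`-simplex. -/
def faceMap (n : ℕ) (j : Fin (n + 2)) : C(Simp n, Simp (n + 1)) :=
  ⟨stdSimplex.map (S := ℝ) j.succAbove, stdSimplex.continuous_map _⟩

/-- A singular `n`-simplex of the universal cover of `(X, x₀)`. The points of the universal cover
over `x` are the homotopy classes of paths from `x₀` to `x`; so this is a singular simplex `σ` of
`X` with, for every point `p` of the standard simplex, a homotopy class of paths from `x₀` to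
`σ p`, which varies continuously, i.e. is transported along paths in the standard simplex. -/
@[ext]
structure LiftedSimplex {X : Type*} [TopologicalSpace X] (x₀ : X) (n : ℕ) where
  /-- the underlying singular simplex of `X` -/
  simplex : C(Simp n, X)
  /-- the lift to the universal cover -/
  lift (p : Simp n) : Path.Homotopic.Quotient x₀ (simplex p)
  /-- the lift is continuous -/
  lift_trans (p q : Simp n) (δ : Path p q) :
    lift q = (lift p).trans (.mk (δ.map simplex.continuous))

namespace LiftedSimplex

variable {X : Type*} [TopologicalSpace X] {x₀ : X} {n : ℕ}

/-- The `j`-th face of a singular simplex of the universal cover. -/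
def face (s : LiftedSimplex x₀ (n + 1)) (j : Fin (n + 2)) : LiftedSimplex x₀ n where
  simplex := s.simplex.comp (faceMap n j)
  lift p := s.lift (faceMap n j p)
  lift_trans _ _ δ := s.lift_trans _ _ (δ.map (faceMap n j).continuous)

/-- The deck transformation of the universal cover given by `g ∈ π₁(X, x₀)`, which sends the class
of a path `γ` from `x₀` to the class of `g` followed by `γ`. -/
def deck (g : FundamentalGroup X x₀) (s : LiftedSimplex x₀ n) : LiftedSimplex x₀ n where
  simplex := s.simplex
  lift p := g.toPath.trans (s.lift p)
  lift_trans p q δ := by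
    rw [s.lift_trans p q δ]
    exact (Path.Homotopic.Quotient.trans_assoc _ _ _).symm

theorem face_face (s : LiftedSimplex x₀ (n + 2)) {i j : Fin (n + 2)} (h : i ≤ j) :
    (s.face j.succ).face i = (s.face i.castSucc).face j := by
  have key : (faceMap (n + 1) j.succ).comp (faceMap n i) =
      (faceMap (n + 1) i.castSucc).comp (faceMap n j) := by
    ext1 p
    have : j.succ.succAbove ∘ i.succAbove = i.castSucc.succAbove ∘ j.succAbove := by
      funext k
      simp only [Function.comp_apply, Fin.succAbove, Fin.ext_iff, Fin.lt_def, Fin.le_def] at *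
      split_ifs <;> simp_all <;> omega
    simp only [ContinuousMap.comp_apply, faceMap, ContinuousMap.coe_mk]
    rw [stdSimplex.map_comp_apply, stdSimplex.map_comp_apply, this]
  have gen : ∀ a b : C(Simp n, Simp (n + 2)), a = b →
      ∀ ha hb, (⟨s.simplex.comp a, fun p => s.lift (a p), ha⟩ : LiftedSimplex x₀ n) =
        ⟨s.simplex.comp b, fun p => s.lift (b p), hb⟩ := by
    rintro a _ rfl _ _
    rfl
  exact gen _ _ key ((s.face j.succ).face i).lift_trans ((s.face i.castSucc).face j).lift_trans

end LiftedSimplex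

open LiftedSimplex

variable {X : Type*} [TopologicalSpace X] {x₀ : X}

/-- The `ρ`-equivariant functions on the singular `n`-simplices of the universal cover. -/
def equivariant (ρ : CharVar (FundamentalGroup X x₀)) (n : ℕ) :
    Submodule ℂ (LiftedSimplex x₀ n → ℂ) where
  carrier := {c | ∀ g s, c (deck g s) = (ρ.toHom g : ℂ) * c s}
  zero_mem' := by simp
  add_mem' := by
    intro a b ha hb g s
    simp [ha g s, hb g s, mul_add]
  smul_mem' := by
    intro z a ha g s
    simp [ha g s, mul_left_comm]

/-- The singular `n`-cochains of `X` with coefficients in the rank one local system `L_ρ`, i.e. the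
group `Hom_{π₁(X, x₀)}(C_n(X̃), ℂ_ρ)` of `ρ`-equivariant singular `n`-cochains of the universal
cover. -/
def TwistedCochain (ρ : CharVar (FundamentalGroup X x₀)) (n : ℕ) : Type _ :=
  equivariant ρ n

instance (ρ : CharVar (FundamentalGroup X x₀)) (n : ℕ) : AddCommGroup (TwistedCochain ρ n) :=
  inferInstanceAs (AddCommGroup (equivariant ρ n))

instance (ρ : CharVar (FundamentalGroup X x₀)) (n : ℕ) : Module ℂ (TwistedCochain ρ n) :=
  inferInstanceAs (Module ℂ (equivariant ρ n))

/-- The differential `(d c)(s) = ∑ j, (-1)^j c(∂_j s)`. -/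
def twistedDiff (ρ : CharVar (FundamentalGroup X x₀)) (n : ℕ) :
    TwistedCochain ρ n →ₗ[ℂ] TwistedCochain ρ (n + 1) where
  toFun c := ⟨fun s => ∑ j : Fin (n + 2), (-1 : ℂ) ^ (j : ℕ) * c.1 (s.face j), by
    intro g s
    rw [Finset.mul_sum]
    refine Finset.sum_congr rfl fun j _ => ?_
    rw [mul_left_comm, ← c.2 g (s.face j)]
    rfl⟩
  map_add' a b := by
    refine Subtype.ext (funext fun s => ?_)
    change ∑ j : Fin (n + 2), (-1 : ℂ) ^ (j : ℕ) * (a.1 (s.face j) + b.1 (s.face j)) =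
      (∑ j : Fin (n + 2), _) + ∑ j : Fin (n + 2), _
    simp only [mul_add, Finset.sum_add_distrib]
  map_smul' z a := by
    refine Subtype.ext (funext fun s => ?_)
    change ∑ j : Fin (n + 2), (-1 : ℂ) ^ (j : ℕ) * (z * a.1 (s.face j)) =
      z * ∑ j : Fin (n + 2), _
    simp only [Finset.mul_sum, mul_left_comm]

/-- The coboundaries in degree `n`; in degree `0` there are none but `0`. -/
def twistedCoboundary (ρ : CharVar (FundamentalGroup X x₀)) :
    (n : ℕ) → Submodule ℂ (TwistedCochain ρ n)
  | 0 => ⊥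
  | n + 1 => LinearMap.range (twistedDiff ρ n)

/-- The twisted cochains form a complex. -/
theorem twistedDiff_twistedDiff (ρ : CharVar (FundamentalGroup X x₀)) (n : ℕ)
    (c : TwistedCochain ρ n) : twistedDiff ρ (n + 1) (twistedDiff ρ n c) = 0 := by
  refine Subtype.ext (funext fun s => ?_)
  change ∑ j : Fin (n + 3), (-1 : ℂ) ^ (j : ℕ) *
    (∑ i : Fin (n + 2), (-1 : ℂ) ^ (i : ℕ) * c.1 ((s.face j).face i)) = 0
  simp only [Finset.mul_sum]
  rw [Finset.sum_comm]
  simp only [← Finset.sum_product']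
  let P := Fin (n + 2) × Fin (n + 3)
  let S : Finset P := {ij : P | (ij.2 : ℕ) ≤ (ij.1 : ℕ)}
  rw [Finset.univ_product_univ, ← Finset.sum_add_sum_compl S, ← eq_neg_iff_add_eq_zero,
    ← Finset.sum_neg_distrib]
  let φ : ∀ ij : P, ij ∈ S → P := fun ij hij =>
    (Fin.castLT ij.2 (lt_of_le_of_lt (Finset.mem_filter.mp hij).right (Fin.is_lt ij.1)),
      ij.1.succ)
  apply Finset.sum_bij φ
  · intro ij hij
    simp_rw [S, φ, Finset.compl_filter, Finset.mem_filter_univ, Fin.val_succ,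
      Fin.val_castLT] at hij ⊢
    lia
  · rintro ⟨i, j⟩ hij ⟨i', j'⟩ hij' h
    rw [Prod.mk_inj]
    exact ⟨by simpa [φ] using! congr_arg Prod.snd h,
      by simpa [φ, Fin.castSucc_castLT] using! congr_arg Fin.castSucc (congr_arg Prod.fst h)⟩
  · rintro ⟨i', j'⟩ hij'
    simp_rw [S, Finset.compl_filter, Finset.mem_filter_univ, not_le] at hij'
    refine ⟨(j'.pred <| ?_, Fin.castSucc i'), ?_, ?_⟩
    · rintro rfl
      simp only [Fin.val_zero, not_lt_zero] at hij'
    · simpa [S] using! Nat.le_sub_one_of_lt hij'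
    · simp only [φ, Fin.castLT_castSucc, Fin.succ_pred]
  · rintro ⟨i, j⟩ hij
    have hle : (j : ℕ) ≤ (i : ℕ) := by simpa [S] using! hij
    have h1 := face_face s (i := j.castLT (lt_of_le_of_lt hle i.is_lt)) (j := i) hle
    rw [Fin.castSucc_castLT] at h1
    simp only [φ]
    rw [h1]
    simp only [Fin.val_succ, Fin.val_castLT, pow_succ]
    ring

/-- The cohomology `Hⁱ(X, L_ρ)`: cocycles modulo coboundaries. -/
abbrev TwistedCohomology (ρ : CharVar (FundamentalGroup X x₀)) (i : ℕ) : Type _ :=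
  LinearMap.ker (twistedDiff ρ i) ⧸
    (twistedCoboundary ρ i).submoduleOf (LinearMap.ker (twistedDiff ρ i))

/-- The cohomology jump locus `Σⁱ_k(X) = {ρ ∈ Hom(π₁(X, x₀), ℂ*) | dim Hⁱ(X, L_ρ) ≥ k}`. -/
def jumpLocus (x₀ : X) (i k : ℕ) : Set (CharVar (FundamentalGroup X x₀)) :=
  {ρ | (k : Cardinal) ≤ Module.rank ℂ (TwistedCohomology ρ i)}

end

/-!
Let `τ` be a character of `π₁(U)` of finite order `n`, let `f : V → U` be the covering with
`f_* π₁(V) = ker τ`, and let `r` be the restriction of characters from `π₁(U)` to `π₁(V)`.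

*The covering.* Both spaces have the same universal cover, so a cochain on `V` with coefficients
in `r ρ` is a function on the lifted simplices of `U` that is equivariant under `ker τ`, and it
splits into eigenvectors of the finite cyclic group `π₁(U) / ker τ`. Hence
`Hⁱ(V, L_{rρ}) = ⨁_{j < n} Hⁱ(U, L_{ρτ^j})`
(`sumPullback_injective`, `sumPullback_surjective`, `rank_twistedCohomology_restrictChar_eq`).

*The translated component.* Let `T ∋ τ` be a component of `Σⁱ_k(U)`, let `h_j` be the minimum over
`ρ ∈ T` of `dim Hⁱ(U, L_{ρτ^j})`, and let `N = ∑ h_j`, so that `N ≥ h_0 ≥ k`. Then `r(T)` is an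
irreducible subset of `Σⁱ_N(V)` that contains `1`; it lies in a component `W ∋ 1`, which by
hypothesis is a subtorus. A subtorus is the set of characters that are trivial on the kernel of
a homomorphism `m : π₁(V) → ℤ^d` (`CharVar.mem_range_torusMap`; this uses that `ℂ*` is divisible).
So the characters `ρ` with `rρ ∈ W` are those of a quotient `Q` of `π₁(U)`, which is abelian and
finitely generated because it has a subgroup of finite index that is a quotient of `ℤ^d`
(`exists_fg_quotient`). Characters of `Q` in an irreducible set agree on torsion elements
(`CharVar.eq_of_isIrreducible`), so `T` is contained in the translate `D = τ · Hom(Q / torsion, ℂ*)`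
of a subtorus. All of `r(D)` lies in `W ⊆ Σⁱ_N(V)`, so `∑_j dim Hⁱ(U, L_{ρτ^j}) ≥ N` on `D`, while
each summand is at most `h_j` on a nonempty open subset of the irreducible set `D`. Generically on
`D`, the `j`-th dimension is therefore exactly `h_j`, and semicontinuity gives
`dim Hⁱ(U, L_ρ) ≥ h_0 ≥ k` on all of `D` (`IsIrreducible.le_of_sum_le`). As `T` is maximal, `T = D`.

*Semicontinuity.* The argument needs that `ρ ↦ dim Hⁱ(U, L_ρ)` is finite and upper semicontinuous
on the characters of a finitely generated abelian quotient `Q` of `π₁(U)`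
(`CharVar.exists_isOpen_rank_le`). Over the noetherian ring `R = ℂ[Q]`, the singular chains of `U`
with coefficients in the tautological local system form a complex of free modules `C`, and
`Hⁱ(U, L_ρ)` is the `i`-th cohomology of the functionals on `C` that are semilinear for the
evaluation `ρ : R → ℂ`. If the homology of `C` is finitely generated, then the lowest module of `C`
can be replaced by a finitely generated free one, one degree at a time, until `Hⁱ(U, L_ρ)` is
expressed by matrices with entries in `R`. Their ranks after the evaluation at `ρ` are lower
semicontinuous (`Functional.FiniteComplex.exists_rank_le`, `Matrix.exists_rank_map_le`).

*Finiteness of the homology.* That the homology with coefficients in `R` is finitely generated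
for a CW complex of finite type is `TwistedChain.smallMod_cycles`. Singular homology is
developed for this purpose by operators on chains of affine simplices in a convex set, which are
pushed forward along lifted simplices: cones give homotopy invariance and
barycentric subdivision gives excision. The cells are then attached one at a time. The homology of
a cell relative to the complement of its center is finitely generated and vanishes below the
dimension of the cell (`TwistedChain.smallMod_relCycles_puncturedCell`), so that each cell adds
finitely many generators, and none in degrees below its dimension. As every chain lies in a
skeleton, finitely many cells account for the homology in a given degree.
-/

/-! ### Chains of ordered tuples -/

noncomputable section

/-- Chains of ordered tuples with coefficients in `R`: a tuple of length `m` in `K` stands for the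
affine `(m - 1)`-simplex with these vertices. The length `m = 0` is the augmentation. -/
abbrev TupleChain (R : Type*) [CommRing R] (K : Type*) (m : ℕ) : Type _ := (Fin m → K) →₀ R

namespace TupleChain

variable {R : Type*} [CommRing R] {K K' : Type*}

variable (R) in
/-- The boundary operator, which omits one entry of a tuple at a time. -/
def bd (K : Type*) (m : ℕ) : TupleChain R K (m + 1) →ₗ[R] TupleChain R K m :=
  Finsupp.linearCombination R
    (fun v => ∑ j : Fin (m + 1), (-1 : R) ^ (j : ℕ) • Finsupp.single (v ∘ j.succAbove) 1)

variable (R) in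
/-- The cone with apex `x`, which puts `x` in front of a tuple. -/
def cone (x : K) (m : ℕ) : TupleChain R K m →ₗ[R] TupleChain R K (m + 1) :=
  Finsupp.lmapDomain R R (fun v => (Fin.cons x v : Fin (m + 1) → K))

variable (R) in
/-- The map on chains of tuples induced by a map of the entries. -/
def push (φ : K → K') (m : ℕ) : TupleChain R K m →ₗ[R] TupleChain R K' m :=
  Finsupp.lmapDomain R R (φ ∘ ·)

theorem bd_single {m : ℕ} (v : Fin (m + 1) → K) : bd R K m (Finsupp.single v 1) =
    ∑ j : Fin (m + 1), (-1 : R) ^ (j : ℕ) • Finsupp.single (v ∘ j.succAbove) 1 := by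
  simp [bd]

theorem cone_single (x : K) {m : ℕ} (v : Fin m → K) :
    cone R x m (Finsupp.single v 1) = Finsupp.single (Fin.cons x v) 1 := by
  simp [cone]

theorem push_single (φ : K → K') {m : ℕ} (v : Fin m → K) :
    push R φ m (Finsupp.single v 1) = Finsupp.single (φ ∘ v) 1 := by
  simp [push]

/-- Linear maps out of the chains of tuples agree if they agree on tuples. -/
theorem hom_ext {M : Type*} [AddCommGroup M] [Module R M] {m : ℕ}
    {f g : TupleChain R K m →ₗ[R] M}
    (h : ∀ v, f (Finsupp.single v 1) = g (Finsupp.single v 1)) : f = g :=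
  Finsupp.lhom_ext' fun v => LinearMap.ext_ring (h v)

theorem bd_cone (x : K) (m : ℕ) (c : TupleChain R K (m + 1)) :
    bd R K (m + 1) (cone R x (m + 1) c) = c - cone R x m (bd R K m c) := by
  suffices h : bd R K (m + 1) ∘ₗ cone R x (m + 1) = LinearMap.id - cone R x m ∘ₗ bd R K m from
    LinearMap.congr_fun h c
  refine hom_ext fun v => ?_
  simp only [LinearMap.comp_apply, LinearMap.sub_apply, LinearMap.id_apply, cone_single, bd_single,
    map_sum, map_smul]
  rw [Fin.sum_univ_succ]
  have h0 : (Fin.cons x v : Fin (m + 2) → K) ∘ Fin.succAbove 0 = v := by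
    funext k; simp
  have h1 (j : Fin (m + 1)) : (Fin.cons x v : Fin (m + 2) → K) ∘ Fin.succAbove j.succ =
      Fin.cons x (v ∘ j.succAbove) := by
    funext k
    refine Fin.cases ?_ (fun k => ?_) k <;> simp
  simp only [h0, h1, Fin.val_zero, pow_zero, one_smul, Fin.val_succ, pow_succ, mul_neg, mul_one,
    neg_smul, Finset.sum_neg_distrib, sub_eq_add_neg]

theorem bd_cone_zero (x : K) (c : TupleChain R K 0) :
    bd R K 0 (cone R x 0 c) = c := by
  suffices h : bd R K 0 ∘ₗ cone R x 0 = LinearMap.id from LinearMap.congr_fun h c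
  refine hom_ext fun v => ?_
  simp [cone_single, bd_single, Subsingleton.elim _ v]

theorem bd_bd (m : ℕ) (c : TupleChain R K (m + 2)) :
    bd R K m (bd R K (m + 1) c) = 0 := by
  suffices h : ∀ m, bd R K m ∘ₗ bd R K (m + 1) = 0 from LinearMap.congr_fun (h m) c
  intro m
  induction m with
  | zero =>
    refine hom_ext fun v => ?_
    rw [← Fin.cons_self_tail v, ← cone_single, LinearMap.comp_apply, bd_cone, map_sub, bd_cone_zero]
    simp
  | succ m ih =>
    refine hom_ext fun v => ?_
    rw [← Fin.cons_self_tail v, ← cone_single, LinearMap.comp_apply, bd_cone, map_sub, bd_cone,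
      ← LinearMap.comp_apply (bd R K m), ih]
    simp

theorem push_bd (φ : K → K') (m : ℕ) (c : TupleChain R K (m + 1)) :
    push R φ m (bd R K m c) = bd R K' m (push R φ (m + 1) c) := by
  suffices h : push R φ m ∘ₗ bd R K m = bd R K' m ∘ₗ push R φ (m + 1) from LinearMap.congr_fun h c
  refine hom_ext fun v => ?_
  simp only [LinearMap.comp_apply, bd_single, map_sum, map_smul, push_single]
  rfl

theorem push_cone (φ : K → K') (x : K) (m : ℕ) (c : TupleChain R K m) :
    push R φ (m + 1) (cone R x m c) = cone R (φ x) m (push R φ m c) := by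
  suffices h : push R φ (m + 1) ∘ₗ cone R x m = cone R (φ x) m ∘ₗ push R φ m from
    LinearMap.congr_fun h c
  refine hom_ext fun v => ?_
  simp only [LinearMap.comp_apply, cone_single, push_single]
  congr 1
  funext k
  refine Fin.cases ?_ (fun k => ?_) k <;> simp

theorem push_comp {K'' : Type*} (φ : K → K') (ψ : K' → K'') (m : ℕ) (c : TupleChain R K m) :
    push R ψ m (push R φ m c) = push R (ψ ∘ φ) m c := by
  suffices h : push R ψ m ∘ₗ push R φ m = push R (ψ ∘ φ) m from LinearMap.congr_fun h c
  refine hom_ext fun v => ?_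
  simp only [LinearMap.comp_apply, push_single]
  rfl

variable (R) in
/-- The subdivision operator determined by a choice of an apex `b v` for each tuple `v`: the
subdivision of a tuple is the cone with apex `b v` over the subdivision of its boundary. -/
def sd (b : ∀ m, (Fin (m + 1) → K) → K) : ∀ m, TupleChain R K m →ₗ[R] TupleChain R K m
  | 0 => LinearMap.id
  | m + 1 => Finsupp.linearCombination R
      (fun v => cone R (b m v) m (sd b m (bd R K m (Finsupp.single v 1))))

/-- The chain homotopy between two chain maps `f` and `g` that coincide on the augmentation,
determined by a choice of an apex for each tuple. -/
def homotopy (f g : ∀ m, TupleChain R K m →ₗ[R] TupleChain R K' m)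
    (b : ∀ m, (Fin (m + 1) → K) → K') : ∀ m, TupleChain R K m →ₗ[R] TupleChain R K' (m + 1)
  | 0 => 0
  | m + 1 => Finsupp.linearCombination R
      (fun v => cone R (b m v) (m + 1) (f (m + 1) (Finsupp.single v 1) -
        g (m + 1) (Finsupp.single v 1) - homotopy f g b m (bd R K m (Finsupp.single v 1))))

theorem sd_succ_single (b : ∀ m, (Fin (m + 1) → K) → K) {m : ℕ} (v : Fin (m + 1) → K) :
    sd R b (m + 1) (Finsupp.single v 1) =
      cone R (b m v) m (sd R b m (bd R K m (Finsupp.single v 1))) := by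
  simp [sd]

theorem homotopy_succ_single (f g : ∀ m, TupleChain R K m →ₗ[R] TupleChain R K' m)
    (b : ∀ m, (Fin (m + 1) → K) → K') {m : ℕ} (v : Fin (m + 1) → K) :
    homotopy f g b (m + 1) (Finsupp.single v 1) =
      cone R (b m v) (m + 1) (f (m + 1) (Finsupp.single v 1) -
        g (m + 1) (Finsupp.single v 1) - homotopy f g b m (bd R K m (Finsupp.single v 1))) := by
  simp [homotopy]

theorem bd_sd (b : ∀ m, (Fin (m + 1) → K) → K) (m : ℕ) (c : TupleChain R K (m + 1)) :
    bd R K m (sd R b (m + 1) c) = sd R b m (bd R K m c) := by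
  suffices h : ∀ m, bd R K m ∘ₗ sd R b (m + 1) = sd R b m ∘ₗ bd R K m from
    LinearMap.congr_fun (h m) c
  intro m
  refine hom_ext fun v => ?_
  rw [LinearMap.comp_apply, LinearMap.comp_apply, sd_succ_single]
  induction m with
  | zero => rw [bd_cone_zero]
  | succ m ih =>
    have h : bd R K m ∘ₗ sd R b (m + 1) = sd R b m ∘ₗ bd R K m := hom_ext fun w => by
      rw [LinearMap.comp_apply, LinearMap.comp_apply, sd_succ_single, ih]
    rw [bd_cone, ← LinearMap.comp_apply (bd R K m), h, LinearMap.comp_apply, bd_bd]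
    simp

theorem bd_homotopy (f g : ∀ m, TupleChain R K m →ₗ[R] TupleChain R K' m)
    (b : ∀ m, (Fin (m + 1) → K) → K')
    (hf : ∀ m c, bd R K' m (f (m + 1) c) = f m (bd R K m c))
    (hg : ∀ m c, bd R K' m (g (m + 1) c) = g m (bd R K m c)) (h0 : f 0 = g 0) (m : ℕ)
    (c : TupleChain R K (m + 1)) :
    bd R K' (m + 1) (homotopy f g b (m + 1) c) =
      f (m + 1) c - g (m + 1) c - homotopy f g b m (bd R K m c) := by
  suffices h : ∀ m, bd R K' (m + 1) ∘ₗ homotopy f g b (m + 1) =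
      f (m + 1) - g (m + 1) - homotopy f g b m ∘ₗ bd R K m from LinearMap.congr_fun (h m) c
  intro m
  induction m with
  | zero =>
    refine hom_ext fun v => ?_
    rw [LinearMap.comp_apply, homotopy_succ_single, bd_cone]
    simp only [map_sub, hf, hg, h0, homotopy]
    simp
  | succ m ih =>
    refine hom_ext fun v => ?_
    rw [LinearMap.comp_apply, homotopy_succ_single, bd_cone]
    simp only [map_sub, hf, hg]
    rw [← LinearMap.comp_apply (bd R K' (m + 1)), ih]
    simp [bd_bd]

theorem push_sd (φ : K → K') (b : ∀ m, (Fin (m + 1) → K) → K) (b' : ∀ m, (Fin (m + 1) → K') → K')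
    (h : ∀ m v, φ (b m v) = b' m (φ ∘ v)) (m : ℕ) (c : TupleChain R K m) :
    push R φ m (sd R b m c) = sd R b' m (push R φ m c) := by
  suffices h : ∀ m, push R φ m ∘ₗ sd R b m = sd R b' m ∘ₗ push R φ m from
    LinearMap.congr_fun (h m) c
  intro m
  induction m with
  | zero => rfl
  | succ m ih =>
    refine hom_ext fun v => ?_
    rw [LinearMap.comp_apply, LinearMap.comp_apply, sd_succ_single, push_single, sd_succ_single,
      push_cone, h, ← LinearMap.comp_apply (push R φ m), ih, LinearMap.comp_apply, push_bd,
      push_single]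

theorem push_homotopy {L L' : Type*} (φ : K → L) (φ' : K' → L')
    (f g : ∀ m, TupleChain R K m →ₗ[R] TupleChain R K' m)
    (f' g' : ∀ m, TupleChain R L m →ₗ[R] TupleChain R L' m)
    (b : ∀ m, (Fin (m + 1) → K) → K') (b' : ∀ m, (Fin (m + 1) → L) → L')
    (hf : ∀ m c, push R φ' m (f m c) = f' m (push R φ m c))
    (hg : ∀ m c, push R φ' m (g m c) = g' m (push R φ m c))
    (h : ∀ m v, φ' (b m v) = b' m (φ ∘ v)) (m : ℕ) (c : TupleChain R K m) :
    push R φ' (m + 1) (homotopy f g b m c) = homotopy f' g' b' m (push R φ m c) := by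
  suffices h : ∀ m, push R φ' (m + 1) ∘ₗ homotopy f g b m = homotopy f' g' b' m ∘ₗ push R φ m from
    LinearMap.congr_fun (h m) c
  intro m
  induction m with
  | zero => simp [homotopy]
  | succ m ih =>
    refine hom_ext fun v => ?_
    rw [LinearMap.comp_apply, LinearMap.comp_apply, homotopy_succ_single, push_single,
      homotopy_succ_single, push_cone, h, map_sub (push R φ' (m + 1)), map_sub (push R φ' (m + 1)),
      hf, hg, ← LinearMap.comp_apply (push R φ' (m + 1)), ih, LinearMap.comp_apply, push_bd,
      push_single]

end TupleChain

end

/-! ### Affine simplices and maps lifted to the universal cover -/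

noncomputable section

section Affine

variable {E : Type*} [AddCommGroup E] [Module ℝ E] [TopologicalSpace E] [ContinuousAdd E]
  [ContinuousSMul ℝ E] {K : Set E} (hK : Convex ℝ K)

/-- The affine simplex in a convex set `K` with given vertices. -/
def affSimplex {n : ℕ} (v : Fin (n + 1) → K) : C(Simp n, K) where
  toFun t := ⟨∑ i, t i • (v i : E), hK.sum_mem (fun i _ => t.2.1 i) t.2.2 fun i _ => (v i).2⟩
  continuous_toFun := by
    refine Continuous.subtype_mk (continuous_finsetSum _ fun i _ => ?_) _
    exact ((continuous_apply i).comp continuous_subtype_val).smul continuous_const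

theorem coe_affSimplex {n : ℕ} (v : Fin (n + 1) → K) (t : Simp n) :
    (affSimplex hK v t : E) = ∑ i, t i • (v i : E) := rfl

/-- The barycenter of an affine simplex. -/
def bary (n : ℕ) (v : Fin (n + 1) → K) : K := affSimplex hK v stdSimplex.barycenter

theorem affSimplex_comp_faceMap {n : ℕ} (v : Fin (n + 2) → K) (j : Fin (n + 2)) :
    (affSimplex hK v).comp (faceMap n j) = affSimplex hK (v ∘ j.succAbove) := by
  ext t
  simp only [ContinuousMap.comp_apply, coe_affSimplex, Function.comp_apply]
  have h (i : Fin (n + 2)) : (faceMap n j t) i = ∑ k with j.succAbove k = i, t k := by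
    simp only [faceMap, ContinuousMap.coe_mk, stdSimplex.map_coe]
    rw [FunOnFinite.linearMap_apply_apply]
  simp only [h, Finset.sum_smul]
  rw [← Finset.sum_fiberwise (Finset.univ : Finset (Fin (n + 1))) j.succAbove]
  refine Finset.sum_congr rfl fun i _ => Finset.sum_congr rfl fun k hk => ?_
  rw [(Finset.mem_filter.mp hk).2]

theorem affSimplex_comp {n m : ℕ} (v : Fin (n + 1) → K) (w : Fin (m + 1) → Simp n) :
    (affSimplex hK v).comp (affSimplex (convex_stdSimplex ℝ _) w) =
      affSimplex hK (affSimplex hK v ∘ w) := by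
  ext t
  simp only [ContinuousMap.comp_apply, coe_affSimplex, Function.comp_apply]
  have h (i : Fin (n + 1)) : (affSimplex (convex_stdSimplex ℝ _) w t) i = ∑ k, t k * w k i := by
    change (∑ k, t k • (w k : Fin (n + 1) → ℝ)) i = _
    simp [Finset.sum_apply]
  simp only [h, Finset.sum_smul, Finset.smul_sum]
  rw [Finset.sum_comm]
  simp only [mul_smul]

/-- The vertices of the standard simplex. -/
abbrev vertices (n : ℕ) : Fin (n + 1) → Simp n := stdSimplex.vertex

theorem affSimplex_vertices (n : ℕ) :
    affSimplex (convex_stdSimplex ℝ _) (vertices n) = ContinuousMap.id (Simp n) := by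
  ext t i
  change (∑ k, t k • (vertices n k : Fin (n + 1) → ℝ)) i = t i
  simp [Finset.sum_apply, Pi.single_apply]

theorem affSimplex_comp_vertices {n : ℕ} (v : Fin (n + 1) → K) :
    affSimplex hK v ∘ vertices n = v := by
  funext i
  ext
  simp [coe_affSimplex, Pi.single_apply, ite_smul]

theorem bary_affSimplex {n m : ℕ} (v : Fin (n + 1) → K) (w : Fin (m + 1) → Simp n) :
    affSimplex hK v (bary (convex_stdSimplex ℝ _) m w) = bary hK m (affSimplex hK v ∘ w) := by
  rw [bary, bary, ← affSimplex_comp]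
  rfl

end Affine

instance (n : ℕ) : ContractibleSpace (Simp n) :=
  (convex_stdSimplex ℝ (Fin (n + 1))).contractibleSpace ⟨_, (vertices n 0).2⟩

instance (n : ℕ) : LocallyPathConnectedSpace (Simp n) :=
  (convex_stdSimplex ℝ (Fin (n + 1))).locallyPathConnectedSpace

/-- A continuous map from `K` to the universal cover of `(X, x₀)`, encoded in the same way as a
singular simplex of the universal cover. -/
structure LiftedMap {X : Type*} [TopologicalSpace X] (x₀ : X) (K : Type*) [TopologicalSpace K] where
  /-- the underlying map to `X` -/
  map : C(K, X)
  /-- the lift to the universal cover -/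
  lift (p : K) : Path.Homotopic.Quotient x₀ (map p)
  /-- the lift is continuous -/
  lift_trans (p q : K) (δ : Path p q) : lift q = (lift p).trans (.mk (δ.map map.continuous))

namespace LiftedMap

variable {X : Type*} [TopologicalSpace X] {x₀ : X} {K L : Type*} [TopologicalSpace K]
  [TopologicalSpace L]

/-- The restriction of a lifted map along a singular simplex. -/
def simplex (s : LiftedMap x₀ K) {n : ℕ} (α : C(Simp n, K)) : LiftedSimplex x₀ n where
  simplex := s.map.comp α
  lift p := s.lift (α p)
  lift_trans _ _ δ := s.lift_trans _ _ (δ.map α.continuous)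

/-- The restriction of a lifted map along a continuous map. -/
def comp (s : LiftedMap x₀ K) (α : C(L, K)) : LiftedMap x₀ L where
  map := s.map.comp α
  lift p := s.lift (α p)
  lift_trans _ _ δ := s.lift_trans _ _ (δ.map α.continuous)

/-- A deck transformation applied to a lifted map. -/
def deck (g : FundamentalGroup X x₀) (s : LiftedMap x₀ K) : LiftedMap x₀ K where
  map := s.map
  lift p := g.toPath.trans (s.lift p)
  lift_trans p q δ := by
    rw [s.lift_trans p q δ]
    exact (Path.Homotopic.Quotient.trans_assoc _ _ _).symm

/-- Two lifts of the same map agree if they agree at one point. -/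
theorem ext_of_heq [PathConnectedSpace K] {s s' : LiftedMap x₀ K} (h : s.map = s'.map) (k : K)
    (hk : s.lift k ≍ s'.lift k) : s = s' := by
  obtain ⟨c, l, hl⟩ := s
  obtain ⟨c', l', hl'⟩ := s'
  obtain rfl : c = c' := h
  have hk' : l k = l' k := eq_of_heq hk
  have : l = l' := by
    funext p
    have δ := PathConnectedSpace.somePath k p
    rw [hl k p δ, hl' k p δ, hk']
  subst this
  rfl

/-- On a simply connected space, a map lifts to the universal cover with a prescribed value at a
point. -/
def ofPoint [SimplyConnectedSpace K] (c : C(K, X)) (k : K)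
    (l : Path.Homotopic.Quotient x₀ (c k)) : LiftedMap x₀ K where
  map := c
  lift p := l.trans (.mk ((PathConnectedSpace.somePath k p).map c.continuous))
  lift_trans p q δ := by
    rw [Path.Homotopic.Quotient.trans_assoc, ← Path.Homotopic.Quotient.mk_trans, ← Path.map_trans]
    congr 1
    exact Path.Homotopic.Quotient.eq.mpr ((SimplyConnectedSpace.paths_homotopic _ _).map c)

theorem ofPoint_lift [SimplyConnectedSpace K] (c : C(K, X)) (k : K)
    (l : Path.Homotopic.Quotient x₀ (c k)) : (ofPoint c k l).lift k = l := by
  have : (Path.Homotopic.Quotient.mk ((PathConnectedSpace.somePath k k).map c.continuous)) =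
      .refl (c k) := by
    have h := (SimplyConnectedSpace.paths_homotopic
      (PathConnectedSpace.somePath k k) (Path.refl k)).map c
    exact Path.Homotopic.Quotient.eq.mpr h
  simp only [ofPoint, this]
  exact Path.Homotopic.Quotient.trans_refl _

end LiftedMap

namespace LiftedSimplex

variable {X : Type*} [TopologicalSpace X] {x₀ : X} {n : ℕ}

/-- A lifted simplex as a lifted map on the standard simplex. -/
def toMap (s : LiftedSimplex x₀ n) : LiftedMap x₀ (Simp n) := ⟨s.simplex, s.lift, s.lift_trans⟩

theorem toMap_simplex_id (s : LiftedSimplex x₀ n) :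
    s.toMap.simplex (ContinuousMap.id (Simp n)) = s := rfl

theorem ext_of_heq {s s' : LiftedSimplex x₀ n} (h : s.simplex = s'.simplex) (p : Simp n)
    (hp : s.lift p ≍ s'.lift p) : s = s' := by
  have := LiftedMap.ext_of_heq (s := s.toMap) (s' := s'.toMap) h p hp
  obtain ⟨c, l, hl⟩ := s
  simp only [toMap, LiftedMap.mk.injEq] at this
  obtain ⟨rfl, h2⟩ := this
  cases h2
  rfl

theorem deck_deck (g h : FundamentalGroup X x₀) (s : LiftedSimplex x₀ n) :
    deck g (deck h s) = deck (h * g) s := by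
  simp only [deck, LiftedSimplex.mk.injEq, heq_eq_eq, true_and]
  funext p
  exact (Path.Homotopic.Quotient.trans_assoc _ _ _).symm

theorem deck_one (s : LiftedSimplex x₀ n) : deck 1 s = s := by
  obtain ⟨c, l, hl⟩ := s
  simp only [deck, LiftedSimplex.mk.injEq, heq_eq_eq, true_and]
  funext p
  exact Path.Homotopic.Quotient.refl_trans _

/-- Deck transformations act freely. -/
theorem deck_injective (s : LiftedSimplex x₀ n) :
    Function.Injective (fun g : FundamentalGroup X x₀ => deck g s) := by
  intro g h hgh
  simp only [deck, LiftedSimplex.mk.injEq, heq_eq_eq, true_and] at hgh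
  have := congrArg (fun q => Path.Homotopic.Quotient.trans q (s.lift (vertices n 0)).symm)
    (congrFun hgh (vertices n 0))
  simp only [Path.Homotopic.Quotient.trans_assoc] at this
  rw [Path.Homotopic.Quotient.trans_symm, Path.Homotopic.Quotient.trans_refl,
    Path.Homotopic.Quotient.trans_refl] at this
  exact this

/-- Deck transformations act transitively on the lifts of a singular simplex. -/
theorem exists_deck_eq {s s' : LiftedSimplex x₀ n} (h : s.simplex = s'.simplex) :
    ∃ g : FundamentalGroup X x₀, s = deck g s' := by
  obtain ⟨c, l, hl⟩ := s
  obtain ⟨c', l', hl'⟩ := s'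
  obtain rfl : c = c' := h
  refine ⟨FundamentalGroup.fromPath ((l (vertices n 0)).trans (l' (vertices n 0)).symm), ?_⟩
  refine ext_of_heq rfl (vertices n 0) (heq_of_eq ?_)
  change l _ = Path.Homotopic.Quotient.trans (Path.Homotopic.Quotient.trans _ _) _
  rw [Path.Homotopic.Quotient.trans_assoc, Path.Homotopic.Quotient.symm_trans,
    Path.Homotopic.Quotient.trans_refl]

end LiftedSimplex

end

/-! ### Singular chains with coefficients in a rank one local system -/

noncomputable section

variable {X : Type*} [TopologicalSpace X] {x₀ : X}

/-- The singular simplices of `X` that lift to the universal cover of `(X, x₀)`, that is, those in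
the path component of `x₀`. -/
abbrev Liftable (x₀ : X) (n : ℕ) : Type _ :=
  Set.range (LiftedSimplex.simplex : LiftedSimplex x₀ n → C(Simp n, X))

/-- A chosen lift of a singular simplex to the universal cover. -/
def Liftable.lifted {n : ℕ} (σ : Liftable x₀ n) : LiftedSimplex x₀ n := σ.2.choose

theorem Liftable.lifted_simplex {n : ℕ} (σ : Liftable x₀ n) : σ.lifted.simplex = σ.1 :=
  σ.2.choose_spec

/-- The singular simplex underlying a lifted simplex. -/
abbrev LiftedSimplex.base {n : ℕ} (s : LiftedSimplex x₀ n) : Liftable x₀ n := ⟨s.simplex, s, rfl⟩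

/-- The singular chains of `X` with coefficients in a local system of free `R`-modules of rank
one, trivialized on every singular simplex by its chosen lift to the universal cover. -/
abbrev TwistedChain (R : Type*) [CommRing R] (x₀ : X) (n : ℕ) : Type _ := Liftable x₀ n →₀ R

namespace TwistedChain

open LiftedSimplex

variable {R : Type*} [CommRing R] (θ : FundamentalGroup X x₀ →* Rˣ) {n : ℕ}

/-- The deck transformation comparing a lifted simplex to the chosen lift. -/
def comparison (s : LiftedSimplex x₀ n) : FundamentalGroup X x₀ :=
  (exists_deck_eq (s := s) (s' := (Liftable.lifted s.base))
    (Liftable.lifted_simplex s.base).symm).choose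

theorem deck_comparison (s : LiftedSimplex x₀ n) :
    s = deck (comparison s) (Liftable.lifted s.base) :=
  (exists_deck_eq (s := s) (s' := (Liftable.lifted s.base))
    (Liftable.lifted_simplex s.base).symm).choose_spec

/-- The chain given by a lifted simplex, for the local system with monodromy `θ`. -/
def of (s : LiftedSimplex x₀ n) : TwistedChain R x₀ n :=
  Finsupp.single s.base (θ (comparison s) : R)

theorem of_deck (g : FundamentalGroup X x₀) (s : LiftedSimplex x₀ n) :
    of θ (deck g s) = (θ g : R) • of θ s := by
  have h : comparison (deck g s) = comparison s * g := by
    apply deck_injective (Liftable.lifted s.base)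
    change deck (comparison (deck g s))
      (Liftable.lifted (deck g s).base) = _
    beta_reduce
    rw [← deck_comparison, ← deck_deck, ← deck_comparison]
  simp only [of, h, map_mul, Finsupp.smul_single, smul_eq_mul, Units.val_mul, mul_comm]
  rfl

theorem of_lifted (σ : Liftable x₀ n) : of θ σ.lifted = Finsupp.single σ 1 := by
  have hσ : σ.lifted.base = σ :=
    Subtype.ext σ.lifted_simplex
  have h : comparison σ.lifted = 1 := by
    apply deck_injective σ.lifted
    have := deck_comparison σ.lifted
    rw [hσ] at this
    beta_reduce
    rw [← this, deck_one]
  rw [of, h, hσ, map_one, Units.val_one]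

variable {θ}

theorem hom_ext {M : Type*} [AddCommGroup M] [Module R M] {f g : TwistedChain R x₀ n →ₗ[R] M}
    (h : ∀ s, f (of θ s) = g (of θ s)) : f = g := by
  refine Finsupp.lhom_ext' fun σ => LinearMap.ext_ring ?_
  simpa [of_lifted] using h σ.lifted

variable (θ)

/-- A function on lifted simplices that transforms by `θ` under deck transformations extends to a
linear map on twisted chains. -/
def lift {M : Type*} [AddCommGroup M] [Module R M] (f : LiftedSimplex x₀ n → M) :
    TwistedChain R x₀ n →ₗ[R] M :=
  Finsupp.linearCombination R (fun σ => f σ.lifted)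

theorem lift_of {M : Type*} [AddCommGroup M] [Module R M] (f : LiftedSimplex x₀ n → M)
    (hf : ∀ g s, f (deck g s) = (θ g : R) • f s) (s : LiftedSimplex x₀ n) :
    lift f (of θ s) = f s := by
  conv_rhs => rw [deck_comparison s, hf]
  simp [lift, of]

/-- The boundary operator of the twisted chains. -/
def bd (n : ℕ) : TwistedChain R x₀ (n + 1) →ₗ[R] TwistedChain R x₀ n :=
  lift (fun s => ∑ j : Fin (n + 2), (-1 : R) ^ (j : ℕ) • of θ (s.face j))

theorem bd_of (s : LiftedSimplex x₀ (n + 1)) :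
    bd θ n (of θ s) = ∑ j : Fin (n + 2), (-1 : R) ^ (j : ℕ) • of θ (s.face j) := by
  refine lift_of θ _ (fun g s => ?_) s
  rw [Finset.smul_sum]
  refine Finset.sum_congr rfl fun j _ => ?_
  rw [smul_comm, ← of_deck]
  rfl

variable (R) in
/-- The chains whose simplices lie in the subset `A`. -/
def inside (x₀ : X) (n : ℕ) (A : Set X) : Submodule R (TwistedChain R x₀ n) :=
  Finsupp.supported R R {σ | Set.range σ.1 ⊆ A}

theorem of_mem_inside {s : LiftedSimplex x₀ n} {A : Set X} (h : Set.range s.simplex ⊆ A) :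
    of θ s ∈ inside R x₀ n A :=
  Finsupp.single_mem_supported R _ h

theorem inside_mono {A B : Set X} (h : A ⊆ B) : inside R x₀ n A ≤ inside R x₀ n B :=
  Finsupp.supported_mono fun _ hσ => Set.Subset.trans hσ h

theorem inside_inter (A B : Set X) :
    inside R x₀ n (A ∩ B) = inside R x₀ n A ⊓ inside R x₀ n B := by
  rw [inside, inside, inside, ← Finsupp.supported_inter]
  congr 1
  ext σ
  exact Set.subset_inter_iff

theorem inside_univ : inside R x₀ n Set.univ = ⊤ := by
  simp [inside]

/-- To check a linear condition on the chains inside `A` it suffices to check it on the lifted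
simplices inside `A`. -/
theorem inside_le {A : Set X} {P : Submodule R (TwistedChain R x₀ n)}
    (h : ∀ s : LiftedSimplex x₀ n, Set.range s.simplex ⊆ A → of θ s ∈ P) :
    inside R x₀ n A ≤ P := by
  rw [inside, Finsupp.supported_eq_span_single, Submodule.span_le]
  rintro _ ⟨σ, hσ, rfl⟩
  beta_reduce
  rw [SetLike.mem_coe, ← of_lifted θ]
  exact h _ (by rw [σ.lifted_simplex]; exact hσ)

theorem bd_mem_inside {A : Set X} {c : TwistedChain R x₀ (n + 1)}
    (hc : c ∈ inside R x₀ (n + 1) A) : bd θ n c ∈ inside R x₀ n A := by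
  suffices h : inside R x₀ (n + 1) A ≤ (inside R x₀ n A).comap (bd θ n) from h hc
  refine inside_le θ fun s hs => ?_
  rw [Submodule.mem_comap, bd_of]
  refine Submodule.sum_mem _ fun j _ => Submodule.smul_mem _ _ (of_mem_inside θ ?_)
  exact (Set.range_comp_subset_range (faceMap n j) s.simplex).trans hs

section Affine

variable {E : Type*} [AddCommGroup E] [Module ℝ E] [TopologicalSpace E] [ContinuousAdd E]
  [ContinuousSMul ℝ E] {K : Set E} (hK : Convex ℝ K)

/-- A lifted map on a convex set turns affine simplices into twisted chains. -/
def ofTuples (s : LiftedMap x₀ K) (n : ℕ) : TupleChain R K (n + 1) →ₗ[R] TwistedChain R x₀ n :=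
  Finsupp.linearCombination R (fun v => of θ (s.simplex (affSimplex hK v)))

theorem ofTuples_single (s : LiftedMap x₀ K) (v : Fin (n + 1) → K) :
    ofTuples θ hK s n (Finsupp.single v 1) = of θ (s.simplex (affSimplex hK v)) := by
  simp [ofTuples]

theorem bd_ofTuples (s : LiftedMap x₀ K) (n : ℕ) (c : TupleChain R K (n + 2)) :
    bd θ n (ofTuples θ hK s (n + 1) c) = ofTuples θ hK s n (TupleChain.bd R K (n + 1) c) := by
  suffices h : bd θ n ∘ₗ ofTuples θ hK s (n + 1) =
      ofTuples θ hK s n ∘ₗ TupleChain.bd R K (n + 1) from LinearMap.congr_fun h c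
  refine TupleChain.hom_ext fun v => ?_
  simp only [LinearMap.comp_apply, ofTuples_single, bd_of, TupleChain.bd_single, map_sum, map_smul]
  refine Finset.sum_congr rfl fun j _ => ?_
  rw [← affSimplex_comp_faceMap hK v j]
  rfl

theorem ofTuples_deck (g : FundamentalGroup X x₀) (s : LiftedMap x₀ K) (n : ℕ)
    (c : TupleChain R K (n + 1)) :
    ofTuples θ hK (s.deck g) n c = (θ g : R) • ofTuples θ hK s n c := by
  suffices h : ofTuples θ hK (s.deck g) n = (θ g : R) • ofTuples θ hK s n from
    LinearMap.congr_fun h c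
  refine TupleChain.hom_ext fun v => ?_
  rw [LinearMap.smul_apply, ofTuples_single, ofTuples_single, ← of_deck]
  rfl

theorem ofTuples_mem_inside (s : LiftedMap x₀ K) {A : Set X} (h : Set.range s.map ⊆ A) (n : ℕ)
    (c : TupleChain R K (n + 1)) : ofTuples θ hK s n c ∈ inside R x₀ n A := by
  induction c using Finsupp.induction_linear with
  | zero => simp
  | add f g hf hg => rw [map_add]; exact add_mem hf hg
  | single v r =>
    rw [← mul_one r, ← smul_eq_mul, ← Finsupp.smul_single, map_smul, ofTuples_single]
    exact Submodule.smul_mem _ _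
      (of_mem_inside θ ((Set.range_comp_subset_range (affSimplex hK v) s.map).trans h))

/-- Naturality of `ofTuples` for maps between convex sets that are compatible with affine
simplices. -/
theorem ofTuples_comp {E' : Type*} [AddCommGroup E'] [Module ℝ E'] [TopologicalSpace E']
    [ContinuousAdd E'] [ContinuousSMul ℝ E'] {L : Set E'} (hL : Convex ℝ L) (s : LiftedMap x₀ K)
    (φ : C(L, K)) (hφ : ∀ v : Fin (n + 1) → L, φ.comp (affSimplex hL v) = affSimplex hK (φ ∘ v))
    (c : TupleChain R L (n + 1)) :
    ofTuples θ hL (s.comp φ) n c = ofTuples θ hK s n (TupleChain.push R φ (n + 1) c) := by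
  suffices h : ofTuples θ hL (s.comp φ) n = ofTuples θ hK s n ∘ₗ TupleChain.push R φ (n + 1) from
    LinearMap.congr_fun h c
  refine TupleChain.hom_ext fun v => ?_
  rw [LinearMap.comp_apply, TupleChain.push_single, ofTuples_single, ofTuples_single, ← hφ]
  rfl

end Affine

/-- The tuple of vertices of the standard simplex, as a chain. -/
abbrev fundamentalChain (R : Type*) [CommRing R] (n : ℕ) : TupleChain R (Simp n) (n + 1) :=
  Finsupp.single (vertices n) 1

theorem ofTuples_fundamentalChain (s : LiftedSimplex x₀ n) :
    ofTuples θ (convex_stdSimplex ℝ _) s.toMap n (fundamentalChain R n) = of θ s := by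
  rw [ofTuples_single, affSimplex_vertices, toMap_simplex_id]

theorem bd_bd (c : TwistedChain R x₀ (n + 2)) : bd θ n (bd θ (n + 1) c) = 0 := by
  suffices h : bd θ n ∘ₗ bd θ (n + 1) = 0 from LinearMap.congr_fun h c
  refine hom_ext (θ := θ) fun s => ?_
  rw [LinearMap.comp_apply, ← ofTuples_fundamentalChain, bd_ofTuples, bd_ofTuples,
    TupleChain.bd_bd]
  simp

theorem faceMap_comp_vertices (j : Fin (n + 2)) :
    faceMap n j ∘ vertices n = vertices (n + 1) ∘ j.succAbove := by
  have := affSimplex_comp_faceMap (convex_stdSimplex ℝ _) (vertices (n + 1)) j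
  rw [affSimplex_vertices, ContinuousMap.id_comp] at this
  rw [this, affSimplex_comp_vertices]

theorem bd_fundamentalChain : TupleChain.bd R (Simp (n + 1)) (n + 1) (fundamentalChain R (n + 1)) =
    ∑ j : Fin (n + 2), (-1 : R) ^ (j : ℕ) •
      TupleChain.push R (faceMap n j) (n + 1) (fundamentalChain R n) := by
  rw [TupleChain.bd_single]
  simp only [TupleChain.push_single, faceMap_comp_vertices]

theorem faceMap_comp_affSimplex {m : ℕ} (j : Fin (n + 2)) (v : Fin (m + 1) → Simp n) :
    (faceMap n j).comp (affSimplex (convex_stdSimplex ℝ _) v) =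
      affSimplex (convex_stdSimplex ℝ _) (faceMap n j ∘ v) := by
  have h : faceMap n j =
      affSimplex (convex_stdSimplex ℝ _) (vertices (n + 1) ∘ j.succAbove) := by
    rw [← affSimplex_comp_faceMap, affSimplex_vertices, ContinuousMap.id_comp]
  rw [h, affSimplex_comp]

end TwistedChain

end

noncomputable section

namespace TwistedChain

open LiftedSimplex Set

variable {X : Type*} [TopologicalSpace X] {x₀ : X} {R : Type*} [CommRing R]
  (θ : FundamentalGroup X x₀ →* Rˣ)

/-- The boundary of a chain lies inside `E`; in degree `0` there is no condition. -/
def bdInside : (n : ℕ) → Set X → Submodule R (TwistedChain R x₀ n)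
  | 0, _ => ⊤
  | n + 1, E => (inside R x₀ n E).comap (bd θ n)

/-- The relative cycles of the pair `(D, E)`. -/
def relCycles (n : ℕ) (D E : Set X) : Submodule R (TwistedChain R x₀ n) :=
  inside R x₀ n D ⊓ bdInside θ n E

/-- The boundaries of chains inside `D`. -/
def boundaries (n : ℕ) (D : Set X) : Submodule R (TwistedChain R x₀ n) :=
  (inside R x₀ (n + 1) D).map (bd θ n)

/-! ### Homotopy invariance -/

/-- The prism over the standard simplex. -/
abbrev prism (n : ℕ) : Set ((Fin (n + 1) → ℝ) × ℝ) := stdSimplex ℝ (Fin (n + 1)) ×ˢ Icc 0 1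

theorem convex_prism (n : ℕ) : Convex ℝ (prism n) := (convex_stdSimplex ℝ _).prod (convex_Icc 0 1)

instance (n : ℕ) : ContractibleSpace (prism n) :=
  (convex_prism n).contractibleSpace ⟨(_, 0), (vertices n 0).2, by simp⟩

/-- The inclusion of the standard simplex in the prism at height `t`. -/
def level (n : ℕ) (t : Icc (0 : ℝ) 1) : C(Simp n, prism n) where
  toFun p := ⟨(p.1, t.1), p.2, t.2⟩
  continuous_toFun := by fun_prop

/-- The face map of the prism over a face map of the standard simplex. -/
def prismFace (n : ℕ) (j : Fin (n + 2)) : C(prism n, prism (n + 1)) where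
  toFun p := ⟨((faceMap n j ⟨p.1.1, p.2.1⟩ : Simp (n + 1)), p.1.2), (faceMap n j _).2, p.2.2⟩
  continuous_toFun := by
    refine Continuous.subtype_mk (Continuous.prodMk ?_ (by fun_prop)) _
    exact continuous_subtype_val.comp ((faceMap n j).continuous.comp (by fun_prop))

theorem level_comp_affSimplex {n m : ℕ} (t : Icc (0 : ℝ) 1) (v : Fin (m + 1) → Simp n) :
    (level n t).comp (affSimplex (convex_stdSimplex ℝ _) v) =
      affSimplex (convex_prism n) (level n t ∘ v) := by
  ext p
  · simp [level, coe_affSimplex, Prod.fst_sum]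
  · have : ∑ x, p x = 1 := p.2.2
    simp [level, coe_affSimplex, Prod.snd_sum, ← Finset.sum_mul, this]

theorem prismFace_comp_affSimplex {n m : ℕ} (j : Fin (n + 2)) (v : Fin (m + 1) → prism n) :
    (prismFace n j).comp (affSimplex (convex_prism n) v) =
      affSimplex (convex_prism (n + 1)) (prismFace n j ∘ v) := by
  ext p
  · have e : (⟨(affSimplex (convex_prism n) v p).1.1, (affSimplex (convex_prism n) v p).2.1⟩ :
        Simp n) = affSimplex (convex_stdSimplex ℝ _) (fun i => ⟨(v i).1.1, (v i).2.1⟩) p :=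
      Subtype.ext (by simp [coe_affSimplex, Prod.fst_sum])
    have h := DFunLike.congr_fun
      (faceMap_comp_affSimplex j (fun i => (⟨(v i).1.1, (v i).2.1⟩ : Simp n))) p
    change (faceMap n j ⟨(affSimplex (convex_prism n) v p).1.1, _⟩ : Fin (n + 2) → ℝ) _ =
      (∑ i, p i • (prismFace n j (v i)).1).1 _
    rw [e, ← ContinuousMap.comp_apply, h, Prod.fst_sum]
    rfl
  · simp [prismFace, coe_affSimplex, Prod.snd_sum]

section Prism

variable {A : Set X} (h : X → ℝ → X)
  (hc : ContinuousOn (fun p : X × ℝ => h p.1 p.2) (A ×ˢ Icc 0 1)) (h0 : ∀ x ∈ A, h x 0 = x)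

/-- The lifted map on the prism given by a homotopy of the subset `A` and a lifted simplex in
`A`. -/
def prismMap {n : ℕ} (s : LiftedSimplex x₀ n) (hs : range s.simplex ⊆ A) :
    LiftedMap x₀ (prism n) :=
  .ofPoint
    ⟨fun p => h (s.simplex ⟨p.1.1, p.2.1⟩) p.1.2, by
      refine hc.comp_continuous (f := fun p : prism n => (s.simplex ⟨p.1.1, p.2.1⟩, p.1.2)) ?_
        fun p => ⟨hs ⟨_, rfl⟩, p.2.2⟩
      exact (s.simplex.continuous.comp (by fun_prop)).prodMk (by fun_prop)⟩
    (level n 0 (vertices n 0))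
    ((s.lift (vertices n 0)).cast rfl (h0 _ (hs ⟨_, rfl⟩)))

variable {h}

theorem prismMap_level_zero {n : ℕ} (s : LiftedSimplex x₀ n) (hs : range s.simplex ⊆ A) :
    (prismMap h hc h0 s hs).comp (level n 0) = s.toMap := by
  refine LiftedMap.ext_of_heq ?_ (vertices n 0) ?_
  · ext p
    exact h0 _ (hs ⟨_, rfl⟩)
  · exact (heq_of_eq (LiftedMap.ofPoint_lift _ _ _)).trans
      (Path.Homotopic.Quotient.cast_heq _ _)

theorem prismMap_face {n : ℕ} (s : LiftedSimplex x₀ (n + 1)) (hs : range s.simplex ⊆ A)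
    (j : Fin (n + 2)) (hs' : range (s.face j).simplex ⊆ A) :
    (prismMap h hc h0 s hs).comp (prismFace n j) = prismMap h hc h0 (s.face j) hs' := by
  refine LiftedMap.ext_of_heq rfl (level n 0 (vertices n 0)) ?_
  refine HEq.trans ?_ (((Path.Homotopic.Quotient.cast_heq _ _).symm).trans
    (heq_of_eq (LiftedMap.ofPoint_lift _ _ _).symm))
  have := prismMap_level_zero hc h0 s hs
  have := congr_arg_heq (fun r : LiftedMap x₀ (Simp (n + 1)) => r.lift (faceMap n j (vertices n 0)))
    this
  exact this

theorem prismMap_deck {n : ℕ} (s : LiftedSimplex x₀ n) (hs : range s.simplex ⊆ A)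
    (g : FundamentalGroup X x₀) :
    prismMap h hc h0 (deck g s) hs = (prismMap h hc h0 s hs).deck g := by
  refine LiftedMap.ext_of_heq rfl (level n 0 (vertices n 0)) (heq_of_eq ?_)
  refine (LiftedMap.ofPoint_lift _ _ _).trans (Eq.trans ?_
    (congrArg (Path.Homotopic.Quotient.trans g.toPath) (LiftedMap.ofPoint_lift _ _ _).symm))
  apply eq_of_heq
  refine (Path.Homotopic.Quotient.cast_heq _ _).trans ?_
  have aux : ∀ {x y : X} (e : y = x) (l : Path.Homotopic.Quotient x₀ x),
      Path.Homotopic.Quotient.trans g.toPath l ≍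
        Path.Homotopic.Quotient.trans g.toPath (l.cast rfl e) := by
    rintro x _ rfl l
    rw [Path.Homotopic.Quotient.cast_rfl_rfl]
  exact aux _ _

variable (R) in
/-- The prism decomposed into tuples: a chain homotopy between the two ends. -/
def prismChain (n m : ℕ) : TupleChain R (Simp n) m →ₗ[R] TupleChain R (prism n) (m + 1) :=
  TupleChain.homotopy (TupleChain.push R (level n 1)) (TupleChain.push R (level n 0))
    (fun m v => level n 0 (bary (convex_stdSimplex ℝ _) m v)) m

variable (R) in
theorem push_prismFace_prismChain {n : ℕ} (j : Fin (n + 2)) (m : ℕ) (c : TupleChain R (Simp n) m) :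
    TupleChain.push R (prismFace n j) (m + 1) (prismChain R n m c) =
      prismChain R (n + 1) m (TupleChain.push R (faceMap n j) m c) := by
  refine TupleChain.push_homotopy _ _ _ _ _ _ _ _ (fun m c => ?_) (fun m c => ?_)
    (fun m v => ?_) m c
  · rw [TupleChain.push_comp, TupleChain.push_comp]; rfl
  · rw [TupleChain.push_comp, TupleChain.push_comp]; rfl
  · have := DFunLike.congr_fun (faceMap_comp_affSimplex j v) stdSimplex.barycenter
    exact congrArg (level (n + 1) 0) this

open Classical in
variable (h) in
/-- The prism operator of a homotopy. -/
def prismOp (n : ℕ) : TwistedChain R x₀ n →ₗ[R] TwistedChain R x₀ (n + 1) :=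
  lift (fun s => if hs : range s.simplex ⊆ A then
    ofTuples θ (convex_prism n) (prismMap h hc h0 s hs) (n + 1)
      (prismChain R n (n + 1) (fundamentalChain R n)) else 0)

open Classical in
variable (h) in
/-- The effect on chains of the end of a homotopy. -/
def endOp (n : ℕ) : TwistedChain R x₀ n →ₗ[R] TwistedChain R x₀ n :=
  lift (fun s => if hs : range s.simplex ⊆ A then
    of θ ((prismMap h hc h0 s hs).simplex (level n 1)) else 0)

theorem prismOp_of {n : ℕ} (s : LiftedSimplex x₀ n) (hs : range s.simplex ⊆ A) :
    prismOp θ h hc h0 n (of θ s) = ofTuples θ (convex_prism n) (prismMap h hc h0 s hs) (n + 1)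
      (prismChain R n (n + 1) (fundamentalChain R n)) := by
  rw [prismOp, lift_of, dif_pos hs]
  intro g s
  by_cases hs : range s.simplex ⊆ A
  · rw [dif_pos hs, dif_pos (by exact hs), ← ofTuples_deck, ← prismMap_deck]
  · rw [dif_neg hs, dif_neg (by exact hs), smul_zero]

theorem endOp_of {n : ℕ} (s : LiftedSimplex x₀ n) (hs : range s.simplex ⊆ A) :
    endOp θ h hc h0 n (of θ s) = of θ ((prismMap h hc h0 s hs).simplex (level n 1)) := by
  rw [endOp, lift_of, dif_pos hs]
  intro g s
  by_cases hs : range s.simplex ⊆ A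
  · rw [dif_pos hs, dif_pos (by exact hs), ← of_deck, prismMap_deck]
    rfl
  · rw [dif_neg hs, dif_neg (by exact hs), smul_zero]

theorem bd_prismOp_of {n : ℕ} (s : LiftedSimplex x₀ n) (hs : range s.simplex ⊆ A) :
    bd θ n (prismOp θ h hc h0 n (of θ s)) = endOp θ h hc h0 n (of θ s) - of θ s -
      ofTuples θ (convex_prism n) (prismMap h hc h0 s hs) n
        (prismChain R n n (TupleChain.bd R _ n (fundamentalChain R n))) := by
  rw [prismOp_of θ hc h0 s hs, bd_ofTuples, prismChain, TupleChain.bd_homotopy, map_sub, map_sub]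
  · congr 2
    · rw [endOp_of θ hc h0 s hs, TupleChain.push_single, ofTuples_single, ← level_comp_affSimplex,
        affSimplex_vertices, ContinuousMap.comp_id]
    · rw [TupleChain.push_single, ofTuples_single, ← level_comp_affSimplex,
        affSimplex_vertices, ContinuousMap.comp_id]
      have := prismMap_level_zero hc h0 s hs
      have := congrArg (fun r : LiftedMap x₀ (Simp n) => r.simplex (ContinuousMap.id _)) this
      exact congrArg (of θ) this
  · exact fun m c => (TupleChain.push_bd _ _ _).symm
  · exact fun m c => (TupleChain.push_bd _ _ _).symm
  · exact TupleChain.hom_ext fun v => by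
      rw [TupleChain.push_single, TupleChain.push_single, Subsingleton.elim (level n 1 ∘ v)]

theorem bd_prismOp_zero {c : TwistedChain R x₀ 0} (hA : c ∈ inside R x₀ 0 A) :
    bd θ 0 (prismOp θ h hc h0 0 c) = endOp θ h hc h0 0 c - c := by
  suffices H : inside R x₀ 0 A ≤ LinearMap.eqLocus (bd θ 0 ∘ₗ prismOp θ h hc h0 0)
      (endOp θ h hc h0 0 - LinearMap.id) from H hA
  refine inside_le θ fun s hs => ?_
  change bd θ 0 (prismOp θ h hc h0 0 (of θ s)) = _
  rw [bd_prismOp_of θ hc h0 s hs]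
  simp [prismChain, TupleChain.homotopy]

theorem bd_prismOp_succ {n : ℕ} {c : TwistedChain R x₀ (n + 1)} (hA : c ∈ inside R x₀ (n + 1) A) :
    bd θ (n + 1) (prismOp θ h hc h0 (n + 1) c) = endOp θ h hc h0 (n + 1) c - c -
      prismOp θ h hc h0 n (bd θ n c) := by
  suffices H : inside R x₀ (n + 1) A ≤ LinearMap.eqLocus (bd θ (n + 1) ∘ₗ prismOp θ h hc h0 (n + 1))
      (endOp θ h hc h0 (n + 1) - LinearMap.id - prismOp θ h hc h0 n ∘ₗ bd θ n) from H hA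
  refine inside_le θ fun s hs => ?_
  change bd θ (n + 1) (prismOp θ h hc h0 (n + 1) (of θ s)) = _
  rw [bd_prismOp_of θ hc h0 s hs]
  simp only [LinearMap.sub_apply, LinearMap.comp_apply, LinearMap.id_apply]
  congr 1
  rw [bd_of, bd_fundamentalChain]
  simp only [map_sum, map_smul]
  refine Finset.sum_congr rfl fun j _ => ?_
  have hs' : range (s.face j).simplex ⊆ A :=
    (range_comp_subset_range (faceMap n j) s.simplex).trans hs
  rw [prismOp_of θ hc h0 _ hs', ← push_prismFace_prismChain, ← prismMap_face hc h0 s hs j hs',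
    ofTuples_comp]
  exact fun v => prismFace_comp_affSimplex j v

theorem prismOp_mem {B C : Set X} (hB : B ⊆ A) (hBC : ∀ x ∈ B, ∀ t ∈ Icc (0 : ℝ) 1, h x t ∈ C)
    {n : ℕ} {c : TwistedChain R x₀ n} (hcB : c ∈ inside R x₀ n B) :
    prismOp θ h hc h0 n c ∈ inside R x₀ (n + 1) C := by
  suffices H : inside R x₀ n B ≤ (inside R x₀ (n + 1) C).comap (prismOp θ h hc h0 n) from H hcB
  refine inside_le θ fun s hs => ?_
  rw [Submodule.mem_comap, prismOp_of θ hc h0 s (hs.trans hB)]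
  refine ofTuples_mem_inside _ _ _ ?_ _ _
  rintro _ ⟨p, rfl⟩
  exact hBC _ (hs ⟨_, rfl⟩) _ p.2.2

theorem endOp_mem {B C : Set X} (hB : B ⊆ A) (hBC : ∀ x ∈ B, h x 1 ∈ C)
    {n : ℕ} {c : TwistedChain R x₀ n} (hcB : c ∈ inside R x₀ n B) :
    endOp θ h hc h0 n c ∈ inside R x₀ n C := by
  suffices H : inside R x₀ n B ≤ (inside R x₀ n C).comap (endOp θ h hc h0 n) from H hcB
  refine inside_le θ fun s hs => ?_
  rw [Submodule.mem_comap, endOp_of θ hc h0 s (hs.trans hB)]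
  refine of_mem_inside _ ?_
  rintro _ ⟨p, rfl⟩
  exact hBC _ (hs ⟨_, rfl⟩)

end Prism

/-- If `D` deforms into its subset `E`, keeping `E` inside itself, then the pair `(D, E)` has no
homology. -/
theorem relCycles_le_of_deformation {D E : Set X} (hED : E ⊆ D) (h : X → ℝ → X)
    (hc : ContinuousOn (fun p : X × ℝ => h p.1 p.2) (D ×ˢ Icc 0 1)) (h0 : ∀ x ∈ D, h x 0 = x)
    (hD : ∀ x ∈ D, ∀ t ∈ Icc (0 : ℝ) 1, h x t ∈ D) (hE : ∀ x ∈ E, ∀ t ∈ Icc (0 : ℝ) 1, h x t ∈ E)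
    (h1 : ∀ x ∈ D, h x 1 ∈ E) (n : ℕ) :
    relCycles θ n D E ≤ inside R x₀ n E ⊔ boundaries θ n D := by
  rintro z ⟨hz, hz'⟩
  have hend := endOp_mem θ hc h0 Subset.rfl h1 hz
  have hp := prismOp_mem θ hc h0 Subset.rfl hD hz
  cases n with
  | zero =>
    have := bd_prismOp_zero θ hc h0 hz
    have hz2 : z = endOp θ h hc h0 0 z - bd θ 0 (prismOp θ h hc h0 0 z) := by
      rw [this]; abel
    rw [hz2]
    exact sub_mem (Submodule.mem_sup_left hend)
      (Submodule.mem_sup_right (Submodule.mem_map_of_mem hp))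
  | succ n =>
    have := bd_prismOp_succ θ hc h0 hz
    have hz2 : z = endOp θ h hc h0 (n + 1) z - prismOp θ h hc h0 n (bd θ n z) -
        bd θ (n + 1) (prismOp θ h hc h0 (n + 1) z) := by
      rw [this]; abel
    rw [hz2]
    exact sub_mem (Submodule.mem_sup_left (sub_mem hend (prismOp_mem θ hc h0 hED hE hz')))
      (Submodule.mem_sup_right (Submodule.mem_map_of_mem hp))

end TwistedChain

end

/-! ### Subdivision -/

noncomputable section

namespace TupleChain

variable {R : Type*} [CommRing R] {E : Type*} [NormedAddCommGroup E] [NormedSpace ℝ E] {K : Set E}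

/-- The tuples with entries in `W` whose entries have distance at most `d`. -/
def fineTuples (K : Set E) (m : ℕ) (d : ℝ) (W : Set E) : Set (Fin m → K) :=
  {v | (∀ i j, dist (v i) (v j) ≤ d) ∧ ∀ i, (v i : E) ∈ W}

theorem dist_bary_le (hK : Convex ℝ K) {m : ℕ} {v : Fin (m + 1) → K} {d : ℝ}
    (hv : ∀ i j, dist (v i) (v j) ≤ d) (j : Fin (m + 1)) :
    ((m : ℝ) + 1) * dist (v j : E) (bary hK m v) ≤ m * d := by
  have hb : ((m : ℝ) + 1) • ((bary hK m v : E) - v j) = ∑ i, ((v i : E) - v j) := by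
    have : (bary hK m v : E) = ∑ i, ((m : ℝ) + 1)⁻¹ • (v i : E) := by
      rw [bary, coe_affSimplex]
      refine Finset.sum_congr rfl fun i _ => ?_
      congr 1
      simp [stdSimplex.barycenter]
      change ((m : ℝ) + 1)⁻¹ = _
      norm_cast
    rw [this, ← Finset.smul_sum, smul_sub, smul_smul, mul_inv_cancel₀ (by positivity), one_smul,
      Finset.sum_sub_distrib, Finset.sum_const, Finset.card_univ, Fintype.card_fin,
      ← Nat.cast_smul_eq_nsmul ℝ]
    push_cast
    rfl
  have hn : ((m : ℝ) + 1) * dist (v j : E) (bary hK m v) =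
      ‖((m : ℝ) + 1) • ((bary hK m v : E) - v j)‖ := by
    rw [norm_smul, dist_comm, dist_eq_norm, Real.norm_of_nonneg (by positivity)]
  rw [hn, hb, ← Finset.sum_erase_add _ _ (Finset.mem_univ j), sub_self, add_zero]
  refine (norm_sum_le _ _).trans ((Finset.sum_le_card_nsmul _ _ d fun i _ => ?_).trans ?_)
  · rw [← dist_eq_norm]
    exact hv i j
  · simp

/-- Barycentric subdivision shrinks the distances between the vertices. -/
theorem sd_mem_fineTuples (hK : Convex ℝ K) {r : ℝ} (hr1 : r ≤ 1) {d : ℝ} (m : ℕ)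
    (hr : (m : ℝ) - 1 ≤ r * m) {W : Set E} (hW : Convex ℝ W) {v : Fin m → K}
    (hv : v ∈ fineTuples K m d W) :
    sd R (bary hK) m (Finsupp.single v 1) ∈
      Finsupp.supported R R (fineTuples K m (r * d) W) := by
  induction m generalizing W with
  | zero => exact Finsupp.single_mem_supported R _ ⟨fun i => i.elim0, fun i => i.elim0⟩
  | succ m ih =>
    obtain ⟨hvd, hvW⟩ := hv
    have hd : 0 ≤ d := dist_nonneg.trans (hvd 0 0)
    have hm : (m : ℝ) ≤ r * (m + 1) := by push_cast at hr; linarith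
    have hbW : (bary hK m v : E) ∈ W :=
      hW.sum_mem (fun i _ => stdSimplex.barycenter.2.1 i) stdSimplex.barycenter.2.2 fun i _ => hvW i
    have hdist (j : Fin (m + 1)) : dist (v j : E) (bary hK m v) ≤ r * d := by
      have h1 := dist_bary_le hK hvd j
      have h2 : (m : ℝ) * d ≤ r * (m + 1) * d := mul_le_mul_of_nonneg_right hm hd
      refine le_of_mul_le_mul_left (h1.trans (h2.trans (le_of_eq ?_)))
        (by positivity : (0 : ℝ) < (m : ℝ) + 1)
      ring
    have hcone : Finsupp.supported R R
        (fineTuples K m (r * d) (W ∩ Metric.closedBall (bary hK m v : E) (r * d))) ≤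
        (Finsupp.supported R R (fineTuples K (m + 1) (r * d) W)).comap
          (cone R (bary hK m v) m) := by
      rw [Finsupp.supported_eq_span_single, Submodule.span_le]
      rintro _ ⟨w, ⟨hwd, hwW⟩, rfl⟩
      rw [SetLike.mem_coe, Submodule.mem_comap]
      beta_reduce
      rw [cone_single]
      refine Finsupp.single_mem_supported R _ ⟨fun i j => ?_, fun i => ?_⟩
      · have hr0 : 0 ≤ r * d := dist_nonneg.trans (hdist 0)
        refine Fin.cases ?_ (fun i => ?_) i <;> refine Fin.cases ?_ (fun j => ?_) j
        · simpa using hr0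
        · rw [Fin.cons_zero, Fin.cons_succ, dist_comm]
          exact (hwW j).2
        · rw [Fin.cons_zero, Fin.cons_succ]
          exact (hwW i).2
        · rw [Fin.cons_succ, Fin.cons_succ]
          exact hwd i j
      · refine Fin.cases ?_ (fun i => ?_) i
        · exact hbW
        · exact (hwW i).1
    rw [sd_succ_single]
    refine hcone ?_
    rw [bd_single, map_sum]
    refine Submodule.sum_mem _ fun j _ => ?_
    rw [map_smul]
    refine Submodule.smul_mem _ _ (ih (by linarith) (hW.inter (convex_closedBall _ _)) ?_)
    exact ⟨fun _ _ => hvd _ _, fun i => ⟨hvW _, hdist _⟩⟩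

theorem sd_pow_mem_fineTuples (hK : Convex ℝ K) {r : ℝ} (hr1 : r ≤ 1) {d : ℝ} (m : ℕ)
    (hr : (m : ℝ) - 1 ≤ r * m) {v : Fin m → K} (hv : ∀ i j, dist (v i) (v j) ≤ d) (N : ℕ) :
    (sd R (bary hK) m ^ N) (Finsupp.single v 1) ∈
      Finsupp.supported R R (fineTuples K m (r ^ N * d) Set.univ) := by
  induction N with
  | zero => exact Finsupp.single_mem_supported R _ (by simpa [fineTuples] using hv)
  | succ N ih =>
    have h : Finsupp.supported R R (fineTuples K m (r ^ N * d) Set.univ) ≤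
        (Finsupp.supported R R (fineTuples K m (r ^ (N + 1) * d) Set.univ)).comap
          (sd R (bary hK) m) := by
      rw [Finsupp.supported_eq_span_single, Submodule.span_le]
      rintro _ ⟨w, hw, rfl⟩
      rw [pow_succ', mul_assoc]
      exact sd_mem_fineTuples hK hr1 m hr convex_univ hw
    rw [pow_succ' (sd R (bary hK) m), Module.End.mul_apply]
    exact h ih

end TupleChain

namespace TwistedChain

open LiftedSimplex Set

variable {X : Type*} [TopologicalSpace X] {x₀ : X} {R : Type*} [CommRing R]
  (θ : FundamentalGroup X x₀ →* Rˣ)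

/-- An operation on chains of tuples in the standard simplex gives an operation on twisted
chains. -/
def opOf {n m : ℕ} (c : TupleChain R (Simp n) (m + 1)) :
    TwistedChain R x₀ n →ₗ[R] TwistedChain R x₀ m :=
  lift (fun s => ofTuples θ (convex_stdSimplex ℝ _) s.toMap m c)

theorem opOf_of {n m : ℕ} (c : TupleChain R (Simp n) (m + 1)) (s : LiftedSimplex x₀ n) :
    opOf θ c (of θ s) = ofTuples θ (convex_stdSimplex ℝ _) s.toMap m c :=
  lift_of θ _ (fun g s => ofTuples_deck θ _ g s.toMap m c) s

theorem opOf_mem {n m : ℕ} (c : TupleChain R (Simp n) (m + 1)) {A : Set X}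
    {z : TwistedChain R x₀ n} (hz : z ∈ inside R x₀ n A) : opOf θ c z ∈ inside R x₀ m A := by
  suffices H : inside R x₀ n A ≤ (inside R x₀ m A).comap (opOf θ c) from H hz
  refine inside_le θ fun s hs => ?_
  rw [Submodule.mem_comap, opOf_of]
  exact ofTuples_mem_inside _ _ _ hs _ _

section Affine

variable {E : Type*} [AddCommGroup E] [Module ℝ E] [TopologicalSpace E] [ContinuousAdd E]
  [ContinuousSMul ℝ E] {K : Set E} (hK : Convex ℝ K)

theorem opOf_ofTuples {n m : ℕ} (c : TupleChain R (Simp n) (m + 1)) (s : LiftedMap x₀ K)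
    (F : TupleChain R K (n + 1) →ₗ[R] TupleChain R K (m + 1))
    (hF : ∀ v, F (Finsupp.single v 1) = TupleChain.push R (affSimplex hK v) (m + 1) c)
    (z : TupleChain R K (n + 1)) :
    opOf θ c (ofTuples θ hK s n z) = ofTuples θ hK s m (F z) := by
  suffices h : opOf θ c ∘ₗ ofTuples θ hK s n = ofTuples θ hK s m ∘ₗ F from LinearMap.congr_fun h z
  refine TupleChain.hom_ext fun v => ?_
  rw [LinearMap.comp_apply, LinearMap.comp_apply, ofTuples_single, opOf_of, hF,
    ← ofTuples_comp θ hK (convex_stdSimplex ℝ _) s (affSimplex hK v)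
      (fun w => affSimplex_comp hK v w)]
  rfl

variable (R) in
/-- The chain homotopy between the identity and the barycentric subdivision of tuples. -/
def sdTuplesHomotopy (m : ℕ) : TupleChain R K m →ₗ[R] TupleChain R K (m + 1) :=
  TupleChain.homotopy (fun _ => LinearMap.id) (TupleChain.sd R (bary hK)) (bary hK) m

theorem bd_sdTuplesHomotopy (m : ℕ) (c : TupleChain R K (m + 1)) :
    TupleChain.bd R K (m + 1) (sdTuplesHomotopy R hK (m + 1) c) =
      c - TupleChain.sd R (bary hK) (m + 1) c - sdTuplesHomotopy R hK m (TupleChain.bd R K m c) :=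
  TupleChain.bd_homotopy (fun _ => LinearMap.id) (TupleChain.sd R (bary hK)) (bary hK)
    (fun _ _ => rfl) (fun _ _ => TupleChain.bd_sd _ _ _) rfl m c

theorem push_affSimplex_sd {n : ℕ} (v : Fin (n + 1) → K) :
    TupleChain.sd R (bary hK) (n + 1) (Finsupp.single v 1) = TupleChain.push R (affSimplex hK v)
      (n + 1) (TupleChain.sd R (bary (convex_stdSimplex ℝ _)) (n + 1) (fundamentalChain R n)) := by
  rw [TupleChain.push_sd _ _ (bary hK) (fun m w => bary_affSimplex hK v w), TupleChain.push_single,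
    affSimplex_comp_vertices]

theorem push_affSimplex_sdTuplesHomotopy {n : ℕ} (v : Fin (n + 1) → K) :
    sdTuplesHomotopy R hK (n + 1) (Finsupp.single v 1) =
      TupleChain.push R (affSimplex hK v) (n + 2)
        (sdTuplesHomotopy R (convex_stdSimplex ℝ _) (n + 1) (fundamentalChain R n)) := by
  rw [sdTuplesHomotopy, sdTuplesHomotopy, TupleChain.push_homotopy (affSimplex hK v)
    (affSimplex hK v) _ _ (fun _ => LinearMap.id) (TupleChain.sd R (bary hK)) _ (bary hK)
    (fun m c => rfl) (fun m c => TupleChain.push_sd _ _ _ (fun m w => bary_affSimplex hK v w) m c)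
    (fun m w => bary_affSimplex hK v w), TupleChain.push_single, affSimplex_comp_vertices]

end Affine

/-- The subdivision operator on twisted chains. -/
def sd (n : ℕ) : TwistedChain R x₀ n →ₗ[R] TwistedChain R x₀ n :=
  opOf θ (TupleChain.sd R (bary (convex_stdSimplex ℝ _)) (n + 1) (fundamentalChain R n))

/-- The chain homotopy between the identity and the subdivision operator. -/
def sdHomotopy (n : ℕ) : TwistedChain R x₀ n →ₗ[R] TwistedChain R x₀ (n + 1) :=
  opOf θ (sdTuplesHomotopy R (convex_stdSimplex ℝ _) (n + 1) (fundamentalChain R n))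

theorem bd_sd (n : ℕ) (c : TwistedChain R x₀ (n + 1)) :
    bd θ n (sd θ (n + 1) c) = sd θ n (bd θ n c) := by
  suffices h : bd θ n ∘ₗ sd θ (n + 1) = sd θ n ∘ₗ bd θ n from LinearMap.congr_fun h c
  refine hom_ext (θ := θ) fun s => ?_
  rw [LinearMap.comp_apply, LinearMap.comp_apply, sd, opOf_of, bd_ofTuples, TupleChain.bd_sd,
    ← ofTuples_fundamentalChain, bd_ofTuples, sd, opOf_ofTuples]
  exact push_affSimplex_sd _

theorem bd_sdHomotopy_zero (c : TwistedChain R x₀ 0) :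
    bd θ 0 (sdHomotopy θ 0 c) = c - sd θ 0 c := by
  suffices h : bd θ 0 ∘ₗ sdHomotopy θ 0 = LinearMap.id - sd θ 0 from LinearMap.congr_fun h c
  refine hom_ext (θ := θ) fun s => ?_
  rw [LinearMap.comp_apply, LinearMap.sub_apply, LinearMap.id_apply, sdHomotopy, sd, opOf_of,
    opOf_of, bd_ofTuples, bd_sdTuplesHomotopy, map_sub, map_sub, ofTuples_fundamentalChain]
  simp [sdTuplesHomotopy, TupleChain.homotopy]

theorem bd_sdHomotopy_succ (n : ℕ) (c : TwistedChain R x₀ (n + 1)) :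
    bd θ (n + 1) (sdHomotopy θ (n + 1) c) = c - sd θ (n + 1) c - sdHomotopy θ n (bd θ n c) := by
  suffices h : bd θ (n + 1) ∘ₗ sdHomotopy θ (n + 1) =
      LinearMap.id - sd θ (n + 1) - sdHomotopy θ n ∘ₗ bd θ n from LinearMap.congr_fun h c
  refine hom_ext (θ := θ) fun s => ?_
  rw [LinearMap.comp_apply, LinearMap.sub_apply, LinearMap.sub_apply, LinearMap.id_apply,
    LinearMap.comp_apply, sdHomotopy, sd, opOf_of, opOf_of, bd_ofTuples,
    bd_sdTuplesHomotopy, map_sub, map_sub, ofTuples_fundamentalChain]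
  congr 1
  rw [← ofTuples_fundamentalChain, bd_ofTuples, sdHomotopy, opOf_ofTuples _ _ _ _
    (sdTuplesHomotopy R (convex_stdSimplex ℝ _) (n + 1))]
  exact push_affSimplex_sdTuplesHomotopy _

theorem sd_mem_relCycles {n : ℕ} {D E : Set X} {z : TwistedChain R x₀ n}
    (hz : z ∈ relCycles θ n D E) : sd θ n z ∈ relCycles θ n D E := by
  refine ⟨opOf_mem θ _ hz.1, ?_⟩
  cases n with
  | zero => trivial
  | succ n =>
    have := opOf_mem θ (TupleChain.sd R (bary (convex_stdSimplex ℝ _)) (n + 1)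
      (fundamentalChain R n)) hz.2
    change bd θ n (sd θ (n + 1) z) ∈ inside R x₀ n E
    rw [bd_sd]
    exact this

theorem sub_sd_mem {n : ℕ} {D E : Set X} {z : TwistedChain R x₀ n}
    (hz : z ∈ relCycles θ n D E) : z - sd θ n z ∈ inside R x₀ n E ⊔ boundaries θ n D := by
  cases n with
  | zero =>
    rw [← bd_sdHomotopy_zero]
    exact Submodule.mem_sup_right (Submodule.mem_map_of_mem (opOf_mem θ _ hz.1))
  | succ n =>
    have : z - sd θ (n + 1) z = sdHomotopy θ n (bd θ n z) +
        bd θ (n + 1) (sdHomotopy θ (n + 1) z) := by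
      rw [bd_sdHomotopy_succ]; abel
    rw [this]
    exact add_mem (Submodule.mem_sup_left (opOf_mem θ _ hz.2))
      (Submodule.mem_sup_right (Submodule.mem_map_of_mem (opOf_mem θ _ hz.1)))

theorem sd_pow_mem_relCycles {n : ℕ} {D E : Set X} {z : TwistedChain R x₀ n}
    (hz : z ∈ relCycles θ n D E) (N : ℕ) : (sd θ n ^ N) z ∈ relCycles θ n D E := by
  induction N with
  | zero => exact hz
  | succ N ih =>
    rw [pow_succ', Module.End.mul_apply]
    exact sd_mem_relCycles θ ih

/-- A relative cycle is homologous to its iterated subdivisions. -/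
theorem sub_sd_pow_mem {n : ℕ} {D E : Set X} {z : TwistedChain R x₀ n}
    (hz : z ∈ relCycles θ n D E) (N : ℕ) :
    z - (sd θ n ^ N) z ∈ inside R x₀ n E ⊔ boundaries θ n D := by
  induction N with
  | zero => simp
  | succ N ih =>
    rw [pow_succ', Module.End.mul_apply, ← sub_add_sub_cancel z ((sd θ n ^ N) z)]
    exact add_mem ih (sub_sd_mem θ (sd_pow_mem_relCycles θ hz N))

theorem bd_sd_pow (n N : ℕ) (c : TwistedChain R x₀ (n + 1)) :
    bd θ n ((sd θ (n + 1) ^ N) c) = (sd θ n ^ N) (bd θ n c) := by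
  induction N with
  | zero => rfl
  | succ N ih => rw [pow_succ', pow_succ', Module.End.mul_apply, Module.End.mul_apply, bd_sd, ih]

theorem sd_mem_sup {n : ℕ} {A B : Set X} {z : TwistedChain R x₀ n}
    (hz : z ∈ inside R x₀ n A ⊔ inside R x₀ n B) :
    sd θ n z ∈ inside R x₀ n A ⊔ inside R x₀ n B := by
  obtain ⟨a, ha, b, hb, rfl⟩ := Submodule.mem_sup.mp hz
  rw [map_add]
  exact Submodule.add_mem_sup (opOf_mem θ _ ha) (opOf_mem θ _ hb)

/-- Iterated subdivision makes a chain inside `A ∪ B` a sum of chains inside `A` and `B`, if `A`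
and `B` are open in `A ∪ B`. -/
theorem exists_sd_pow_mem {A B OA OB : Set X} (hOA : IsOpen OA) (hOB : IsOpen OB)
    (hA : OA ∩ (A ∪ B) = A) (hB : OB ∩ (A ∪ B) = B) {n : ℕ} {z : TwistedChain R x₀ n}
    (hz : z ∈ inside R x₀ n (A ∪ B)) :
    ∃ N, ∀ M ≥ N, (sd θ n ^ M) z ∈ inside R x₀ n A ⊔ inside R x₀ n B := by
  have of_one (w : TwistedChain R x₀ n) (N : ℕ)
      (h : (sd θ n ^ N) w ∈ inside R x₀ n A ⊔ inside R x₀ n B) (M : ℕ) (hM : M ≥ N) :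
      (sd θ n ^ M) w ∈ inside R x₀ n A ⊔ inside R x₀ n B := by
    induction M, hM using Nat.le_induction with
    | base => exact h
    | succ M _ ih => rw [pow_succ', Module.End.mul_apply]; exact sd_mem_sup θ ih
  let P : Submodule R (TwistedChain R x₀ n) :=
    { carrier := {w | ∃ N, ∀ M ≥ N, (sd θ n ^ M) w ∈ inside R x₀ n A ⊔ inside R x₀ n B}
      zero_mem' := ⟨0, fun M _ => by simp⟩
      add_mem' := by
        rintro a b ⟨N, hN⟩ ⟨N', hN'⟩
        refine ⟨max N N', fun M hM => ?_⟩
        rw [map_add]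
        exact add_mem (hN M (le_trans (le_max_left _ _) hM))
          (hN' M (le_trans (le_max_right _ _) hM))
      smul_mem' := by
        rintro r a ⟨N, hN⟩
        refine ⟨N, fun M hM => ?_⟩
        rw [map_smul]
        exact Submodule.smul_mem _ _ (hN M hM) }
  suffices H : inside R x₀ n (A ∪ B) ≤ P from H hz
  refine inside_le θ fun s hs => ?_
  let hS := convex_stdSimplex ℝ (Fin (n + 1))
  obtain ⟨δ, hδ, hleb⟩ := lebesgue_number_lemma_of_metric (s := (univ : Set (Simp n)))
    (c := fun b : Bool => if b then s.simplex ⁻¹' OA else s.simplex ⁻¹' OB) isCompact_univ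
    (fun b => by cases b <;> simp [hOA.preimage s.simplex.continuous,
      hOB.preimage s.simplex.continuous])
    (fun p _ => by
      rcases hs ⟨p, rfl⟩ with h | h
      · rw [← hA] at h
        exact mem_iUnion.mpr ⟨true, by simpa using h.1⟩
      · rw [← hB] at h
        exact mem_iUnion.mpr ⟨false, by simpa using h.1⟩)
  have hr0 : (0 : ℝ) ≤ n / (n + 1) := by positivity
  have hr1 : (n : ℝ) / (n + 1) < 1 := by rw [div_lt_one (by positivity)]; linarith
  obtain ⟨N, hN⟩ := exists_pow_lt_of_lt_one (by positivity : 0 < δ / 2) hr1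
  refine ⟨N, of_one _ N ?_⟩
  have hfund : (sd θ n ^ N) (of θ s) = ofTuples θ hS s.toMap n
      ((TupleChain.sd R (bary hS) (n + 1) ^ N) (fundamentalChain R n)) := by
    clear hN
    induction N with
    | zero => exact (ofTuples_fundamentalChain θ s).symm
    | succ N ih =>
      rw [pow_succ', pow_succ', Module.End.mul_apply, Module.End.mul_apply, ih, sd, opOf_ofTuples]
      exact push_affSimplex_sd _
  have hfine := TupleChain.sd_pow_mem_fineTuples (R := R) hS hr1.le (d := 1) (n + 1)
    (by push_cast; rw [div_mul_cancel₀ _ (by positivity)]; linarith) (v := vertices n)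
    (fun i j => by
      refine (dist_pi_le_iff zero_le_one).mpr fun k => ?_
      rw [Real.dist_eq]
      have h1 := (vertices n i).2.1 k
      have h2 := (vertices n j).2.1 k
      have h3 : (vertices n i).1 k ≤ 1 := stdSimplex.le_one (vertices n i) k
      have h4 : (vertices n j).1 k ≤ 1 := stdSimplex.le_one (vertices n j) k
      rw [abs_le]
      constructor <;> linarith) N
  rw [hfund]
  suffices H : Finsupp.supported R R
      (TupleChain.fineTuples (stdSimplex ℝ (Fin (n + 1))) (n + 1) ((n / (n + 1)) ^ N * 1) univ) ≤
      (inside R x₀ n A ⊔ inside R x₀ n B).comap (ofTuples θ hS s.toMap n) from H hfine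
  rw [Finsupp.supported_eq_span_single, Submodule.span_le]
  rintro _ ⟨v, ⟨hv, -⟩, rfl⟩
  beta_reduce
  rw [SetLike.mem_coe, Submodule.mem_comap, ofTuples_single]
  have hball (p : Simp n) : affSimplex hS v p ∈ Metric.ball (v 0) δ := by
    have : (affSimplex hS v p : Fin (n + 1) → ℝ) ∈ Metric.ball (v 0 : Fin (n + 1) → ℝ) δ := by
      refine (convex_ball _ _).sum_mem (fun i _ => p.2.1 i) p.2.2 fun i _ => ?_
      refine lt_of_le_of_lt (hv i 0) ?_
      rw [mul_one]
      linarith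
    exact this
  obtain ⟨b, hb⟩ := hleb (v 0) (mem_univ _)
  cases b with
  | true =>
    refine Submodule.mem_sup_left (of_mem_inside θ ?_)
    rintro _ ⟨p, rfl⟩
    have h1 : s.simplex (affSimplex hS v p) ∈ OA := by simpa using hb (hball p)
    change s.simplex (affSimplex hS v p) ∈ A
    rw [← hA]
    exact ⟨h1, hs ⟨_, rfl⟩⟩
  | false =>
    refine Submodule.mem_sup_right (of_mem_inside θ ?_)
    rintro _ ⟨p, rfl⟩
    have h1 : s.simplex (affSimplex hS v p) ∈ OB := by simpa using hb (hball p)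
    change s.simplex (affSimplex hS v p) ∈ B
    rw [← hB]
    exact ⟨h1, hs ⟨_, rfl⟩⟩

end TwistedChain

end

/-! ### Finite generation modulo a submodule -/

noncomputable section

section SmallMod

variable {R M N : Type*} [CommRing R] [AddCommGroup M] [Module R M] [AddCommGroup N] [Module R N]

/-- The submodule `X` is finitely generated modulo `Y`, and even contained in `Y` if `b` holds. The
parameter `b` allows to prove finite generation and vanishing of homology by one argument. -/
def SmallMod (b : Prop) (X Y : Submodule R M) : Prop :=
  ∃ F : Submodule R M, F.FG ∧ (b → F = ⊥) ∧ X ≤ F ⊔ Y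

namespace SmallMod

variable {b : Prop} {X X' Y Y' : Submodule R M}

theorem of_le (h : X ≤ Y) : SmallMod b X Y := ⟨⊥, Submodule.fg_bot, fun _ => rfl, by simpa⟩

theorem mono (h : SmallMod b X Y) (hX : X' ≤ X) (hY : Y ≤ Y') : SmallMod b X' Y' := by
  obtain ⟨F, hF, hb, hle⟩ := h
  exact ⟨F, hF, hb, hX.trans (hle.trans (sup_le_sup_left hY F))⟩

theorem trans (h : SmallMod b X Y) (h' : SmallMod b Y Y') : SmallMod b X Y' := by
  obtain ⟨F, hF, hb, hle⟩ := h
  obtain ⟨F', hF', hb', hle'⟩ := h'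
  refine ⟨F ⊔ F', hF.sup hF', fun h => by rw [hb h, hb' h, sup_idem], ?_⟩
  rw [sup_assoc]
  exact hle.trans (sup_le_sup_left hle' F)

theorem sup (h : SmallMod b X Y) (h' : SmallMod b X' Y) : SmallMod b (X ⊔ X') Y := by
  obtain ⟨F, hF, hb, hle⟩ := h
  obtain ⟨F', hF', hb', hle'⟩ := h'
  refine ⟨F ⊔ F', hF.sup hF', fun h => by rw [hb h, hb' h, sup_idem], ?_⟩
  rw [sup_sup_distrib_right]
  exact sup_le_sup hle hle'

/-- Over a noetherian ring, generators can be chosen in the preimage under a linear map. -/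
theorem comap [IsNoetherianRing R] {f : M →ₗ[R] N} {Z : Submodule R N}
    (h : SmallMod b (X.map f) Z) :
    SmallMod b X (X ⊓ Z.comap f) := by
  classical
  by_cases hb : b
  · obtain ⟨F, -, hF, hle⟩ := h
    rw [hF hb, bot_sup_eq, Submodule.map_le_iff_le_comap] at hle
    exact of_le (le_inf le_rfl hle)
  obtain ⟨F, hF, -, hle⟩ := h
  let g : M →ₗ[R] N ⧸ Z := Z.mkQ ∘ₗ f
  have hg : (X.map g).FG := by
    have h1 : X.map g ≤ F.map Z.mkQ := by
      rw [Submodule.map_comp]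
      refine (Submodule.map_mono hle).trans ?_
      rw [Submodule.map_sup, Submodule.mkQ_map_self, sup_bot_eq]
    have : IsNoetherian R (F.map Z.mkQ) := isNoetherian_of_fg_of_noetherian _ (hF.map _)
    exact Submodule.FG.of_le_of_isNoetherian h1
  have hspan : X.map g = Submodule.span R (g '' X) := by
    rw [← Submodule.map_span, Submodule.span_eq]
  rw [hspan, Submodule.fg_span_iff_fg_span_finset_subset] at hg
  obtain ⟨s, hs, hs'⟩ := hg
  obtain ⟨t, ht, rfl⟩ := (Finset.subset_set_image_iff).mp hs
  refine ⟨Submodule.span R t, ⟨t, rfl⟩, fun h => absurd h hb, fun x hx => ?_⟩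
  have hx' : g x ∈ (Submodule.span R (t : Set M)).map g := by
    rw [Submodule.map_span, ← Finset.coe_image, ← hs']
    exact Submodule.subset_span ⟨x, hx, rfl⟩
  obtain ⟨y, hy, hyx⟩ := hx'
  have hyX : y ∈ X := Submodule.span_le.mpr ht hy
  rw [← add_sub_cancel y x]
  refine Submodule.add_mem_sup hy ⟨sub_mem hx hyX, ?_⟩
  change f (x - y) ∈ Z
  rw [← Submodule.Quotient.mk_eq_zero, ← Submodule.mkQ_apply]
  change g (x - y) = 0
  rw [map_sub, hyx, sub_self]

theorem inf [IsNoetherianRing R] (h : SmallMod b X Y) : SmallMod b X (X ⊓ Y) := by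
  have h' : SmallMod b (X.map LinearMap.id) Y := by rwa [Submodule.map_id]
  simpa using h'.comap

end SmallMod

end SmallMod

/-! ### Excision -/

namespace TwistedChain

variable {X : Type*} [TopologicalSpace X] {x₀ : X} {R : Type*} [CommRing R]
  (θ : FundamentalGroup X x₀ →* Rˣ)

theorem boundaries_mono {n : ℕ} {D D' : Set X} (h : D ⊆ D') :
    boundaries θ n D ≤ boundaries θ n D' :=
  Submodule.map_mono (inside_mono h)

theorem inside_le_bdInside {n : ℕ} {A : Set X} : inside R x₀ n A ≤ bdInside θ n A := by
  cases n with
  | zero => exact le_top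
  | succ n => exact fun _ h => bd_mem_inside θ h

theorem bdInside_mono {n : ℕ} {A B : Set X} (h : A ⊆ B) : bdInside θ n A ≤ bdInside θ n B := by
  cases n with
  | zero => exact le_rfl
  | succ n => exact Submodule.comap_mono (inside_mono h)

theorem bdInside_inter {n : ℕ} {A B : Set X} :
    bdInside θ n (A ∩ B) = bdInside θ n A ⊓ bdInside θ n B := by
  cases n with
  | zero => exact (inf_top_eq _).symm
  | succ n => rw [bdInside, inside_inter]; rfl

theorem boundaries_le_bdInside {n : ℕ} {D E : Set X} : boundaries θ n D ≤ bdInside θ n E := by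
  rintro _ ⟨w, -, rfl⟩
  cases n with
  | zero => trivial
  | succ n =>
    change bd θ n (bd θ (n + 1) w) ∈ inside R x₀ n E
    rw [bd_bd]
    exact zero_mem _

variable [IsNoetherianRing R] {b : Prop}

/-- The relative homology of `(D, A ∪ B)` is controlled by that of `(B, A ∩ B)`, one degree lower,
if the pair `(D, A)` has no homology. -/
theorem smallMod_relCycles_union {D A B OA OB : Set X} (hBD : B ⊆ D) (hOA : IsOpen OA)
    (hOB : IsOpen OB) (hA : OA ∩ (A ∪ B) = A) (hB : OB ∩ (A ∪ B) = B) (n : ℕ)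
    (hDA : relCycles θ n D A ≤ inside R x₀ n A ⊔ boundaries θ n D)
    (hAB : ∀ m, m + 1 = n → SmallMod b (relCycles θ m B (A ∩ B))
      (inside R x₀ m (A ∩ B) ⊔ boundaries θ m B)) :
    SmallMod b (relCycles θ n D (A ∪ B)) (inside R x₀ n (A ∪ B) ⊔ boundaries θ n D) := by
  have hle : inside R x₀ n A ⊔ boundaries θ n D ≤ inside R x₀ n (A ∪ B) ⊔ boundaries θ n D :=
    sup_le_sup_right (inside_mono Set.subset_union_left) _
  cases n with
  | zero => exact SmallMod.of_le (hDA.trans hle)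
  | succ n =>
    let Z : Submodule R (TwistedChain R x₀ (n + 1)) :=
      inside R x₀ (n + 1) D ⊓ (inside R x₀ n A ⊔ inside R x₀ n B).comap (bd θ n)
    have h1 : relCycles θ (n + 1) D (A ∪ B) ≤
        Z ⊔ (inside R x₀ (n + 1) (A ∪ B) ⊔ boundaries θ (n + 1) D) := by
      intro z hz
      obtain ⟨N, hN⟩ := exists_sd_pow_mem θ hOA hOB hA hB hz.2
      rw [← add_sub_cancel ((sd θ (n + 1) ^ N) z) z]
      refine Submodule.add_mem_sup ⟨(sd_pow_mem_relCycles θ hz N).1, ?_⟩ (sub_sd_pow_mem θ hz N)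
      rw [SetLike.mem_coe, Submodule.mem_comap, bd_sd_pow]
      exact hN N le_rfl
    have h2 : Z.map (bd θ n) ≤ relCycles θ n B (A ∩ B) ⊔ inside R x₀ n A := by
      rintro _ ⟨z, ⟨-, hz⟩, rfl⟩
      obtain ⟨p, hp, q, hq, hpq⟩ := Submodule.mem_sup.mp hz
      rw [← hpq, add_comm]
      refine Submodule.add_mem_sup ⟨hq, ?_⟩ hp
      rw [bdInside_inter]
      refine ⟨?_, inside_le_bdInside θ hq⟩
      rw [eq_sub_of_add_eq' hpq]
      refine sub_mem ?_ (inside_le_bdInside θ hp)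
      exact boundaries_le_bdInside θ
        (Submodule.mem_map_of_mem (p := inside R x₀ (n + 1) Set.univ) (by simp [inside_univ]))
    have h3 : SmallMod b (Z.map (bd θ n)) (inside R x₀ n A ⊔ boundaries θ n B) := by
      refine (SmallMod.sup ((hAB n rfl).mono le_rfl ?_) (SmallMod.of_le le_sup_left)).mono h2 le_rfl
      exact sup_le_sup_right (inside_mono Set.inter_subset_left) _
    have h4 : Z ⊓ (inside R x₀ n A ⊔ boundaries θ n B).comap (bd θ n) ≤
        inside R x₀ (n + 1) (A ∪ B) ⊔ boundaries θ (n + 1) D := by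
      rintro z ⟨hz, hz'⟩
      obtain ⟨a, ha, _, ⟨y, hy, rfl⟩, hay⟩ := Submodule.mem_sup.mp hz'
      rw [← add_sub_cancel y z]
      refine add_mem (Submodule.mem_sup_left (inside_mono Set.subset_union_right hy))
        (hle (hDA ⟨sub_mem hz.1 (inside_mono hBD hy), ?_⟩))
      change bd θ n (z - y) ∈ inside R x₀ n A
      rw [map_sub, ← hay, add_sub_cancel_right]
      exact ha
    exact (SmallMod.sup (h3.comap.mono le_rfl h4) (SmallMod.of_le le_rfl)).mono h1 le_rfl

/-- The relative homology of `(A ∪ B, C)` is controlled by that of `(B, A ∩ B)` if the pair `(A, C)`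
has no homology. -/
theorem smallMod_relCycles_of_excision {A B C OA OB : Set X} (hOA : IsOpen OA)
    (hOB : IsOpen OB) (hA : OA ∩ (A ∪ B) = A) (hB : OB ∩ (A ∪ B) = B) (n : ℕ) (hCA : C ⊆ A)
    (hAC : relCycles θ n A C ≤ inside R x₀ n C ⊔ boundaries θ n A)
    (hAB : SmallMod b (relCycles θ n B (A ∩ B)) (inside R x₀ n (A ∩ B) ⊔ boundaries θ n B)) :
    SmallMod b (relCycles θ n (A ∪ B) C) (inside R x₀ n C ⊔ boundaries θ n (A ∪ B)) := by
  have h1 : relCycles θ n (A ∪ B) C ≤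
      relCycles θ n B (A ∩ B) ⊔ (inside R x₀ n A ⊔ boundaries θ n (A ∪ B)) := by
    have hle : inside R x₀ n C ⊔ boundaries θ n (A ∪ B) ≤
        inside R x₀ n A ⊔ boundaries θ n (A ∪ B) := sup_le_sup_right (inside_mono hCA) _
    intro z hz
    obtain ⟨N, hN⟩ := exists_sd_pow_mem θ hOA hOB hA hB hz.1
    obtain ⟨p, hp, q, hq, hpq⟩ := Submodule.mem_sup.mp (hN N le_rfl)
    have hqz : z = q + (p + (z - (sd θ n ^ N) z)) := by rw [← hpq]; abel
    rw [hqz]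
    refine Submodule.add_mem_sup ⟨hq, ?_⟩ (add_mem (Submodule.mem_sup_left hp)
      (hle (sub_sd_pow_mem θ hz N)))
    rw [bdInside_inter]
    refine ⟨?_, inside_le_bdInside θ hq⟩
    rw [eq_sub_of_add_eq' hpq]
    exact sub_mem (bdInside_mono θ hCA (sd_pow_mem_relCycles θ hz N).2) (inside_le_bdInside θ hp)
  have h2 : SmallMod b (relCycles θ n (A ∪ B) C) (inside R x₀ n A ⊔ boundaries θ n (A ∪ B)) := by
    refine (SmallMod.sup (hAB.mono le_rfl ?_) (SmallMod.of_le le_rfl)).mono h1 le_rfl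
    exact sup_le_sup (inside_mono Set.inter_subset_left)
      (boundaries_mono θ Set.subset_union_right)
  refine h2.inf.mono le_rfl ?_
  rintro z ⟨hz, hz'⟩
  obtain ⟨a, ha, w, hw, rfl⟩ := Submodule.mem_sup.mp hz'
  have haC : a ∈ relCycles θ n A C := by
    refine ⟨ha, ?_⟩
    rw [← add_sub_cancel_right a w]
    exact sub_mem hz.2 (boundaries_le_bdInside θ hw)
  exact add_mem (sup_le_sup_left (boundaries_mono θ Set.subset_union_left) _ (hAC haC))
    (Submodule.mem_sup_right hw)

end TwistedChain

end

/-! ### The homology of a punctured cell -/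

noncomputable section

namespace TwistedChain

open Set Metric

variable {X : Type*} [TopologicalSpace X] {x₀ : X} {R : Type*} [CommRing R]
  (θ : FundamentalGroup X x₀ →* Rˣ)

theorem inside_singleton_fg (x : X) (n : ℕ) : (inside R x₀ n {x}).FG := by
  rw [inside, Finsupp.supported_eq_span_single]
  refine Submodule.fg_span (Set.Subsingleton.finite ?_)
  refine Set.Subsingleton.image ?_ _
  intro σ hσ τ hτ
  ext p
  have h1 := hσ ⟨p, rfl⟩
  have h2 := hτ ⟨p, rfl⟩
  rw [mem_singleton_iff] at h1 h2
  rw [h1, h2]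

section Cell

variable {N : ℕ} {e : (Fin N → ℝ) → X} {g : X → Fin N → ℝ} (he : ContinuousOn e (ball 0 1))
  (hg : ContinuousOn g (e '' ball 0 1)) (hge : ∀ x ∈ ball (0 : Fin N → ℝ) 1, g (e x) = x)

include he hg hge in
/-- A deformation inside the open unit ball transported to an open cell. -/
theorem relCycles_image_le {D E : Set (Fin N → ℝ)} (hD : D ⊆ ball 0 1) (hED : E ⊆ D)
    (H : (Fin N → ℝ) → ℝ → Fin N → ℝ) (hc : Continuous fun p : (Fin N → ℝ) × ℝ => H p.1 p.2)
    (h0 : ∀ x ∈ D, H x 0 = x) (hHD : ∀ x ∈ D, ∀ t ∈ Icc (0 : ℝ) 1, H x t ∈ D)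
    (hHE : ∀ x ∈ E, ∀ t ∈ Icc (0 : ℝ) 1, H x t ∈ E) (h1 : ∀ x ∈ D, H x 1 ∈ E) (n : ℕ) :
    relCycles θ n (e '' D) (e '' E) ≤
      inside R x₀ n (e '' E) ⊔ boundaries θ n (e '' D) := by
  refine relCycles_le_of_deformation θ (image_mono hED) (fun y t => e (H (g y) t)) ?_ ?_ ?_ ?_ ?_ n
  · refine he.comp (t := ball 0 1) (f := fun p : X × ℝ => H (g p.1) p.2) ?_ ?_
    · refine hc.comp_continuousOn (f := fun p : X × ℝ => (g p.1, p.2))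
        (ContinuousOn.prodMk ?_ continuousOn_snd)
      refine hg.comp continuousOn_fst ?_
      rintro ⟨_, t⟩ ⟨⟨x, hx, rfl⟩, -⟩
      exact ⟨x, hD hx, rfl⟩
    · rintro ⟨_, t⟩ ⟨⟨x, hx, rfl⟩, ht⟩
      simp only [hge x (hD hx)]
      exact hD (hHD x hx t ht)
  · rintro _ ⟨x, hx, rfl⟩
    rw [hge x (hD hx), h0 x hx]
  · rintro _ ⟨x, hx, rfl⟩ t ht
    rw [hge x (hD hx)]
    exact ⟨_, hHD x hx t ht, rfl⟩
  · rintro _ ⟨x, hx, rfl⟩ t ht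
    rw [hge x (hD (hED hx))]
    exact ⟨_, hHE x hx t ht, rfl⟩
  · rintro _ ⟨x, hx, rfl⟩
    rw [hge x (hD hx)]
    exact ⟨_, h1 x hx, rfl⟩

/-- The points of the open cube whose coordinates from the `k`-th on are negative. -/
def negTail (N k : ℕ) : Set (Fin N → ℝ) := {x | x ∈ ball 0 1 ∧ ∀ l : Fin N, k ≤ l → x l < 0}

/-- The points of `negTail N k` whose first `k` coordinates do not all vanish. -/
def negTailPunctured (N k : ℕ) : Set (Fin N → ℝ) :=
  {x | x ∈ negTail N k ∧ ∃ l : Fin N, (l : ℕ) < k ∧ x l ≠ 0}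

theorem mem_ball_pi {x : Fin N → ℝ} : x ∈ ball (0 : Fin N → ℝ) 1 ↔ ∀ l, |x l| < 1 := by
  rw [mem_ball, dist_pi_lt_iff one_pos]
  simp

include he hg hge in
/-- The homology of `negTail N k` relative to `negTailPunctured N k` is finitely generated and
vanishes below degree `k`. By induction on `k`: `negTailPunctured N (k + 1)` is covered by
`negTail N k` and by a set into which `negTail N (k + 1)` deforms, and they meet in
`negTailPunctured N k`. -/
theorem smallMod_relCycles_negTail [IsNoetherianRing R] (k : ℕ) (hk : k ≤ N) (n : ℕ) :
    SmallMod (n < k) (relCycles θ n (e '' negTail N k) (e '' negTailPunctured N k))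
      (inside R x₀ n (e '' negTailPunctured N k) ⊔ boundaries θ n (e '' negTail N k)) := by
  induction k generalizing n with
  | zero =>
    have hpt : (fun _ => -1 / 2 : Fin N → ℝ) ∈ negTail N 0 := by
      refine ⟨mem_ball_pi.mpr fun l => ?_, fun l _ => by norm_num⟩
      rw [abs_lt]; norm_num
    have h := relCycles_image_le θ he hg hge (R := R) (D := negTail N 0)
      (E := {fun _ => -1 / 2}) (fun x hx => hx.1) (by simpa using hpt)
      (fun x t l => (1 - t) * x l + t * (-1 / 2)) (by fun_prop) (fun x _ => by simp) ?_ ?_ ?_ n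
    · have h2 : SmallMod (n < 0) (relCycles θ n (e '' negTail N 0) (e '' {fun _ => -1 / 2}))
          (boundaries θ n (e '' negTail N 0)) := by
        rw [image_singleton] at h ⊢
        exact ⟨_, inside_singleton_fg _ n, fun h => absurd h (Nat.not_lt_zero n), h⟩
      refine h2.mono (inf_le_inf_left _ (bdInside_mono θ (image_mono ?_))) le_sup_right
      rintro x ⟨-, l, hl, -⟩
      exact absurd hl (Nat.not_lt_zero _)
    · rintro x ⟨hx, hx'⟩ t ⟨ht0, ht1⟩
      refine ⟨mem_ball_pi.mpr fun l => ?_, fun l hl => ?_⟩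
      · have h1 := mem_ball_pi.mp hx l
        rw [abs_lt] at h1 ⊢
        constructor <;> nlinarith
      · have h1 := hx' l hl
        change (1 - t) * x l + t * (-1 / 2) < 0
        rcases ht1.lt_or_eq with h | rfl
        · nlinarith
        · norm_num
    · rintro _ rfl t -
      rw [mem_singleton_iff]
      funext l
      ring
    · rintro x -
      rw [mem_singleton_iff]
      funext l
      ring
  | succ k ih =>
    let a : Fin N := ⟨k, hk⟩
    let A : Set (Fin N → ℝ) :=
      {x | x ∈ negTail N (k + 1) ∧ ((∃ l : Fin N, (l : ℕ) < k ∧ x l ≠ 0) ∨ 0 < x a)}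
    have hB : negTail N k = {x | x ∈ negTail N (k + 1) ∧ x a < 0} := by
      ext x
      constructor
      · rintro ⟨h1, h2⟩
        exact ⟨⟨h1, fun l hl => h2 l (by omega)⟩, h2 a le_rfl⟩
      · rintro ⟨⟨h1, h2⟩, h3⟩
        refine ⟨h1, fun l hl => ?_⟩
        rcases hl.lt_or_eq with h | h
        · exact h2 l h
        · rwa [show l = a from Fin.ext h.symm]
    have hunion : negTailPunctured N (k + 1) = A ∪ negTail N k := by
      rw [hB]
      ext x
      constructor
      · rintro ⟨h1, l, hl, hxl⟩
        rcases lt_or_eq_of_le (Nat.lt_succ_iff.mp hl) with h | h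
        · exact Or.inl ⟨h1, Or.inl ⟨l, h, hxl⟩⟩
        · rw [show l = a from Fin.ext h] at hxl
          rcases lt_or_gt_of_ne hxl with h | h
          · exact Or.inr ⟨h1, h⟩
          · exact Or.inl ⟨h1, Or.inr h⟩
      · rintro (⟨h1, ⟨l, hl, hxl⟩ | h⟩ | ⟨h1, h⟩)
        · exact ⟨h1, l, by omega, hxl⟩
        · exact ⟨h1, a, Nat.lt_succ_self k, h.ne'⟩
        · exact ⟨h1, a, Nat.lt_succ_self k, h.ne⟩
    have hinter : negTailPunctured N k = A ∩ negTail N k := by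
      ext x
      constructor
      · rintro ⟨h1, h2⟩
        have h3 := h1
        rw [hB] at h3
        exact ⟨⟨h3.1, Or.inl h2⟩, h1⟩
      · rintro ⟨⟨h1, h2 | h2⟩, h3⟩
        · exact ⟨h3, h2⟩
        · rw [hB] at h3
          exact absurd h2 h3.2.le.not_gt
    have hAball : A ⊆ ball 0 1 := fun x hx => hx.1.1
    have hBball : negTail N k ⊆ ball 0 1 := fun x hx => hx.1
    have hinj : InjOn e (ball 0 1) := fun x hx y hy hxy => by rw [← hge x hx, hxy, hge y hy]
    have hopen {O S T : Set (Fin N → ℝ)} (hO : IsOpen O) (hT : T ⊆ ball 0 1) (hS : O ∩ T = S) :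
        ∃ O' : Set X, IsOpen O' ∧ O' ∩ (e '' T) = e '' S := by
      obtain ⟨u, hu, hu'⟩ := continuousOn_iff'.mp hg O hO
      refine ⟨u, hu, ?_⟩
      ext y
      constructor
      · rintro ⟨hy, x, hx, rfl⟩
        refine ⟨x, hS ▸ ⟨?_, hx⟩, rfl⟩
        have : e x ∈ g ⁻¹' O ∩ e '' ball 0 1 := hu' ▸ ⟨hy, x, hT hx, rfl⟩
        rw [← hge x (hT hx)]
        exact this.1
      · rintro ⟨x, hx, rfl⟩
        rw [← hS] at hx
        refine ⟨?_, x, hx.2, rfl⟩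
        have : e x ∈ u ∩ e '' ball 0 1 := hu' ▸ ⟨by
          rw [mem_preimage, hge x (hT hx.2)]; exact hx.1, x, hT hx.2, rfl⟩
        exact this.1
    have hOA : IsOpen {x : Fin N → ℝ | (∃ l : Fin N, (l : ℕ) < k ∧ x l ≠ 0) ∨ 0 < x a} := by
      refine IsOpen.union ?_ (isOpen_lt continuous_const (continuous_apply a))
      have : {x : Fin N → ℝ | ∃ l : Fin N, (l : ℕ) < k ∧ x l ≠ 0} =
          ⋃ (l : Fin N) (_ : (l : ℕ) < k), {x : Fin N → ℝ | x l ≠ 0} := by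
        ext x
        simp
      have h : IsOpen {x : Fin N → ℝ | ∃ l : Fin N, (l : ℕ) < k ∧ x l ≠ 0} := by
        rw [this]
        exact isOpen_iUnion fun l => isOpen_iUnion fun _ =>
          isOpen_ne_fun (continuous_apply l) continuous_const
      exact h
    obtain ⟨OA, hOA, hA'⟩ := hopen (S := A) (T := A ∪ negTail N k) hOA
      (union_subset hAball hBball) (by
        rw [← hunion]
        ext x
        constructor
        · rintro ⟨h1, h2⟩
          exact ⟨h2.1, h1⟩
        · intro hx
          exact ⟨hx.2, hunion ▸ Or.inl hx⟩)
    obtain ⟨OB, hOB, hB'⟩ := hopen (S := negTail N k) (T := A ∪ negTail N k)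
      (O := {x | x a < 0}) (isOpen_lt (continuous_apply a) continuous_const)
      (union_subset hAball hBball) (by
        rw [← hunion]
        ext x
        constructor
        · rintro ⟨h1, h2⟩
          rw [hB]
          exact ⟨h2.1, h1⟩
        · intro hx
          refine ⟨?_, hunion ▸ Or.inr hx⟩
          rw [hB] at hx
          exact hx.2)
    rw [image_union] at hA' hB'
    rw [hunion, image_union]
    refine smallMod_relCycles_union θ (B := e '' negTail N k) (image_mono ?_) hOA hOB hA' hB' n
      ?_ ?_
    · rw [hB]; exact fun x hx => hx.1
    · refine relCycles_image_le θ he hg hge (fun x hx => hx.1) (fun x hx => hx.1)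
        (fun x t l => if l = a then (1 - t) * x l + t * (1 / 2) else x l) ?_ ?_ ?_ ?_ ?_ n
      · refine continuous_pi fun l => ?_
        split_ifs <;> fun_prop
      · intro x _
        funext l
        simp
      · rintro x ⟨hx, hx'⟩ t ⟨ht0, ht1⟩
        refine ⟨mem_ball_pi.mpr fun l => ?_, fun l hl => ?_⟩
        · have h1 := mem_ball_pi.mp hx l
          split_ifs
          · rw [abs_lt] at h1 ⊢
            constructor <;> nlinarith
          · exact h1
        · have hla : l ≠ a := by rintro rfl; exact absurd hl (by simp [a])
          simpa [hla] using hx' l hl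
      · rintro x ⟨⟨hx, hx'⟩, hx2⟩ t ⟨ht0, ht1⟩
        refine ⟨⟨mem_ball_pi.mpr fun l => ?_, fun l hl => ?_⟩, ?_⟩
        · have h1 := mem_ball_pi.mp hx l
          split_ifs
          · rw [abs_lt] at h1 ⊢
            constructor <;> nlinarith
          · exact h1
        · have hla : l ≠ a := by rintro rfl; exact absurd hl (by simp [a])
          simpa [hla] using hx' l hl
        · rcases hx2 with ⟨l, hl, hxl⟩ | h
          · refine Or.inl ⟨l, hl, ?_⟩
            have hla : l ≠ a := by rintro rfl; exact absurd hl (by simp [a])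
            simpa [hla] using hxl
          · right
            simp only [if_true]
            rcases ht1.lt_or_eq with h | rfl
            · nlinarith
            · norm_num
      · rintro x ⟨hx, hx'⟩
        refine ⟨⟨mem_ball_pi.mpr fun l => ?_, fun l hl => ?_⟩, Or.inr (by norm_num)⟩
        · have h1 := mem_ball_pi.mp hx l
          split_ifs
          · rw [abs_lt]
            constructor <;> norm_num
          · exact h1
        · have hla : l ≠ a := by rintro rfl; exact absurd hl (by simp [a])
          simpa [hla] using hx' l hl
    · rintro m rfl
      have := ih (by omega) m
      rw [hinter, hinj.image_inter hAball hBball] at this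
      simpa only [Nat.add_lt_add_iff_right] using this

include he hg hge in
/-- The homology of an open `N`-cell relative to the complement of its center is finitely generated
and vanishes below degree `N`. -/
theorem smallMod_relCycles_puncturedCell [IsNoetherianRing R] (n : ℕ) :
    SmallMod (n < N) (relCycles θ n (e '' ball 0 1) (e '' (ball 0 1 \ {0})))
      (inside R x₀ n (e '' (ball 0 1 \ {0})) ⊔ boundaries θ n (e '' ball 0 1)) := by
  have h := smallMod_relCycles_negTail θ he hg hge (R := R) N le_rfl n
  have h1 : negTail N N = ball 0 1 := by
    ext x
    exact ⟨fun h => h.1, fun h => ⟨h, fun l hl => absurd l.2 (not_lt.mpr hl)⟩⟩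
  have h2 : negTailPunctured N N = ball 0 1 \ {0} := by
    rw [negTailPunctured, h1]
    ext x
    refine and_congr_right fun _ => ?_
    rw [mem_singleton_iff, funext_iff, not_forall]
    exact exists_congr fun l => and_iff_right l.2
  rwa [h1, h2] at h

end Cell

/-! ### Attaching a cell -/

section Attach

variable [T2Space X] {N : ℕ} {e : (Fin N → ℝ) → X} {g : X → Fin N → ℝ} {Y : Set X}

/-- The radial homotopy of the punctured ball to the sphere. -/
def radial (x : Fin N → ℝ) (t : ℝ) : Fin N → ℝ := ((1 - t) + t / ‖x‖) • x

theorem radial_zero (x : Fin N → ℝ) : radial x 0 = x := by simp [radial]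

theorem norm_radial {x : Fin N → ℝ} (hx : x ≠ 0) {t : ℝ} (ht : t ∈ Icc (0 : ℝ) 1) :
    ‖radial x t‖ = (1 - t) * ‖x‖ + t := by
  have hx' : ‖x‖ ≠ 0 := norm_ne_zero_iff.mpr hx
  rw [radial, norm_smul, Real.norm_of_nonneg]
  · field_simp
  · have := ht.1
    have := ht.2
    have : 0 ≤ t / ‖x‖ := by positivity
    linarith

theorem radial_of_norm_eq_one {x : Fin N → ℝ} (hx : ‖x‖ = 1) (t : ℝ) : radial x t = x := by
  simp [radial, hx]

/-- Attaching an `N`-cell to a closed set `Y`: the relative homology is finitely generated, and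
vanishes below degree `N`. -/
theorem smallMod_relCycles_attach [IsNoetherianRing R] (hY : IsClosed Y)
    (he : ContinuousOn e (closedBall 0 1)) (hg : ContinuousOn g (e '' ball 0 1))
    (hge : ∀ x ∈ ball (0 : Fin N → ℝ) 1, g (e x) = x) (hsphere : e '' sphere 0 1 ⊆ Y)
    (hdisj : Disjoint (e '' ball 0 1) Y) (n : ℕ) :
    SmallMod (n < N) (relCycles θ n (Y ∪ e '' closedBall 0 1) Y)
      (inside R x₀ n Y ⊔ boundaries θ n (Y ∪ e '' closedBall 0 1)) := by
  classical
  have he' : ContinuousOn e (ball 0 1) := he.mono ball_subset_closedBall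
  have hinj : InjOn e (ball 0 1) := fun x hx y hy hxy => by rw [← hge x hx, hxy, hge y hy]
  have h0ball : (0 : Fin N → ℝ) ∈ ball (0 : Fin N → ℝ) 1 := mem_ball_self one_pos
  have hnotY {x : Fin N → ℝ} (hx : x ∈ ball 0 1) : e x ∉ Y :=
    fun h => hdisj.le_bot ⟨⟨x, hx, rfl⟩, h⟩
  let A : Set X := Y ∪ e '' (ball 0 1 \ {0})
  let B : Set X := e '' ball 0 1
  have h0A : e 0 ∉ A := by
    rintro (h | ⟨x, ⟨hx, hx0⟩, hxe⟩)
    · exact hnotY h0ball h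
    · exact hx0 (hinj hx h0ball hxe)
  have hAB : Y ∪ e '' closedBall 0 1 = A ∪ B := by
    rw [← sphere_union_ball, image_union, ← union_assoc, union_eq_self_of_subset_right hsphere,
      union_assoc, union_eq_self_of_subset_left (image_mono sdiff_subset)]
  have hinter : A ∩ B = e '' (ball 0 1 \ {0}) := by
    ext y
    constructor
    · rintro ⟨h | h, x, hx, rfl⟩
      · exact absurd h (hnotY hx)
      · exact h
    · intro h
      exact ⟨Or.inr h, image_mono sdiff_subset h⟩
  have hOA : ({e 0}ᶜ : Set X) ∩ (A ∪ B) = A := by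
    ext y
    constructor
    · rintro ⟨h1, h2 | ⟨x, hx, rfl⟩⟩
      · exact h2
      · refine Or.inr ⟨x, ⟨hx, ?_⟩, rfl⟩
        rintro rfl
        exact h1 rfl
    · intro h
      exact ⟨fun h' => h0A (h' ▸ h), Or.inl h⟩
  have hOB : Yᶜ ∩ (A ∪ B) = B := by
    ext y
    constructor
    · rintro ⟨h1, (h2 | h2) | h2⟩
      · exact absurd h2 h1
      · exact image_mono sdiff_subset h2
      · exact h2
    · rintro ⟨x, hx, rfl⟩
      exact ⟨hnotY hx, Or.inr ⟨x, hx, rfl⟩⟩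
  rw [hAB]
  refine smallMod_relCycles_of_excision θ isOpen_compl_singleton hY.isOpen_compl hOA hOB n
    subset_union_left ?_ (by
      rw [hinter]; exact smallMod_relCycles_puncturedCell θ he' hg hge n)
  -- the radial deformation of `A` to `Y`
  let h : X → ℝ → X := fun y t => if y ∈ B then e (radial (g y) t) else y
  have hYfix {y : X} (hy : y ∈ Y) (t : ℝ) : h y t = y :=
    if_neg fun ⟨x, hx, hxy⟩ => hnotY hx (hxy ▸ hy)
  have hcell {x : Fin N → ℝ} (hx : x ∈ closedBall 0 1) (t : ℝ) : h (e x) t = e (radial x t) := by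
    rcases (mem_closedBall_zero_iff.mp hx).lt_or_eq with h1 | h1
    · have hxb : x ∈ ball 0 1 := mem_ball_zero_iff.mpr h1
      simp only [h, B]
      rw [if_pos ⟨x, hxb, rfl⟩, hge x hxb]
    · rw [hYfix (hsphere ⟨x, mem_sphere_zero_iff_norm.mpr h1, rfl⟩), radial_of_norm_eq_one h1]
  have hradial {x : Fin N → ℝ} (hx : x ∈ closedBall 0 1) (hx0 : x ≠ 0) {t : ℝ}
      (ht : t ∈ Icc (0 : ℝ) 1) : radial x t ∈ closedBall (0 : Fin N → ℝ) 1 ∧ radial x t ≠ 0 := by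
    have hn := norm_radial hx0 ht
    have hx1 := mem_closedBall_zero_iff.mp hx
    have hx2 : 0 < ‖x‖ := norm_pos_iff.mpr hx0
    obtain ⟨ht0, ht1⟩ := ht
    refine ⟨mem_closedBall_zero_iff.mpr (by rw [hn]; nlinarith), norm_pos_iff.mp ?_⟩
    rw [hn]
    rcases ht0.lt_or_eq with h | rfl
    · nlinarith
    · simpa using hx2
  have hcellA {x : Fin N → ℝ} (hx : x ∈ closedBall 0 1) (hx0 : x ≠ 0) : e x ∈ A := by
    rcases (mem_closedBall_zero_iff.mp hx).lt_or_eq with h1 | h1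
    · exact Or.inr ⟨x, ⟨mem_ball_zero_iff.mpr h1, hx0⟩, rfl⟩
    · exact Or.inl (hsphere ⟨x, mem_sphere_zero_iff_norm.mpr h1, rfl⟩)
  refine relCycles_le_of_deformation θ subset_union_left h ?_ ?_ ?_ ?_ ?_ n
  · rw [continuousOn_iff_isClosed]
    intro T hT
    have hcont : ContinuousOn (fun p : (Fin N → ℝ) × ℝ => e (radial p.1 p.2))
        ((closedBall 0 1 \ {0}) ×ˢ Icc 0 1) := by
      refine he.comp (f := fun p : (Fin N → ℝ) × ℝ => radial p.1 p.2) ?_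
        fun p hp => (hradial hp.1.1 hp.1.2 hp.2).1
      refine ContinuousOn.smul (f := fun p : (Fin N → ℝ) × ℝ => 1 - p.2 + p.2 / ‖p.1‖) ?_
        continuousOn_fst
      refine ContinuousOn.add (by fun_prop) ?_
      exact continuousOn_snd.div continuousOn_fst.norm fun p hp => norm_ne_zero_iff.mpr hp.1.2
    obtain ⟨C, hC, hCT⟩ := continuousOn_iff_isClosed.mp hcont T hT
    have hcomp : IsCompact ((fun p : (Fin N → ℝ) × ℝ => (e p.1, p.2)) ''
        (closedBall 0 1 ×ˢ Icc 0 1 ∩ C)) := by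
      refine IsCompact.image_of_continuousOn
        (((isCompact_closedBall 0 1).prod isCompact_Icc).inter_right hC) ?_
      refine ContinuousOn.mono ?_ inter_subset_left
      exact (he.comp continuousOn_fst fun p hp => hp.1).prodMk continuousOn_snd
    refine ⟨(Prod.fst ⁻¹' (T ∩ Y)) ∪ _, ((hT.inter hY).preimage continuous_fst).union
      hcomp.isClosed, ?_⟩
    ext ⟨y, t⟩
    constructor
    · rintro ⟨h1, hyA, ht⟩
      refine ⟨?_, hyA, ht⟩
      rcases hyA with hy | ⟨x, ⟨hx, hx0⟩, rfl⟩
      · refine Or.inl ⟨?_, hy⟩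
        have : h y t ∈ T := h1
        rwa [hYfix hy] at this
      · have hx' := ball_subset_closedBall hx
        have h2 : h (e x) t ∈ T := h1
        rw [hcell hx'] at h2
        have h3 : (x, t) ∈ C ∩ ((closedBall 0 1 \ {0}) ×ˢ Icc 0 1) :=
          hCT ▸ ⟨h2, ⟨hx', hx0⟩, ht⟩
        exact Or.inr ⟨(x, t), ⟨⟨hx', ht⟩, h3.1⟩, rfl⟩
    · rintro ⟨h1, hyA, ht⟩
      refine ⟨?_, hyA, ht⟩
      change h y t ∈ T
      rcases h1 with ⟨h1, h2⟩ | ⟨⟨x, t'⟩, ⟨⟨hx, -⟩, hxC⟩, hxy⟩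
      · rwa [hYfix h2]
      · obtain ⟨rfl, rfl⟩ : e x = y ∧ t' = t := Prod.mk.injEq _ _ _ _ ▸ hxy
        have hx0 : x ≠ 0 := by rintro rfl; exact h0A hyA
        rw [hcell hx]
        have : (x, t') ∈ (fun p : (Fin N → ℝ) × ℝ => e (radial p.1 p.2)) ⁻¹' T ∩
            ((closedBall 0 1 \ {0}) ×ˢ Icc 0 1) := hCT ▸ ⟨hxC, ⟨hx, hx0⟩, ht⟩
        exact this.1
  · rintro y (hy | ⟨x, ⟨hx, -⟩, rfl⟩)
    · exact hYfix hy 0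
    · rw [hcell (ball_subset_closedBall hx), radial_zero]
  · rintro y (hy | ⟨x, ⟨hx, hx0⟩, rfl⟩) t ht
    · rw [hYfix hy]; exact Or.inl hy
    · have hx' := ball_subset_closedBall hx
      rw [hcell hx']
      exact hcellA (hradial hx' hx0 ht).1 (hradial hx' hx0 ht).2
  · intro y hy t _
    rw [hYfix hy]; exact hy
  · rintro y (hy | ⟨x, ⟨hx, hx0⟩, rfl⟩)
    · rw [hYfix hy]; exact hy
    · rw [hcell (ball_subset_closedBall hx)]
      refine hsphere ⟨_, mem_sphere_zero_iff_norm.mpr ?_, rfl⟩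
      rw [norm_radial hx0 (by simp)]
      simp

end Attach

end TwistedChain

end

/-! ### The homology of CW complexes of finite type -/

noncomputable section

section Compactness

open Set

variable {X : Type*} [TopologicalSpace X] [T2Space X] [CWComplex (univ : Set X)]

/-- A compact set meets only finitely many cells of a CW complex, so that it lies in a skeleton. -/
theorem IsCompact.exists_subset_skeletonLT {K : Set X} (hK : IsCompact K) :
    ∃ m : ℕ, K ⊆ CWComplex.skeletonLT (univ : Set X) m := by
  by_contra! hcon
  simp only [not_subset] at hcon
  choose x hxK hx using hcon
  let F : ℕ → Set X := fun m => x '' Ici m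
  have hF (m : ℕ) : IsClosed (F m) := by
    rw [CWComplex.closed (univ : Set X) _ (subset_univ _)]
    intro n j
    refine (((finite_Iio (n + 1)).image x).subset ?_).isClosed
    rintro _ ⟨⟨l, -, rfl⟩, hl⟩
    refine ⟨l, ?_, rfl⟩
    by_contra h
    refine hx l (RelCWComplex.skeletonLT_mono ?_ (RelCWComplex.closedCell_subset_skeletonLT n j hl))
    rw [mem_Iio, not_lt] at h
    exact_mod_cast h
  obtain ⟨y, hy⟩ := IsCompact.nonempty_iInter_of_sequence_nonempty_isCompact_isClosed F
    (fun m => image_mono (Ici_subset_Ici.mpr (Nat.le_succ m)))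
    (fun m => ⟨x m, m, self_mem_Ici, rfl⟩)
    (hK.of_isClosed_subset (hF 0) (by rintro _ ⟨l, -, rfl⟩; exact hxK l)) hF
  rw [mem_iInter] at hy
  have hy' : y ∈ ⋃ n : ℕ, (CWComplex.skeletonLT (univ : Set X) n : Set X) := by
    rw [CWComplex.iUnion_skeletonLT_eq_complex]
    trivial
  obtain ⟨m, hm⟩ := mem_iUnion.mp hy'
  obtain ⟨l, hl, rfl⟩ := hy m
  exact hx l (RelCWComplex.skeletonLT_mono (by exact_mod_cast hl) hm)

end Compactness

namespace TwistedChain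

open Set Metric

variable {X : Type*} [TopologicalSpace X] {x₀ : X} {R : Type*} [CommRing R]
  (θ : FundamentalGroup X x₀ →* Rˣ)

theorem smallMod_cycles_of_relCycles [IsNoetherianRing R] {b : Prop} {Y Y' : Set X} (n : ℕ)
    (h : SmallMod b (relCycles θ n Y' Y) (inside R x₀ n Y ⊔ boundaries θ n Y')) :
    SmallMod b (relCycles θ n Y' ∅) (relCycles θ n Y ∅ ⊔ boundaries θ n Y') := by
  have h' := (h.mono (X' := relCycles θ n Y' ∅)
    (inf_le_inf_left _ (bdInside_mono θ (empty_subset Y))) le_rfl).inf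
  refine h'.mono le_rfl ?_
  rintro z ⟨hz, hz'⟩
  obtain ⟨a, ha, w, hw, rfl⟩ := Submodule.mem_sup.mp hz'
  refine Submodule.add_mem_sup ⟨ha, ?_⟩ hw
  rw [← add_sub_cancel_right a w]
  exact sub_mem hz.2 (boundaries_le_bdInside θ hw)

theorem relCycles_empty (n : ℕ) : relCycles θ n (∅ : Set X) ∅ = ⊥ := by
  refine eq_bot_iff.mpr (inf_le_left.trans (inside_le θ fun s hs => ?_))
  exact absurd (hs ⟨vertices n 0, rfl⟩) (notMem_empty _)

variable [T2Space X] [CWComplex (univ : Set X)]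

theorem exists_mem_inside_skeletonLT {n : ℕ} (c : TwistedChain R x₀ n) :
    ∃ M : ℕ, c ∈ inside R x₀ n (CWComplex.skeletonLT (univ : Set X) M) := by
  choose m hm using fun σ : Liftable x₀ n =>
    (isCompact_range σ.1.continuous).exists_subset_skeletonLT
  refine ⟨c.support.sup m, (Finsupp.mem_supported R c).mpr fun σ hσ => (hm σ).trans ?_⟩
  exact RelCWComplex.skeletonLT_mono (by exact_mod_cast Finset.le_sup hσ)

theorem smallMod_cycles_union_closedCell [IsNoetherianRing R] (N : ℕ)
    (S : Finset (RelCWComplex.cell (univ : Set X) N)) (n : ℕ) :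
    SmallMod (n < N)
      (relCycles θ n (CWComplex.skeletonLT (univ : Set X) N ∪
        ⋃ i ∈ S, CWComplex.closedCell N i) ∅)
      (relCycles θ n (CWComplex.skeletonLT (univ : Set X) N) ∅ ⊔
        boundaries θ n (CWComplex.skeletonLT (univ : Set X) N ∪
          ⋃ i ∈ S, CWComplex.closedCell N i)) := by
  classical
  induction S using Finset.induction_on with
  | empty => exact SmallMod.of_le (by simp)
  | insert i S hi ih =>
    let Y : Set X := CWComplex.skeletonLT (univ : Set X) N ∪ ⋃ i ∈ S, CWComplex.closedCell N i
    have hYY : (CWComplex.skeletonLT (univ : Set X) N ∪ ⋃ j ∈ insert i S,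
        CWComplex.closedCell N j : Set X) = Y ∪ CWComplex.closedCell N i := by
      rw [Finset.set_biUnion_insert, union_comm (CWComplex.closedCell N i), ← union_assoc]
    have hY : IsClosed Y := (RelCWComplex.Subcomplex.closed _).union
      (S.finite_toSet.isClosed_biUnion fun i _ => RelCWComplex.isClosed_closedCell)
    have hdisj : Disjoint (CWComplex.openCell N i) Y := by
      refine Disjoint.union_right (RelCWComplex.disjoint_skeletonLT_openCell le_rfl).symm ?_
      rw [disjoint_iUnion₂_right]
      intro j hj
      rw [← CWComplex.cellFrontier_union_openCell_eq_closedCell]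
      refine Disjoint.union_right ?_ ?_
      · exact ((RelCWComplex.disjoint_skeletonLT_openCell le_rfl).mono_left
          (RelCWComplex.cellFrontier_subset_skeletonLT N j)).symm
      · refine RelCWComplex.disjoint_openCell_of_ne ?_
        intro h
        simp only [Sigma.mk.injEq, heq_eq_eq, true_and] at h
        exact hi (h ▸ hj)
    have hsource := RelCWComplex.source_eq (C := (univ : Set X)) N i
    have h := smallMod_relCycles_attach θ (Y := Y) (N := N)
      (e := RelCWComplex.map (C := (univ : Set X)) N i)
      (g := (RelCWComplex.map (C := (univ : Set X)) N i).symm) hY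
      (RelCWComplex.continuousOn N i) (by
        have := RelCWComplex.continuousOn_symm (C := (univ : Set X)) N i
        rwa [← PartialEquiv.image_source_eq_target, hsource] at this)
      (fun x hx => (RelCWComplex.map (C := (univ : Set X)) N i).left_inv (by
        have := hsource ▸ hx
        exact this))
      ((RelCWComplex.cellFrontier_subset_skeletonLT N i).trans subset_union_left) hdisj n
    rw [hYY]
    refine (smallMod_cycles_of_relCycles θ n h).trans (SmallMod.sup ?_
      (SmallMod.of_le le_sup_right))
    exact ih.mono le_rfl (sup_le_sup_left (boundaries_mono θ subset_union_left) _)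

variable [RelCWComplex.FiniteType (univ : Set X)]

theorem smallMod_cycles_skeletonLT_succ [IsNoetherianRing R] (N n : ℕ) :
    SmallMod (n < N) (relCycles θ n (CWComplex.skeletonLT (univ : Set X) (N + 1 : ℕ)) ∅)
      (relCycles θ n (CWComplex.skeletonLT (univ : Set X) N) ∅ ⊔
        boundaries θ n (CWComplex.skeletonLT (univ : Set X) (N + 1 : ℕ))) := by
  have : Finite (RelCWComplex.cell (univ : Set X) N) :=
    RelCWComplex.FiniteType.finite_cell (D := ∅) N
  have := Fintype.ofFinite (RelCWComplex.cell (univ : Set X) N)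
  have h := smallMod_cycles_union_closedCell θ N Finset.univ n
  have e : (CWComplex.skeletonLT (univ : Set X) N ∪
      ⋃ i ∈ (Finset.univ : Finset (RelCWComplex.cell (univ : Set X) N)),
        CWComplex.closedCell N i : Set X) = CWComplex.skeletonLT (univ : Set X) (N + 1 : ℕ) := by
    rw [Nat.cast_succ, ← CWComplex.skeletonLT_union_iUnion_closedCell_eq_skeletonLT_succ]
    simp
  rwa [e] at h

theorem smallMod_cycles_skeletonLT [IsNoetherianRing R] (N n : ℕ) :
    SmallMod False (relCycles θ n (CWComplex.skeletonLT (univ : Set X) N) ∅)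
      (boundaries θ n (CWComplex.skeletonLT (univ : Set X) N)) := by
  induction N with
  | zero =>
    rw [Nat.cast_zero, CWComplex.skeletonLT_zero_eq_empty, relCycles_empty]
    exact SmallMod.of_le bot_le
  | succ N ih =>
    obtain ⟨F, hF, -, hle⟩ := smallMod_cycles_skeletonLT_succ θ N n
    refine SmallMod.trans ⟨F, hF, False.elim, hle⟩ (SmallMod.sup (ih.mono le_rfl ?_)
      (SmallMod.of_le le_rfl))
    exact boundaries_mono θ (RelCWComplex.skeletonLT_mono (by exact_mod_cast N.le_succ))

theorem cycles_skeletonLT_le [IsNoetherianRing R] (n M : ℕ) :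
    relCycles θ n (CWComplex.skeletonLT (univ : Set X) (n + 1 + M : ℕ)) ∅ ≤
      relCycles θ n (CWComplex.skeletonLT (univ : Set X) (n + 1 : ℕ)) ∅ ⊔
        boundaries θ n (CWComplex.skeletonLT (univ : Set X) (n + 1 + M : ℕ)) := by
  induction M with
  | zero => exact le_sup_left
  | succ M ih =>
    obtain ⟨F, -, hF, hle⟩ := smallMod_cycles_skeletonLT_succ (X := X) θ (n + 1 + M) n
    rw [hF (by omega), bot_sup_eq] at hle
    refine hle.trans (sup_le (ih.trans (sup_le_sup_left ?_ _)) le_sup_right)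
    exact boundaries_mono θ (RelCWComplex.skeletonLT_mono (by exact_mod_cast Nat.le_succ _))

/-- The homology of a CW complex of finite type with coefficients in a local system of free modules
of rank one over a noetherian ring is finitely generated. -/
theorem smallMod_cycles [IsNoetherianRing R] (n : ℕ) :
    SmallMod False (relCycles θ n (univ : Set X) ∅) (boundaries θ n (univ : Set X)) := by
  refine (smallMod_cycles_skeletonLT (X := X) θ (n + 1) n).mono le_rfl
    (boundaries_mono θ (subset_univ _)) |>.sup (SmallMod.of_le le_rfl) |>.mono ?_ le_rfl
  rintro z ⟨-, hz⟩
  obtain ⟨M, hM⟩ := exists_mem_inside_skeletonLT z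
  have hzM : z ∈ relCycles θ n (CWComplex.skeletonLT (univ : Set X) (n + 1 + M : ℕ)) ∅ :=
    ⟨inside_mono (RelCWComplex.skeletonLT_mono (by exact_mod_cast Nat.le_add_left _ _)) hM, hz⟩
  exact sup_le_sup_left (boundaries_mono θ (subset_univ _)) _ (cycles_skeletonLT_le θ n M hzM)

end TwistedChain

end

/-! ### Semicontinuity of the rank of a matrix -/

noncomputable section

open scoped Matrix

section MatrixRank

variable {m n : Type*} [Fintype m] [Fintype n]

theorem Matrix.exists_linearIndependent_rows {k : Type*} [Field k] (M : Matrix m n k) :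
    ∃ r : Fin M.rank → m, LinearIndependent k (M.submatrix r id).row := by
  obtain ⟨κ, a, ha, hspan, hli⟩ := exists_linearIndependent' k M.row
  have : Fintype κ := Fintype.ofInjective a ha
  have hcard : Fintype.card κ = M.rank := by
    rw [M.rank_eq_finrank_span_row, ← hspan, finrank_span_eq_card hli]
  let e : Fin M.rank ≃ κ := (Fintype.equivFinOfCardEq hcard).symm
  exact ⟨a ∘ e, hli.comp e e.injective⟩

/-- A matrix over a field has a nonvanishing minor of the size of its rank. -/
theorem Matrix.exists_det_submatrix_ne_zero {k : Type*} [Field k] (M : Matrix m n k) :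
    ∃ (r : Fin M.rank → m) (c : Fin M.rank → n), (M.submatrix r c).det ≠ 0 := by
  obtain ⟨r, hr⟩ := M.exists_linearIndependent_rows
  obtain ⟨c, hc⟩ := (M.submatrix r id)ᵀ.exists_linearIndependent_rows
  have hrank : (M.submatrix r id)ᵀ.rank = M.rank := by
    rw [Matrix.rank_transpose, hr.rank_matrix, Fintype.card_fin]
  refine ⟨r, c ∘ Fin.cast hrank.symm, ?_⟩
  have h2 := hc.comp _ (Fin.cast_injective hrank.symm)
  rw [← isUnit_iff_ne_zero, ← Matrix.isUnit_iff_isUnit_det, ← Matrix.isUnit_transpose,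
    ← Matrix.linearIndependent_rows_iff_isUnit]
  exact h2

/-- The rank of a matrix whose entries depend algebraically on a parameter is lower
semicontinuous. -/
theorem Matrix.exists_rank_map_le {R k : Type*} [CommRing R] [Field k] (M : Matrix m n R)
    (χ₀ : R →+* k) :
    ∃ a : R, χ₀ a ≠ 0 ∧ ∀ χ : R →+* k, χ a ≠ 0 → (M.map χ₀).rank ≤ (M.map χ).rank := by
  obtain ⟨r, c, h⟩ := (M.map χ₀).exists_det_submatrix_ne_zero
  have hdet (χ : R →+* k) : χ (M.submatrix r c).det = ((M.map χ).submatrix r c).det := by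
    rw [RingHom.map_det]
    rfl
  refine ⟨(M.submatrix r c).det, by rwa [hdet], fun χ hχ => ?_⟩
  rw [hdet] at hχ
  have := Matrix.rank_of_det_ne_zero hχ
  rw [Fintype.card_fin] at this
  rw [← this]
  exact Matrix.rank_submatrix_le _ _ _

end MatrixRank

/-! ### Subquotients -/

section Subquotient

variable {k M M' : Type*} [Field k] [AddCommGroup M] [Module k M] [AddCommGroup M'] [Module k M']

/-- A criterion for a linear map to induce an isomorphism of subquotients. -/
theorem nonempty_subquotient_equiv (F : M →ₗ[k] M') {Z B : Submodule k M} {Z' B' : Submodule k M'}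
    (hZ : ∀ z ∈ Z, F z ∈ Z') (hB : ∀ z ∈ Z, (F z ∈ B' ↔ z ∈ B)) (hsurj : Z' ≤ Z.map F ⊔ B') :
    Nonempty ((Z ⧸ B.submoduleOf Z) ≃ₗ[k] (Z' ⧸ B'.submoduleOf Z')) := by
  let G : Z →ₗ[k] Z' ⧸ B'.submoduleOf Z' := (B'.submoduleOf Z').mkQ ∘ₗ F.restrict hZ
  have hker : LinearMap.ker G = B.submoduleOf Z := by
    ext z
    rw [LinearMap.mem_ker, LinearMap.comp_apply, Submodule.mkQ_apply,
      Submodule.Quotient.mk_eq_zero]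
    exact hB z z.2
  have hG : Function.Surjective G := by
    intro q
    obtain ⟨z', rfl⟩ := Submodule.mkQ_surjective _ q
    obtain ⟨_, ⟨z, hz, rfl⟩, b, hb, hzb⟩ := Submodule.mem_sup.mp (hsurj z'.2)
    refine ⟨⟨z, hz⟩, ?_⟩
    rw [LinearMap.comp_apply, ← sub_eq_zero, ← map_sub, Submodule.mkQ_apply,
      Submodule.Quotient.mk_eq_zero]
    change F z - z' ∈ B'
    rw [← hzb, sub_add_cancel_left]
    exact neg_mem hb
  exact ⟨(Submodule.quotEquivOfEq _ _ hker.symm).trans (G.quotKerEquivOfSurjective hG)⟩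

theorem finrank_subquotient [FiniteDimensional k M] {Z B : Submodule k M} (h : B ≤ Z) :
    Module.finrank k (Z ⧸ B.submoduleOf Z) + Module.finrank k B = Module.finrank k Z := by
  rw [← Submodule.finrank_quotient_add_finrank (B.submoduleOf Z),
    (Submodule.submoduleOfEquivOfLe h).finrank_eq]

end Subquotient

/-! ### Semilinear functionals on a complex -/

section Semilinear

variable {R k : Type*} [CommRing R] [Field k] (χ : R →+* k)
  {A B D : Type*} [AddCommGroup A] [Module R A] [AddCommGroup B] [Module R B]
  [AddCommGroup D] [Module R D]

variable (B) in
/-- The `χ`-semilinear functionals on a module over the source of `χ : R → k`. -/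
def Functional : Type _ := B →ₛₗ[χ] k

namespace Functional

instance : AddCommGroup (Functional χ B) := inferInstanceAs (AddCommGroup (B →ₛₗ[χ] k))
instance : Module k (Functional χ B) := inferInstanceAs (Module k (B →ₛₗ[χ] k))
instance : FunLike (Functional χ B) B k := inferInstanceAs (FunLike (B →ₛₗ[χ] k) B k)
instance : SemilinearMapClass (Functional χ B) χ B k :=
  inferInstanceAs (SemilinearMapClass (B →ₛₗ[χ] k) χ B k)

/-- Precomposition of `χ`-semilinear functionals with a linear map. -/
def precomp (f : A →ₗ[R] B) : Functional χ B →ₗ[k] Functional χ A where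
  toFun φ := LinearMap.comp (σ₁₂ := RingHom.id R) (σ₂₃ := χ) (σ₁₃ := χ) φ f
  map_add' _ _ := rfl
  map_smul' _ _ := rfl

@[simp]
theorem precomp_apply (f : A →ₗ[R] B) (φ : Functional χ B) (a : A) :
    precomp χ f φ a = φ (f a) := rfl

variable {χ} in
@[ext]
theorem ext {φ ψ : Functional χ B} (h : ∀ b, φ b = ψ b) : φ = ψ := DFunLike.ext _ _ h

@[simp]
theorem sub_apply (φ ψ : Functional χ B) (b : B) : (φ - ψ) b = φ b - ψ b := rfl

theorem mem_ker_precomp {f : A →ₗ[R] B} {φ : Functional χ B} :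
    φ ∈ LinearMap.ker (precomp χ f) ↔ ∀ a, φ (f a) = 0 :=
  ⟨fun h a => DFunLike.congr_fun (LinearMap.mem_ker.mp h) a, fun h => ext h⟩

variable {χ} in
theorem exists_comp_eq_of_ker_le {π : A →ₗ[R] B} (hπ : Function.Surjective π)
    (ψ : Functional χ A) (h : ∀ a, π a = 0 → ψ a = 0) :
    ∃ φ : Functional χ B, ∀ a, φ (π a) = ψ a := by
  have hψ (a b : A) (hab : π a = π b) : ψ a = ψ b := by
    rw [← sub_eq_zero, ← map_sub]
    exact h _ (by rw [map_sub, hab, sub_self])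
  choose s hs using hπ
  refine ⟨({ toFun := fun b => ψ (s b), map_add' := ?_, map_smul' := ?_ } : B →ₛₗ[χ] k), ?_⟩
  · intro x y
    rw [← map_add]
    exact hψ _ _ (by simp only [map_add, hs])
  · intro r x
    rw [← map_smulₛₗ]
    exact hψ _ _ (by simp only [map_smul, hs])
  · intro a
    exact hψ _ _ (hs _)

variable {χ} in
/-- Functionals extend from the kernel of a surjection onto a projective module, as this kernel is a
direct summand. -/
theorem exists_extension [Module.Projective R B] {π : A →ₗ[R] B} (hπ : Function.Surjective π)
    (φ : Functional χ (LinearMap.ker π)) : ∃ ψ : Functional χ A, ∀ x, ψ x.1 = φ x := by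
  obtain ⟨s, hs⟩ := Module.projective_lifting_property π LinearMap.id hπ
  have hs' (b : B) : π (s b) = b := LinearMap.congr_fun hs b
  let r : A →ₗ[R] LinearMap.ker π :=
    LinearMap.codRestrict _ (LinearMap.id - s ∘ₗ π) fun x => by simp [hs']
  refine ⟨precomp χ r φ, fun x => ?_⟩
  rw [precomp_apply]
  congr 1
  ext
  have : π x = 0 := x.2
  simp [r, this]

/-- The cohomology of the complex of `χ`-semilinear functionals on a complex
`D → B → A`. -/
abbrev cohomology (f : B →ₗ[R] A) (g : D →ₗ[R] B) : Type _ :=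
  LinearMap.ker (precomp χ g) ⧸
    (LinearMap.range (precomp χ f)).submoduleOf (LinearMap.ker (precomp χ g))

variable {f : B →ₗ[R] A} {g : D →ₗ[R] B}

/-- The functionals on a finite free module are given by their values on the basis. -/
def ofTuple (n : ℕ) : (Fin n → k) →ₗ[k] Functional χ (Fin n → R) where
  toFun v := ({ toFun := fun x => ∑ i, χ (x i) * v i
                map_add' := fun x y => by simp [add_mul, Finset.sum_add_distrib]
                map_smul' := fun r x => by simp [Finset.mul_sum, mul_assoc] } :
                  (Fin n → R) →ₛₗ[χ] k)
  map_add' v w := by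
    refine ext fun x => ?_
    change ∑ i, χ (x i) * (v i + w i) = ∑ i, χ (x i) * v i + ∑ i, χ (x i) * w i
    simp [mul_add, Finset.sum_add_distrib]
  map_smul' z v := by
    refine ext fun x => ?_
    change ∑ i, χ (x i) * (z * v i) = z * ∑ i, χ (x i) * v i
    rw [Finset.mul_sum]
    exact Finset.sum_congr rfl fun i _ => mul_left_comm _ _ _

theorem ofTuple_apply (n : ℕ) (v : Fin n → k) (x : Fin n → R) :
    ofTuple χ n v x = ∑ i, χ (x i) * v i := rfl

theorem exists_ofTuple_eq {n : ℕ} (φ : Functional χ (Fin n → R)) : ∃ v, ofTuple χ n v = φ := by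
  refine ⟨fun i => φ (Pi.single i 1), ext fun x => ?_⟩
  rw [ofTuple_apply]
  conv_rhs => rw [pi_eq_sum_univ' x, map_sum]
  refine Finset.sum_congr rfl fun i _ => ?_
  rw [map_smulₛₗ, smul_eq_mul]

theorem ofTuple_comp_toLin {m n : ℕ} (M : Matrix (Fin m) (Fin n) R) (v : Fin n → k) :
    precomp χ (Matrix.vecMulLinear M) (ofTuple χ n v) = ofTuple χ m ((M.map χ).mulVec v) := by
  refine ext fun x => ?_
  simp only [precomp_apply, ofTuple_apply, Matrix.vecMulLinear_apply, Matrix.vecMul, Matrix.mulVec,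
    dotProduct, map_sum, map_mul, Matrix.map_apply, Finset.sum_mul, Finset.mul_sum]
  rw [Finset.sum_comm]
  exact Finset.sum_congr rfl fun i _ => Finset.sum_congr rfl fun j _ => mul_assoc _ _ _

theorem ofTuple_injective (n : ℕ) : Function.Injective (ofTuple (R := R) χ n) := by
  intro v w h
  ext i
  have := DFunLike.congr_fun h (Pi.single i 1)
  simpa [ofTuple_apply, Pi.single_apply, ite_mul] using this

/-- The cohomology of the functionals on a complex of finite free modules. -/
theorem rank_cohomology_matrix {a b c : ℕ} (P : Matrix (Fin a) (Fin b) R)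
    (Q : Matrix (Fin b) (Fin c) R) (h : P * Q = 0) :
    ∃ d : ℕ, Module.rank k (cohomology χ (Matrix.vecMulLinear Q) (Matrix.vecMulLinear P)) = d ∧
      d + (P.map χ).rank + (Q.map χ).rank = b := by
  let Z := LinearMap.ker (P.map χ).mulVecLin
  let B := LinearMap.range (Q.map χ).mulVecLin
  have hBZ : B ≤ Z := by
    rintro _ ⟨v, rfl⟩
    have : (P.map χ) * (Q.map χ) = 0 := by
      rw [← Matrix.map_mul, h]
      ext; simp
    simp [Z, LinearMap.mem_ker, this]
  obtain ⟨e⟩ : Nonempty ((Z ⧸ B.submoduleOf Z) ≃ₗ[k]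
      cohomology χ (Matrix.vecMulLinear Q) (Matrix.vecMulLinear P)) := by
    refine nonempty_subquotient_equiv (ofTuple χ b) ?_ ?_ ?_
    · intro v hv
      rw [LinearMap.mem_ker, ofTuple_comp_toLin, show (P.map χ).mulVec v = 0 from hv, map_zero]
    · intro v _
      constructor
      · rintro ⟨φ, hφ⟩
        obtain ⟨w, rfl⟩ := exists_ofTuple_eq χ φ
        rw [ofTuple_comp_toLin] at hφ
        exact ⟨w, ofTuple_injective χ b hφ⟩
      · rintro ⟨w, rfl⟩
        exact ⟨ofTuple χ c w, ofTuple_comp_toLin χ Q w⟩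
    · intro φ hφ
      obtain ⟨v, rfl⟩ := exists_ofTuple_eq χ φ
      rw [LinearMap.mem_ker, ofTuple_comp_toLin] at hφ
      refine Submodule.mem_sup_left ⟨v, ?_, rfl⟩
      exact ofTuple_injective χ a (hφ.trans (map_zero _).symm)
  refine ⟨Module.finrank k (Z ⧸ B.submoduleOf Z), ?_, ?_⟩
  · have : Module.Finite k (cohomology χ (Matrix.vecMulLinear Q) (Matrix.vecMulLinear P)) :=
      Module.Finite.equiv e
    rw [e.finrank_eq, Module.finrank_eq_rank]
  · have h1 := finrank_subquotient hBZ
    have h2 := (P.map χ).mulVecLin.finrank_range_add_finrank_ker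
    rw [Module.finrank_fin_fun] at h2
    have h3 : Module.finrank k (LinearMap.range (P.map χ).mulVecLin) = (P.map χ).rank := rfl
    have h4 : Module.finrank k B = (Q.map χ).rank := rfl
    have h5 : Module.finrank k (LinearMap.ker (P.map χ).mulVecLin) = Module.finrank k Z := rfl
    omega

end Functional

end Semilinear

end

/-! ### Semicontinuity of the cohomology of a complex -/

noncomputable section

universe u

namespace Functional

section Replacement

variable {R k : Type*} [CommRing R] [Field k] (χ : R →+* k) {b : ℕ}
  {C₀ C₁ C₂ C₃ C₄ : Type*} [AddCommGroup C₀] [Module R C₀] [AddCommGroup C₁] [Module R C₁]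
  [AddCommGroup C₂] [Module R C₂] [AddCommGroup C₃] [Module R C₃] [AddCommGroup C₄] [Module R C₄]
  (d₀ : C₁ →ₗ[R] C₀) (d₁ : C₂ →ₗ[R] C₁) (d₂ : C₃ →ₗ[R] C₂) (d₃ : C₄ →ₗ[R] C₃)
  (u : (Fin b → R) →ₗ[R] C₁)

theorem exists_vecMulLinear_eq {m n : ℕ} (f : (Fin m → R) →ₗ[R] (Fin n → R)) :
    ∃ M : Matrix (Fin m) (Fin n) R, Matrix.vecMulLinear M = f := by
  refine ⟨Matrix.of fun i j => f (Pi.single i 1) j, ?_⟩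
  refine LinearMap.pi_ext' fun i => LinearMap.ext_ring (funext fun j => ?_)
  simp

/-- If `C₁` is generated by a finite free module modulo the image of `C₂`, then the first
cohomology can be computed by matrices. -/
theorem exists_matrix_cohomology [IsNoetherianRing R] [Module.Free R C₀] [Module.Finite R C₀]
    (hd : ∀ x, d₀ (d₁ x) = 0) (hu : Function.Surjective (u.coprod d₁)) :
    ∃ (a c : ℕ) (P : Matrix (Fin a) (Fin b) R) (Q : Matrix (Fin b) (Fin c) R), P * Q = 0 ∧
      ∀ χ : R →+* k, Nonempty (cohomology χ d₀ d₁ ≃ₗ[k]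
        cohomology χ (Matrix.vecMulLinear Q) (Matrix.vecMulLinear P)) := by
  let e : C₀ ≃ₗ[R] (Fin (Fintype.card (Module.Free.ChooseBasisIndex R C₀)) → R) :=
    ((Module.Free.chooseBasis R C₀).reindex (Fintype.equivFin _)).equivFun
  obtain ⟨Q, hQ⟩ := exists_vecMulLinear_eq (e.toLinearMap ∘ₗ d₀ ∘ₗ u)
  let L : Submodule R (Fin b → R) := (LinearMap.ker (u.coprod d₁)).map (LinearMap.fst R _ _)
  have hL : L.FG := IsNoetherian.noetherian L
  obtain ⟨a, s, hs⟩ := Submodule.fg_iff_exists_fin_generating_family.mp hL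
  obtain ⟨P, hP⟩ := exists_vecMulLinear_eq (Fintype.linearCombination R s)
  have hrange (x : Fin b → R) : (∃ y, Matrix.vecMulLinear P y = x) ↔ ∃ c, u x + d₁ c = 0 := by
    rw [hP, ← LinearMap.mem_range, Fintype.range_linearCombination, hs]
    constructor
    · rintro ⟨⟨x, c⟩, h, rfl⟩
      exact ⟨c, h⟩
    · rintro ⟨c, h⟩
      exact ⟨(x, c), h, rfl⟩
  have hQ' (x : Fin b → R) : Matrix.vecMulLinear Q x = e (d₀ (u x)) := LinearMap.congr_fun hQ x
  refine ⟨a, _, P, Q, ?_, fun χ => ?_⟩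
  · ext i j
    obtain ⟨c, hc⟩ := (hrange _).mp ⟨Pi.single i 1, rfl⟩
    have h := congrFun (hQ' (Matrix.vecMulLinear P (Pi.single i 1))) j
    rw [eq_neg_of_add_eq_zero_left hc, map_neg, hd, neg_zero, map_zero] at h
    have h' : Matrix.vecMul (P.row i) Q j = 0 := by simpa using h
    exact h'
  refine nonempty_subquotient_equiv (precomp χ u) ?_ ?_ ?_
  · intro φ hφ
    rw [mem_ker_precomp] at hφ ⊢
    intro y
    obtain ⟨c, hc⟩ := (hrange _).mp ⟨y, rfl⟩
    rw [precomp_apply, eq_neg_of_add_eq_zero_left hc, map_neg, hφ, neg_zero]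
  · intro φ hφ
    rw [mem_ker_precomp] at hφ
    constructor
    · rintro ⟨η, hη⟩
      refine ⟨precomp χ e.toLinearMap η, ext fun y => ?_⟩
      obtain ⟨⟨x, c⟩, rfl⟩ := hu y
      have := DFunLike.congr_fun hη x
      rw [precomp_apply, precomp_apply, hQ'] at this
      simp [hφ, hd, this]
    · rintro ⟨η, rfl⟩
      refine ⟨precomp χ e.symm.toLinearMap η, ext fun x => ?_⟩
      simp [hQ']
  · intro ψ hψ
    rw [mem_ker_precomp] at hψ
    obtain ⟨φ, hφ⟩ := exists_comp_eq_of_ker_le hu (precomp χ (LinearMap.fst R _ _) ψ) (by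
      rintro ⟨x, c⟩ h
      obtain ⟨y, rfl⟩ := (hrange x).mpr ⟨c, h⟩
      exact hψ y)
    refine Submodule.mem_sup_left ⟨φ, (mem_ker_precomp χ).mpr fun c => ?_, ext fun x => ?_⟩
    · have := hφ (0, c)
      simpa using this
    · have := hφ (x, 0)
      simpa using this

/-- The differential `C₃ → ker (F ⊕ C₂ → C₁)`. -/
def replacementDiff (hd : ∀ x, d₁ (d₂ x) = 0) : C₃ →ₗ[R] LinearMap.ker (u.coprod d₁) :=
  LinearMap.codRestrict _ (LinearMap.inr R _ _ ∘ₗ d₂) fun x => by simp [hd]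

/-- The differential `ker (F ⊕ C₂ → C₁) → F`. -/
def replacementProj : LinearMap.ker (u.coprod d₁) →ₗ[R] (Fin b → R) :=
  LinearMap.fst R _ _ ∘ₗ (LinearMap.ker (u.coprod d₁)).subtype

variable [Module.Projective R C₁] (hu : Function.Surjective (u.coprod d₁))
  (hd : ∀ x, d₁ (d₂ x) = 0)

include hu in
theorem projective_ker_coprod [Module.Projective R C₂] :
    Module.Projective R (LinearMap.ker (u.coprod d₁)) := by
  obtain ⟨s, hs⟩ := Module.projective_lifting_property (u.coprod d₁) LinearMap.id hu
  have hs' (y : C₁) : (u.coprod d₁) (s y) = y := LinearMap.congr_fun hs y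
  refine Module.Projective.of_split (LinearMap.ker (u.coprod d₁)).subtype
    (LinearMap.codRestrict _ (LinearMap.id - s ∘ₗ u.coprod d₁) fun x => by
      rw [LinearMap.mem_ker, LinearMap.sub_apply, map_sub, LinearMap.comp_apply, hs']
      exact sub_self _) ?_
  refine LinearMap.ext fun x => Subtype.ext ?_
  have : (u.coprod d₁) x.1 = 0 := x.2
  change x.1 - s ((u.coprod d₁) x.1) = x.1
  rw [this, map_zero, sub_zero]

include hu in
theorem cohomology_replacement_one : Nonempty (cohomology χ d₁ d₂ ≃ₗ[k]
    cohomology χ (replacementProj d₁ u) (replacementDiff d₁ d₂ u hd)) := by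
  refine nonempty_subquotient_equiv
    (precomp χ (LinearMap.snd R _ _ ∘ₗ (LinearMap.ker (u.coprod d₁)).subtype)) ?_ ?_ ?_
  · intro φ hφ
    rw [mem_ker_precomp] at hφ ⊢
    exact hφ
  · intro φ hφ
    constructor
    · rintro ⟨α, hα⟩
      obtain ⟨η, hη⟩ := exists_comp_eq_of_ker_le hu
        (precomp χ (LinearMap.snd R _ _) φ - precomp χ (LinearMap.fst R _ _) α) (by
          intro x hx
          have := DFunLike.congr_fun hα ⟨x, hx⟩
          rw [sub_apply, sub_eq_zero]
          exact this.symm)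
      refine ⟨η, ext fun c => ?_⟩
      simpa using hη (0, c)
    · rintro ⟨η, rfl⟩
      refine ⟨-precomp χ u η, ext fun x => ?_⟩
      have hx : u x.1.1 + d₁ x.1.2 = 0 := x.2
      change -η (u x.1.1) = η (d₁ x.1.2)
      rw [eq_neg_of_add_eq_zero_left hx, map_neg, neg_neg]
  · intro φ hφ
    rw [mem_ker_precomp] at hφ
    obtain ⟨ψ, hψ⟩ := exists_extension hu φ
    rw [Submodule.mem_sup]
    refine ⟨_, ⟨precomp χ (LinearMap.inr R _ _) ψ, (mem_ker_precomp χ).mpr fun x => ?_, rfl⟩, _,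
      ⟨precomp χ (LinearMap.inl R _ _) ψ, rfl⟩, ext fun x => ?_⟩
    · exact (hψ (replacementDiff d₁ d₂ u hd x)).trans (hφ x)
    · change ψ (0, x.1.2) + ψ (x.1.1, 0) = φ x
      rw [← map_add, ← hψ]
      simp

include hu in
theorem cohomology_replacement_two : Nonempty (cohomology χ d₂ d₃ ≃ₗ[k]
    cohomology χ (replacementDiff d₁ d₂ u hd) d₃) := by
  have h : LinearMap.range (precomp χ d₂) =
      LinearMap.range (precomp χ (replacementDiff d₁ d₂ u hd)) := by
    apply le_antisymm
    · rintro _ ⟨η, rfl⟩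
      exact ⟨precomp χ (LinearMap.snd R _ _ ∘ₗ (LinearMap.ker (u.coprod d₁)).subtype) η, rfl⟩
    · rintro _ ⟨η, rfl⟩
      obtain ⟨ψ, hψ⟩ := exists_extension hu η
      exact ⟨precomp χ (LinearMap.inr R _ _) ψ,
        ext fun x => hψ (replacementDiff d₁ d₂ u hd x)⟩
  refine nonempty_subquotient_equiv LinearMap.id (fun _ => id) (fun z _ => ?_) ?_
  · rw [h]; rfl
  · rw [Submodule.map_id]
    exact le_sup_left

end Replacement

/-- A complex of projective modules in degrees `≥ 1` which is finite free in degree `0` and has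
finitely generated homology in degrees `≥ 1`. -/
structure FiniteComplex (R : Type u) [CommRing R] where
  /-- the modules -/
  X : ℕ → ModuleCat.{u} R
  /-- the differentials -/
  d (n : ℕ) : X (n + 1) →ₗ[R] X n
  d_d (n : ℕ) (x : X (n + 2)) : d n (d (n + 1) x) = 0
  free : Module.Free R (X 0)
  finite : Module.Finite R (X 0)
  projective (n : ℕ) : Module.Projective R (X (n + 1))
  homology (n : ℕ) : SmallMod False (LinearMap.ker (d n)) (LinearMap.range (d (n + 1)))

namespace FiniteComplex

variable {R : Type u} [CommRing R] [IsNoetherianRing R] (C : FiniteComplex R)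

theorem exists_generators : ∃ (b : ℕ) (v : (Fin b → R) →ₗ[R] C.X 1),
    Function.Surjective (v.coprod (C.d 1)) := by
  have := C.finite
  have h1 : SmallMod False (⊤ : Submodule R (C.X 1)) (⊤ ⊓ Submodule.comap (C.d 0) ⊥) :=
    SmallMod.comap ⟨Submodule.map (C.d 0) ⊤, IsNoetherian.noetherian _, False.elim, le_sup_left⟩
  obtain ⟨F, hF, -, hle⟩ := (h1.mono le_rfl inf_le_right).trans (C.homology 0)
  obtain ⟨b, s, hs⟩ := Submodule.fg_iff_exists_fin_generating_family.mp hF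
  refine ⟨b, Fintype.linearCombination R s, ?_⟩
  rw [← LinearMap.range_eq_top, LinearMap.range_coprod, Fintype.range_linearCombination, hs]
  exact top_unique hle

/-- A complex with the same cohomology in degrees `≥ 2`, up to a shift. -/
def shift {b : ℕ} (v : (Fin b → R) →ₗ[R] C.X 1) (hv : Function.Surjective (v.coprod (C.d 1))) :
    FiniteComplex R where
  X
    | 0 => .of R (Fin b → R)
    | 1 => .of R (LinearMap.ker (v.coprod (C.d 1)))
    | n + 2 => C.X (n + 3)
  d
    | 0 => replacementProj (C.d 1) v
    | 1 => replacementDiff (C.d 1) (C.d 2) v (C.d_d 1)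
    | n + 2 => C.d (n + 3)
  d_d
    | 0 => fun _ => rfl
    | 1 => fun x => Subtype.ext (Prod.ext rfl (C.d_d 2 x))
    | n + 2 => C.d_d (n + 3)
  free := inferInstanceAs (Module.Free R (Fin b → R))
  finite := inferInstanceAs (Module.Finite R (Fin b → R))
  projective
    | 0 => by
      have := C.projective 0
      have := C.projective 1
      exact projective_ker_coprod (C.d 1) v hv
    | n + 1 => C.projective (n + 2)
  homology
    | 0 => by
      let f : LinearMap.ker (v.coprod (C.d 1)) →ₗ[R] C.X 2 :=
        LinearMap.snd R _ _ ∘ₗ (LinearMap.ker (v.coprod (C.d 1))).subtype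
      have h : SmallMod False ((LinearMap.ker (replacementProj (C.d 1) v)).map f)
          (LinearMap.range (C.d 2)) := by
        refine (C.homology 1).mono ?_ le_rfl
        rintro _ ⟨x, hx, rfl⟩
        have h1 : v x.1.1 + C.d 1 x.1.2 = 0 := x.2
        have h2 : x.1.1 = 0 := hx
        rw [h2, map_zero, zero_add] at h1
        exact h1
      refine h.comap.mono le_rfl ?_
      rintro x ⟨hx, y, hy⟩
      exact ⟨y, Subtype.ext (Prod.ext (Eq.symm hx) hy)⟩
    | 1 => by
      refine (C.homology 2).mono ?_ le_rfl
      intro x hx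
      exact congrArg (fun z : LinearMap.ker (v.coprod (C.d 1)) => z.1.2) hx
    | n + 2 => C.homology (n + 3)

/-- The dimension of the cohomology of the functionals on a complex is upper semicontinuous. -/
theorem exists_rank_le {k : Type*} [Field k] (χ₀ : R →+* k) (i : ℕ) (C : FiniteComplex R) :
    ∃ (a : R) (m : ℕ), χ₀ a ≠ 0 ∧ Module.rank k (cohomology χ₀ (C.d i) (C.d (i + 1))) = m ∧
      ∀ χ : R →+* k, χ a ≠ 0 → Module.rank k (cohomology χ (C.d i) (C.d (i + 1))) ≤ m := by
  induction i generalizing C with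
  | zero =>
    obtain ⟨b, v, hv⟩ := C.exists_generators
    have := C.free
    have := C.finite
    obtain ⟨p, q, P, Q, hPQ, h⟩ :=
      exists_matrix_cohomology (k := k) (C.d 0) (C.d 1) v (C.d_d 0) hv
    have hrank (χ : R →+* k) : ∃ d : ℕ, Module.rank k (cohomology χ (C.d 0) (C.d 1)) = d ∧
        d + (P.map χ).rank + (Q.map χ).rank = b := by
      obtain ⟨d, hd, hd'⟩ := rank_cohomology_matrix χ P Q hPQ
      obtain ⟨e⟩ := h χ
      exact ⟨d, e.rank_eq.trans hd, hd'⟩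
    obtain ⟨a₁, ha₁, h₁⟩ := P.exists_rank_map_le χ₀
    obtain ⟨a₂, ha₂, h₂⟩ := Q.exists_rank_map_le χ₀
    obtain ⟨m, hm, hm'⟩ := hrank χ₀
    refine ⟨a₁ * a₂, m, by rw [map_mul]; exact mul_ne_zero ha₁ ha₂, hm, fun χ hχ => ?_⟩
    rw [map_mul] at hχ
    obtain ⟨d, hd, hd'⟩ := hrank χ
    have h₁' := h₁ χ (left_ne_zero_of_mul hχ)
    have h₂' := h₂ χ (right_ne_zero_of_mul hχ)
    rw [hd]
    exact_mod_cast (by omega : d ≤ m)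
  | succ i ih =>
    obtain ⟨b, v, hv⟩ := C.exists_generators
    have := C.projective 0
    obtain ⟨a, m, ha, hm, hle⟩ := ih (C.shift v hv)
    have hrank (χ : R →+* k) : Module.rank k (cohomology χ (C.d (i + 1)) (C.d (i + 2))) =
        Module.rank k (cohomology χ ((C.shift v hv).d i) ((C.shift v hv).d (i + 1))) := by
      match i with
      | 0 => exact (cohomology_replacement_one χ (C.d 1) (C.d 2) v hv (C.d_d 1)).some.rank_eq
      | 1 =>
        exact (cohomology_replacement_two χ (C.d 1) (C.d 2) (C.d 3) v hv (C.d_d 1)).some.rank_eq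
      | i + 2 => rfl
    exact ⟨a, m, ha, (hrank χ₀).trans hm, fun χ hχ => (hrank χ).trans_le (hle χ hχ)⟩

end FiniteComplex

end Functional

end

/-! ### Semicontinuity of the twisted Betti numbers -/

noncomputable section

universe u

namespace TwistedChain

open Functional LiftedSimplex

section Comparison

variable {X : Type*} [TopologicalSpace X] {x₀ : X} {R : Type*} [CommRing R]
  (θ : FundamentalGroup X x₀ →* Rˣ) (χ : R →+* ℂ)

/-- The character obtained from a family of characters by specialization of the parameters. -/
def specialize : CharVar (FundamentalGroup X x₀) := (Units.map χ.toMonoidHom).comp θ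

theorem specialize_toHom (g : FundamentalGroup X x₀) :
    ((specialize θ χ).toHom g : ℂ) = χ (θ g : R) := rfl

/-- The twisted cochain given by a functional on the twisted chains. -/
def toCochain (n : ℕ) : Functional χ (TwistedChain R x₀ n) →ₗ[ℂ]
    TwistedCochain (specialize θ χ) n where
  toFun φ := ⟨fun s => φ (of θ s), fun g s => by
    change φ (of θ (deck g s)) = _
    rw [of_deck, map_smulₛₗ, specialize_toHom, smul_eq_mul]⟩
  map_add' _ _ := rfl
  map_smul' _ _ := rfl

theorem toCochain_injective (n : ℕ) : Function.Injective (toCochain θ χ n) := by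
  intro φ ψ h
  refine Functional.ext fun x => ?_
  induction x using Finsupp.induction_linear with
  | zero => rw [map_zero, map_zero]
  | add x y hx hy => rw [map_add, map_add, hx, hy]
  | single σ r =>
    have : φ (of θ σ.lifted) = ψ (of θ σ.lifted) := congrArg (fun c => c.1 σ.lifted) h
    rw [← mul_one r, ← smul_eq_mul, ← Finsupp.smul_single, ← of_lifted θ, map_smulₛₗ, map_smulₛₗ,
      this]

theorem toCochain_surjective (n : ℕ) : Function.Surjective (toCochain θ χ n) := by
  intro c
  let φ : TwistedChain R x₀ n →ₛₗ[χ] ℂ :=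
    { toFun := fun x => x.sum fun σ r => χ r * c.1 σ.lifted
      map_add' := fun x y => Finsupp.sum_add_index' (by simp) (by simp [add_mul])
      map_smul' := fun r x => by
        rw [Finsupp.sum_smul_index (by simp), smul_eq_mul, Finsupp.mul_sum]
        simp [mul_assoc] }
  refine ⟨φ, Subtype.ext (funext fun s => ?_)⟩
  change (of θ s).sum (fun σ r => χ r * c.1 σ.lifted) = c.1 s
  rw [of, Finsupp.sum_single_index (by simp)]
  conv_rhs => rw [deck_comparison s, c.2, specialize_toHom]

theorem toCochain_precomp_bd (n : ℕ) (φ : Functional χ (TwistedChain R x₀ n)) :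
    toCochain θ χ (n + 1) (precomp χ (bd θ n) φ) = twistedDiff _ n (toCochain θ χ n φ) := by
  refine Subtype.ext (funext fun s => ?_)
  change φ (bd θ n (of θ s)) = ∑ j : Fin (n + 2), (-1 : ℂ) ^ (j : ℕ) * φ (of θ (s.face j))
  rw [bd_of, map_sum]
  refine Finset.sum_congr rfl fun j _ => ?_
  rw [map_smulₛₗ, map_pow, map_neg, map_one, smul_eq_mul]

end Comparison

variable {X : Type u} [TopologicalSpace X] {x₀ : X} {R : Type u} [CommRing R]
  [IsNoetherianRing R] (θ : FundamentalGroup X x₀ →* Rˣ)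
  [T2Space X] [CWComplex (Set.univ : Set X)] [RelCWComplex.FiniteType (Set.univ : Set X)]

/-- The twisted chains of a CW complex of finite type, shifted by one and augmented by zero. -/
def chainComplex : FiniteComplex R where
  X
    | 0 => .of R PUnit.{u + 1}
    | n + 1 => .of R (TwistedChain R x₀ n)
  d
    | 0 => (0 : TwistedChain R x₀ 0 →ₗ[R] PUnit.{u + 1})
    | n + 1 => bd θ n
  d_d
    | 0 => fun _ => rfl
    | n + 1 => bd_bd θ
  free := inferInstanceAs (Module.Free R PUnit.{u + 1})
  finite := inferInstanceAs (Module.Finite R PUnit.{u + 1})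
  projective n := inferInstanceAs (Module.Projective R (TwistedChain R x₀ n))
  homology
    | 0 => by
      refine (smallMod_cycles θ 0).mono (fun x _ => ?_) LinearMap.map_le_range
      exact ⟨inside_univ (R := R) (x₀ := x₀) ▸ trivial, trivial⟩
    | n + 1 => by
      refine (smallMod_cycles θ (n + 1)).mono (fun x hx => ?_) LinearMap.map_le_range
      refine ⟨inside_univ (R := R) (x₀ := x₀) ▸ trivial, ?_⟩
      change bd θ n x ∈ inside R x₀ n ∅
      rw [show bd θ n x = 0 from hx]
      exact zero_mem _

theorem rank_twistedCohomology (χ : R →+* ℂ) (i : ℕ) :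
    Module.rank ℂ (TwistedCohomology (specialize θ χ) i) =
      Module.rank ℂ (cohomology χ ((chainComplex θ).d i) ((chainComplex θ).d (i + 1))) := by
  have hker (φ : Functional χ (TwistedChain R x₀ i)) :
      toCochain θ χ i φ ∈ LinearMap.ker (twistedDiff (specialize θ χ) i) ↔
        φ ∈ LinearMap.ker (precomp χ (bd θ i)) := by
    rw [LinearMap.mem_ker, LinearMap.mem_ker, ← toCochain_precomp_bd, ← map_zero (toCochain θ χ _)]
    exact (toCochain_injective θ χ (i + 1)).eq_iff
  suffices h : Nonempty (cohomology χ ((chainComplex θ).d i) (bd θ i) ≃ₗ[ℂ]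
      TwistedCohomology (specialize θ χ) i) from h.some.rank_eq.symm
  refine nonempty_subquotient_equiv (toCochain θ χ i) (fun φ => (hker φ).mpr) (fun φ _ => ?_) ?_
  · cases i with
    | zero =>
      constructor
      · intro h
        have h' : toCochain θ χ 0 φ = toCochain θ χ 0 0 := h.trans (map_zero _).symm
        rw [toCochain_injective θ χ 0 h']
        exact zero_mem _
      · rintro ⟨η, rfl⟩
        refine Subtype.ext (funext fun s => ?_)
        exact map_zero η
    | succ i =>
      constructor
      · rintro ⟨c, hc⟩
        obtain ⟨η, rfl⟩ := toCochain_surjective θ χ i c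
        rw [← toCochain_precomp_bd] at hc
        exact ⟨η, toCochain_injective θ χ _ hc⟩
      · rintro ⟨η, rfl⟩
        exact ⟨toCochain θ χ i η, (toCochain_precomp_bd θ χ i η).symm⟩
  · intro c hc
    obtain ⟨φ, rfl⟩ := toCochain_surjective θ χ i c
    exact Submodule.mem_sup_left ⟨φ, (hker φ).mp hc, rfl⟩

end TwistedChain

namespace CharVar

/-- The pullback of characters along a homomorphism of groups. -/
def comap {G H : Type*} [Group G] [Group H] (f : G →* H) : CharVar H →* CharVar G where
  toFun ρ := ρ.toHom.comp f
  map_one' := rfl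
  map_mul' _ _ := rfl

theorem isOpen_evalAt_ne_zero {G : Type*} [Group G] (a : MonoidAlgebra ℂ G) :
    IsOpen {ρ : CharVar G | ρ.evalAt a ≠ 0} := by
  refine ⟨{a}, ?_⟩
  ext ρ
  simp [zeroLocus]

theorem evalAt_of {G : Type*} [Group G] (ρ : CharVar G) (g : G) :
    ρ.evalAt (MonoidAlgebra.of ℂ G g) = ρ.toHom g := by
  simp [evalAt]

/-- The dimension of the cohomology of a CW complex of finite type with coefficients in the
characters of a finitely generated abelian quotient of the fundamental group is finite and upper
semicontinuous. -/
theorem exists_isOpen_rank_le {X : Type u} [TopologicalSpace X] (x₀ : X)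
    [T2Space X] [CWComplex (Set.univ : Set X)] [RelCWComplex.FiniteType (Set.univ : Set X)]
    {Q : Type u} [CommGroup Q] [Group.FG Q] (q : FundamentalGroup X x₀ →* Q) (i : ℕ)
    (ψ₀ : CharVar Q) :
    ∃ (O : Set (CharVar Q)) (m : ℕ), IsOpen O ∧ ψ₀ ∈ O ∧
      Module.rank ℂ (TwistedCohomology (comap q ψ₀) i) = m ∧
      ∀ ψ ∈ O, Module.rank ℂ (TwistedCohomology (comap q ψ) i) ≤ m := by
  have : IsNoetherianRing (MonoidAlgebra ℂ Q) := by
    have : Monoid.FG Q := (Group.fg_iff_monoid_fg).mp inferInstance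
    exact Algebra.FiniteType.isNoetherianRing ℂ _
  let θ : FundamentalGroup X x₀ →* (MonoidAlgebra ℂ Q)ˣ :=
    ((MonoidAlgebra.of ℂ Q).toHomUnits).comp q
  have key (ψ : CharVar Q) : TwistedChain.specialize θ (ψ.evalAt : MonoidAlgebra ℂ Q →+* ℂ) =
      comap q ψ := by
    refine MonoidHom.ext fun g => Units.ext ?_
    exact evalAt_of ψ (q g)
  obtain ⟨a, m, ha, hm, hle⟩ := Functional.FiniteComplex.exists_rank_le
    (ψ₀.evalAt : MonoidAlgebra ℂ Q →+* ℂ) i (TwistedChain.chainComplex θ)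
  refine ⟨_, m, isOpen_evalAt_ne_zero a, ha, ?_, fun ψ hψ => ?_⟩
  · rw [← key, TwistedChain.rank_twistedCohomology, hm]
  · rw [← key, TwistedChain.rank_twistedCohomology]
    exact hle _ hψ

end CharVar

end

/-! ### The cohomology of finite abelian coverings -/

noncomputable section

theorem Path.Homotopic.Quotient.map_trans_eq {X Y : Type*} [TopologicalSpace X]
    [TopologicalSpace Y] {x y z : X} (γ : Path.Homotopic.Quotient x y)
    (δ : Path.Homotopic.Quotient y z) (f : C(X, Y)) :
    (γ.trans δ).map f = (γ.map f).trans (δ.map f) := by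
  induction γ, δ using Path.Homotopic.Quotient.ind₂ with
  | _ γ δ => exact congrArg Path.Homotopic.Quotient.mk (Path.map_trans γ δ f.continuous)

theorem Path.Homotopic.Quotient.map_cast_heq {X Y : Type*} [TopologicalSpace X]
    [TopologicalSpace Y] {x y x' y' : X} (γ : Path.Homotopic.Quotient x y) (f : C(X, Y))
    (hx : x' = x) (hy : y' = y) : (γ.cast hx hy).map f ≍ γ.map f := by
  subst hx hy
  rw [Path.Homotopic.Quotient.cast_rfl_rfl]

namespace LiftedSimplex

variable {U V : Type*} [TopologicalSpace U] [TopologicalSpace V] (f : C(V, U)) {v₀ : V} {n : ℕ}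

/-- The image of a lifted simplex under a continuous map. -/
def pushforward (s : LiftedSimplex v₀ n) : LiftedSimplex (f v₀) n where
  simplex := f.comp s.simplex
  lift p := (s.lift p).map f
  lift_trans p q δ := by
    rw [s.lift_trans p q δ, Path.Homotopic.Quotient.map_trans_eq]
    rfl

theorem pushforward_deck (g : FundamentalGroup V v₀) (s : LiftedSimplex v₀ n) :
    pushforward f (deck g s) =
      deck (FundamentalGroup.mapOfEq f (rfl : f v₀ = f v₀) g) (pushforward f s) := by
  rw [FundamentalGroup.mapOfEq_apply, Path.Homotopic.Quotient.cast_rfl_rfl]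
  refine ext_of_heq rfl (vertices n 0) (heq_of_eq ?_)
  exact Path.Homotopic.Quotient.map_trans_eq g.toPath (s.lift (vertices n 0)) f

variable {f} (hf : IsCoveringMap f)

include hf in
theorem pushforward_injective : Function.Injective (pushforward f : LiftedSimplex v₀ n → _) := by
  have key (s : LiftedSimplex v₀ n) (p : Simp n) :
      (hf.monodromy ((pushforward f s).lift p) ⟨v₀, rfl⟩).1 = s.simplex p :=
    congrArg Subtype.val (hf.monodromy_map (s.lift p))
  intro s s' h
  have hs : s.simplex = s'.simplex := by
    ext p
    rw [← key, ← key, h]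
  obtain ⟨c, l, hl⟩ := s
  obtain ⟨c', l', hl'⟩ := s'
  obtain rfl : c = c' := hs
  simp only [pushforward, LiftedSimplex.mk.injEq, heq_eq_eq, true_and] at h ⊢
  funext p
  exact hf.injective_path_homotopic_map _ _ (congrFun h p)

include hf in
/-- A covering map induces a bijection on lifted simplices, as both spaces have the same universal
cover. -/
theorem pushforward_surjective : Function.Surjective (pushforward f : LiftedSimplex v₀ n → _) := by
  intro t
  let p := vertices n 0
  obtain ⟨c, ⟨hc, hfc⟩, -⟩ := hf.existsUnique_continuousMap_lifts t.simplex p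
    (hf.monodromy (t.lift p) ⟨v₀, rfl⟩).1 (hf.monodromy (t.lift p) ⟨v₀, rfl⟩).2
  let s := LiftedMap.ofPoint c p ((hf.liftPathQuotient (t.lift p) ⟨v₀, rfl⟩).cast rfl hc)
  refine ⟨s.simplex (ContinuousMap.id _), ext_of_heq ?_ p ?_⟩
  · exact DFunLike.coe_injective hfc
  · change (s.lift p).map f ≍ _
    rw [LiftedMap.ofPoint_lift]
    refine (Path.Homotopic.Quotient.map_cast_heq _ _ _ _).trans ?_
    refine (heq_of_eq (hf.map_liftPathQuotient (t.lift p) ⟨v₀, rfl⟩)).trans ?_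
    exact Path.Homotopic.Quotient.cast_heq _ _

end LiftedSimplex

open LiftedSimplex

/-- Subquotients of finite products. -/
theorem nonempty_pi_subquotient_equiv {k ι : Type*} [Field k] {M : ι → Type*}
    [∀ i, AddCommGroup (M i)] [∀ i, Module k (M i)] (Z B : ∀ i, Submodule k (M i)) :
    Nonempty (((Submodule.pi Set.univ Z) ⧸
      (Submodule.pi Set.univ B).submoduleOf (Submodule.pi Set.univ Z)) ≃ₗ[k]
        ∀ i, (Z i ⧸ (B i).submoduleOf (Z i))) := by
  let G : Submodule.pi Set.univ Z →ₗ[k] ∀ i, (Z i ⧸ (B i).submoduleOf (Z i)) :=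
    LinearMap.pi fun i => ((B i).submoduleOf (Z i)).mkQ ∘ₗ
      LinearMap.restrict (LinearMap.proj i) fun z hz => hz i trivial
  have hker : LinearMap.ker G =
      (Submodule.pi Set.univ B).submoduleOf (Submodule.pi Set.univ Z) := by
    ext z
    rw [LinearMap.mem_ker, funext_iff]
    refine forall_congr' fun i => ?_
    change ((B i).submoduleOf (Z i)).mkQ _ = 0 ↔ _
    rw [Submodule.mkQ_apply, Submodule.Quotient.mk_eq_zero]
    exact ⟨fun h _ => h, fun h => h trivial⟩
  have hG : Function.Surjective G := by
    intro q
    choose z hz using fun i => Submodule.mkQ_surjective _ (q i)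
    exact ⟨⟨fun i => (z i).1, fun i _ => (z i).2⟩, funext hz⟩
  exact ⟨(Submodule.quotEquivOfEq _ _ hker.symm).trans (G.quotKerEquivOfSurjective hG)⟩

section Covering

variable {U V : Type*} [TopologicalSpace U] [TopologicalSpace V] (f : C(V, U)) {v₀ : V}

/-- The restriction of a character of `π₁(U)` to `π₁(V)`. -/
abbrev restrictChar (f : C(V, U)) (v₀ : V) :
    CharVar (FundamentalGroup U (f v₀)) →* CharVar (FundamentalGroup V v₀) :=
  CharVar.comap (FundamentalGroup.mapOfEq f (rfl : f v₀ = f v₀))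

/-- The pullback of twisted cochains along a continuous map, for a character that restricts to the
given one. -/
def pullbackCochain {ρ : CharVar (FundamentalGroup U (f v₀))}
    {ρ' : CharVar (FundamentalGroup V v₀)} (h : restrictChar f v₀ ρ = ρ') (n : ℕ) :
    TwistedCochain ρ n →ₗ[ℂ] TwistedCochain ρ' n where
  toFun c := ⟨fun s => c.1 (pushforward f s), fun g s => by
    change c.1 (pushforward f (deck g s)) = _
    rw [pushforward_deck, c.2, ← h]
    rfl⟩
  map_add' _ _ := rfl
  map_smul' _ _ := rfl

variable {f} (hf : IsCoveringMap f) {τ : CharVar (FundamentalGroup U (f v₀))}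
  (hV : (FundamentalGroup.mapOfEq f (rfl : f v₀ = f v₀)).range = τ.toHom.ker)
  (ρ : CharVar (FundamentalGroup U (f v₀)))

include hV in
theorem restrictChar_mul_pow (j : ℕ) : restrictChar f v₀ (ρ * τ ^ j) = restrictChar f v₀ ρ := by
  have : restrictChar f v₀ τ = 1 := by
    refine MonoidHom.ext fun g => ?_
    have : FundamentalGroup.mapOfEq f (rfl : f v₀ = f v₀) g ∈ τ.toHom.ker := hV ▸ ⟨g, rfl⟩
    exact this
  rw [map_mul, map_pow, this, one_pow, mul_one]

include hV in
/-- The sum of the pullbacks of cochains twisted by `ρ`, `ρ τ`, `ρ τ²`, … -/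
def sumPullback (n : ℕ) : (∀ j : Fin (orderOf τ), TwistedCochain (ρ * τ ^ (j : ℕ)) n) →ₗ[ℂ]
    TwistedCochain (restrictChar f v₀ ρ) n :=
  ∑ j : Fin (orderOf τ), pullbackCochain f (restrictChar_mul_pow hV ρ j) n ∘ₗ LinearMap.proj j

theorem sumPullback_apply (n : ℕ)
    (c : ∀ j : Fin (orderOf τ), TwistedCochain (ρ * τ ^ (j : ℕ)) n) (s : LiftedSimplex v₀ n) :
    (sumPullback hV ρ n c).1 s = ∑ j, (c j).1 (pushforward f s) := by
  have : ∀ S : Finset (Fin (orderOf τ)),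
      ((∑ j ∈ S, pullbackCochain f (restrictChar_mul_pow hV ρ j) n ∘ₗ LinearMap.proj j) c).1 s =
        ∑ j ∈ S, (c j).1 (pushforward f s) := by
    classical
    intro S
    induction S using Finset.induction_on with
    | empty => rfl
    | insert a S ha ih =>
      rw [Finset.sum_insert ha, Finset.sum_insert ha, ← ih]
      rfl
  exact this Finset.univ

theorem sumPullback_twistedDiff (n : ℕ)
    (c : ∀ j : Fin (orderOf τ), TwistedCochain (ρ * τ ^ (j : ℕ)) n) :
    sumPullback hV ρ (n + 1) (fun j => twistedDiff _ n (c j)) =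
      twistedDiff _ n (sumPullback hV ρ n c) := by
  rw [sumPullback, sumPullback, LinearMap.sum_apply, LinearMap.sum_apply, map_sum]
  rfl

include hf in
/-- Distinct characters are linearly independent. -/
theorem sumPullback_injective (n : ℕ) : Function.Injective (sumPullback hV ρ n) := by
  rw [injective_iff_map_eq_zero]
  intro c hc
  funext j
  refine Subtype.ext (funext fun t => ?_)
  have hinj : Function.Injective fun j : Fin (orderOf τ) =>
      (Units.coeHom ℂ).comp (τ ^ (j : ℕ)).toHom := by
    intro j j' h
    refine Fin.ext (pow_injOn_Iio_orderOf j.2 j'.2 ?_)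
    refine MonoidHom.ext fun g => Units.ext ?_
    exact DFunLike.congr_fun h g
  have hli := (linearIndependent_monoidHom (FundamentalGroup U (f v₀)) ℂ).comp _ hinj
  rw [Fintype.linearIndependent_iff] at hli
  refine hli (fun j => (c j).1 t) (funext fun g => ?_) j
  obtain ⟨s, hs⟩ := pushforward_surjective hf (deck g t)
  have h : ∑ j, (c j).1 (deck g t) = 0 := by
    rw [← hs, ← sumPullback_apply hV ρ n c s, hc]
    rfl
  have h2 : (ρ.toHom g : ℂ) * ∑ j : Fin (orderOf τ), (c j).1 t * ((τ ^ (j : ℕ)).toHom g : ℂ) =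
      0 := by
    rw [← h, Finset.mul_sum]
    refine Finset.sum_congr rfl fun j _ => ?_
    rw [(c j).2 g t, mul_comm ((c j).1 t), ← mul_assoc]
    rfl
  have h3 := (mul_eq_zero.mp h2).resolve_left (Units.ne_zero _)
  rw [Finset.sum_apply]
  exact h3

theorem finite_quotient_ker {G : Type*} [Group G] {τ : CharVar G} (hτ : IsOfFinOrder τ) :
    Finite (G ⧸ τ.toHom.ker) := by
  have : NeZero (orderOf τ) := ⟨hτ.orderOf_pos.ne'⟩
  have h (g : G) : τ.toHom g ∈ rootsOfUnity (orderOf τ) ℂ := by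
    rw [mem_rootsOfUnity]
    exact congrArg (fun χ : CharVar G => χ.toHom g) (pow_orderOf_eq_one τ)
  let φ : G →* rootsOfUnity (orderOf τ) ℂ := τ.toHom.codRestrict _ h
  have hφ : φ.ker = τ.toHom.ker := MonoidHom.ker_codRestrict _ _ _
  rw [← hφ]
  exact Finite.of_injective _ (QuotientGroup.kerLift_injective φ)

include hf in
/-- Cochains on the covering are averaged over the deck transformations to obtain their components
that transform by characters. -/
theorem sumPullback_surjective (hτ : IsOfFinOrder τ) (n : ℕ) :
    Function.Surjective (sumPullback hV ρ n) := by
  intro c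
  have := finite_quotient_ker hτ
  have := Fintype.ofFinite (FundamentalGroup U (f v₀) ⧸ τ.toHom.ker)
  let e := Equiv.ofBijective _ ⟨pushforward_injective (v₀ := v₀) (n := n) hf,
    pushforward_surjective hf⟩
  let c' : LiftedSimplex (f v₀) n → ℂ := fun t => c.1 (e.symm t)
  have hc' (k : FundamentalGroup U (f v₀)) (hk : k ∈ τ.toHom.ker) (t : LiftedSimplex (f v₀) n) :
      c' (deck k t) = ρ.toHom k * c' t := by
    rw [← hV] at hk
    obtain ⟨g, rfl⟩ := hk
    obtain ⟨s, rfl⟩ := e.surjective t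
    have : deck (FundamentalGroup.mapOfEq f rfl g) (e s) = e (deck g s) :=
      (pushforward_deck f g s).symm
    rw [this]
    simp only [c', e.symm_apply_apply]
    exact c.2 g s
  let h (j : ℕ) (t : LiftedSimplex (f v₀) n) (g : FundamentalGroup U (f v₀)) : ℂ :=
    ((ρ * τ ^ j).toHom g : ℂ)⁻¹ * c' (deck g t)
  have hh (j : ℕ) (t : LiftedSimplex (f v₀) n) (g : FundamentalGroup U (f v₀)) :
      h j t ((g : FundamentalGroup U (f v₀) ⧸ τ.toHom.ker).out) = h j t g := by
    obtain ⟨⟨k, hk⟩, hgk⟩ := QuotientGroup.mk_out_eq_mul τ.toHom.ker g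
    have hk1 : (ρ * τ ^ j).toHom k = ρ.toHom k := by
      change ρ.toHom k * τ.toHom k ^ j = _
      rw [MonoidHom.mem_ker.mp hk, one_pow, mul_one]
    simp only [h, hgk]
    rw [← deck_deck, hc' k hk, map_mul, hk1, Units.val_mul, mul_inv]
    field_simp
  have hdeck (j : ℕ) (t : LiftedSimplex (f v₀) n) (a g : FundamentalGroup U (f v₀)) :
      h j (deck a t) g = ((ρ * τ ^ j).toHom a : ℂ) * h j t (a * g) := by
    simp only [h]
    rw [deck_deck, map_mul, Units.val_mul, mul_inv]
    field_simp
  let p (j : ℕ) (t : LiftedSimplex (f v₀) n) : ℂ :=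
    (orderOf τ : ℂ)⁻¹ * ∑ x : FundamentalGroup U (f v₀) ⧸ τ.toHom.ker, h j t x.out
  have hp (j : ℕ) (a : FundamentalGroup U (f v₀)) (t : LiftedSimplex (f v₀) n) :
      p j (deck a t) = ((ρ * τ ^ j).toHom a : ℂ) * p j t := by
    simp only [p]
    rw [mul_left_comm]
    congr 1
    rw [Finset.mul_sum]
    refine Fintype.sum_equiv (MulAction.toPerm a) _ _ fun x => ?_
    rw [hdeck]
    congr 1
    have hx : MulAction.toPerm a x =
        ((a * x.out : FundamentalGroup U (f v₀)) : FundamentalGroup U (f v₀) ⧸ τ.toHom.ker) := by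
      conv_lhs => rw [← QuotientGroup.out_eq' x]
      rfl
    rw [hx, hh]
  refine ⟨fun j => ⟨p j, hp j⟩, Subtype.ext (funext fun s => ?_)⟩
  refine (sumPullback_apply hV ρ n (fun j => ⟨p j, hp j⟩) s).trans ?_
  change ∑ j : Fin (orderOf τ), p j (e s) = c.1 s
  have hn : (orderOf τ : ℂ) ≠ 0 := Nat.cast_ne_zero.mpr hτ.orderOf_pos.ne'
  simp only [p]
  rw [← Finset.mul_sum, Finset.sum_comm, inv_mul_eq_iff_eq_mul₀ hn,
    Finset.sum_eq_single ((1 : FundamentalGroup U (f v₀)) :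
      FundamentalGroup U (f v₀) ⧸ τ.toHom.ker)]
  · have h1 (j : ℕ) : h j (e s) 1 = c.1 s := by
      simp only [h, c']
      rw [deck_one, map_one, e.symm_apply_apply]
      simp
    simp only [hh, h1, Finset.sum_const, Finset.card_univ, Fintype.card_fin, nsmul_eq_mul]
  · intro x _ hx
    set g := x.out with hg
    have hτg : (τ.toHom g : ℂ) ≠ 1 := by
      intro h
      refine hx ?_
      rw [← QuotientGroup.out_eq' x, QuotientGroup.eq]
      rw [mul_one, inv_mem_iff]
      exact Units.ext h
    have hpow : (τ.toHom g : ℂ) ^ orderOf τ = 1 := by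
      have : τ.toHom g ^ orderOf τ = 1 :=
        congrArg (fun χ : CharVar _ => χ.toHom g) (pow_orderOf_eq_one τ)
      rw [← Units.val_pow_eq_pow_val, this, Units.val_one]
    have hterm (j : ℕ) : h j (e s) g =
        (((ρ.toHom g : ℂ))⁻¹ * c' (deck g (e s))) * ((τ.toHom g : ℂ)⁻¹) ^ j := by
      have : ((ρ * τ ^ j).toHom g : ℂ) = ρ.toHom g * (τ.toHom g : ℂ) ^ j := by
        rw [← Units.val_pow_eq_pow_val, ← Units.val_mul]
        rfl
      simp only [h, this]
      rw [mul_inv, inv_pow]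
      ring
    simp only [hterm]
    rw [← Finset.mul_sum, Fin.sum_univ_eq_sum_range (fun j => ((τ.toHom g : ℂ)⁻¹) ^ j)]
    have hgeom := mul_geom_sum ((τ.toHom g : ℂ)⁻¹) (orderOf τ)
    rw [inv_pow, hpow, inv_one, sub_self] at hgeom
    rw [(mul_eq_zero.mp hgeom).resolve_left (sub_ne_zero.mpr (by
      rw [Ne, inv_eq_one]
      exact hτg)), mul_zero]
  · intro h
    exact absurd (Finset.mem_univ _) h

end Covering

section CoveringRank

universe u v

variable {U : Type u} {V : Type v} [TopologicalSpace U] [TopologicalSpace V] {f : C(V, U)} {v₀ : V}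
  (hf : IsCoveringMap f) {τ : CharVar (FundamentalGroup U (f v₀))}
  (hV : (FundamentalGroup.mapOfEq f (rfl : f v₀ = f v₀)).range = τ.toHom.ker)
  (ρ : CharVar (FundamentalGroup U (f v₀)))

include hf hV in
/-- The cohomology of the covering associated with a torsion character `τ` is the direct sum of the
cohomology groups of the base twisted by the powers of `τ`. -/
theorem lift_rank_twistedCohomology_restrictChar (hτ : IsOfFinOrder τ) (i : ℕ) :
    Cardinal.lift.{u} (Module.rank ℂ (TwistedCohomology (restrictChar f v₀ ρ) i)) =
      Cardinal.lift.{v} (Cardinal.sum fun j : Fin (orderOf τ) =>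
        Module.rank ℂ (TwistedCohomology (ρ * τ ^ (j : ℕ)) i)) := by
  have hinj := sumPullback_injective hf hV ρ
  have hsurj := sumPullback_surjective hf hV ρ hτ
  obtain ⟨e₁⟩ := nonempty_pi_subquotient_equiv
    (fun j : Fin (orderOf τ) => LinearMap.ker (twistedDiff (ρ * τ ^ (j : ℕ)) i))
    (fun j : Fin (orderOf τ) => twistedCoboundary (ρ * τ ^ (j : ℕ)) i)
  have hker (c : ∀ j : Fin (orderOf τ), TwistedCochain (ρ * τ ^ (j : ℕ)) i) :
      sumPullback hV ρ i c ∈ LinearMap.ker (twistedDiff (restrictChar f v₀ ρ) i) ↔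
        ∀ j : Fin (orderOf τ), c j ∈ LinearMap.ker (twistedDiff (ρ * τ ^ (j : ℕ)) i) := by
    rw [LinearMap.mem_ker, ← sumPullback_twistedDiff, ← map_zero (sumPullback hV ρ (i + 1)),
      (hinj (i + 1)).eq_iff, funext_iff]
    rfl
  obtain ⟨e₂⟩ : Nonempty (_ ≃ₗ[ℂ] TwistedCohomology (restrictChar f v₀ ρ) i) := by
    refine nonempty_subquotient_equiv
      (Z := Submodule.pi Set.univ fun j : Fin (orderOf τ) =>
        LinearMap.ker (twistedDiff (ρ * τ ^ (j : ℕ)) i))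
      (B := Submodule.pi Set.univ fun j : Fin (orderOf τ) =>
        twistedCoboundary (ρ * τ ^ (j : ℕ)) i) (sumPullback hV ρ i) ?_ ?_ ?_
    · intro c hc
      exact (hker c).mpr fun j => hc j trivial
    · intro c _
      cases i with
      | zero =>
        constructor
        · intro h j _
          have h' : sumPullback hV ρ 0 c = sumPullback hV ρ 0 0 := h.trans (map_zero _).symm
          rw [hinj 0 h']
          exact zero_mem _
        · intro h
          have : c = 0 := funext fun j => h j trivial
          rw [this, map_zero]
          exact zero_mem _
      | succ i =>
        constructor
        · rintro ⟨b, hb⟩ j -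
          obtain ⟨b, rfl⟩ := hsurj i b
          rw [← sumPullback_twistedDiff] at hb
          exact ⟨b j, congrFun (hinj _ hb) j⟩
        · intro h
          choose b hb using fun j => h j trivial
          refine ⟨sumPullback hV ρ i b, ?_⟩
          rw [← sumPullback_twistedDiff]
          exact congrArg _ (funext hb)
    · intro c hc
      obtain ⟨c, rfl⟩ := hsurj i c
      exact Submodule.mem_sup_left ⟨c, fun j _ => (hker c).mp hc j, rfl⟩
  rw [← e₂.lift_rank_eq, e₁.rank_eq, rank_pi]

theorem Cardinal.sum_natCast {n : ℕ} (m : Fin n → ℕ) :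
    (Cardinal.sum fun j => (m j : Cardinal.{u})) = (∑ j, m j : ℕ) := by
  have h : (Cardinal.sum fun j => (m j : Cardinal.{u})) =
      Cardinal.mk (Σ j, ULift.{u} (Fin (m j))) := by
    rw [Cardinal.mk_sigma]
    simp
  rw [h, Cardinal.mk_fintype]
  simp

include hf hV in
theorem rank_twistedCohomology_restrictChar_eq (hτ : IsOfFinOrder τ) {i : ℕ}
    {m : Fin (orderOf τ) → ℕ}
    (hm : ∀ j : Fin (orderOf τ),
      Module.rank ℂ (TwistedCohomology (ρ * τ ^ (j : ℕ)) i) = m j) :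
    Module.rank ℂ (TwistedCohomology (restrictChar f v₀ ρ) i) = (∑ j, m j : ℕ) := by
  have h := lift_rank_twistedCohomology_restrictChar hf hV ρ hτ i
  simp only [hm] at h
  rw [Cardinal.sum_natCast, Cardinal.lift_natCast] at h
  exact Cardinal.lift_eq_nat_iff.mp h

include hf hV in
theorem le_rank_twistedCohomology_restrictChar (hτ : IsOfFinOrder τ) {i : ℕ}
    {m : Fin (orderOf τ) → ℕ}
    (hm : ∀ j : Fin (orderOf τ),
      m j ≤ Module.rank ℂ (TwistedCohomology (ρ * τ ^ (j : ℕ)) i)) :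
    (∑ j, m j : ℕ) ≤ Module.rank ℂ (TwistedCohomology (restrictChar f v₀ ρ) i) := by
  have h := lift_rank_twistedCohomology_restrictChar hf hV ρ hτ i
  have h' := Cardinal.lift_le.{v}.mpr (Cardinal.sum_le_sum _ _ hm)
  rw [← h, Cardinal.sum_natCast, Cardinal.lift_natCast] at h'
  exact Cardinal.nat_le_lift_iff.mp h'

end CoveringRank

end

/-! ### Subtori of character varieties -/

noncomputable section

namespace CharVar

variable {G H : Type*} [Group G] [Group H]

/-- The homomorphism of group algebras given by `g ↦ c(g) f(g)`. -/
def twist (c : CharVar G) (f : G →* H) : MonoidAlgebra ℂ G →ₐ[ℂ] MonoidAlgebra ℂ H :=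
  MonoidAlgebra.lift ℂ (MonoidAlgebra ℂ H) G
    { toFun := fun g => (c.toHom g : ℂ) • MonoidAlgebra.of ℂ H (f g)
      map_one' := by
        rw [map_one f, map_one c.toHom, map_one (MonoidAlgebra.of ℂ H), Units.val_one, one_smul]
      map_mul' := fun g h => by
        rw [map_mul f, map_mul c.toHom, map_mul (MonoidAlgebra.of ℂ H), Units.val_mul,
          smul_mul_smul_comm] }

theorem evalAt_twist (c : CharVar G) (f : G →* H) (ρ : CharVar H) (a : MonoidAlgebra ℂ G) :
    ρ.evalAt (twist c f a) = (c * comap f ρ).evalAt a := by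
  suffices h : ρ.evalAt.comp (twist c f) = (c * comap f ρ).evalAt from DFunLike.congr_fun h a
  refine MonoidAlgebra.algHom_ext (fun g => ?_) (Subsingleton.elim _ _)
  have h1 : twist c f (MonoidAlgebra.single g (1 : ℂ)) =
      (c.toHom g : ℂ) • MonoidAlgebra.of ℂ H (f g) := by
    rw [twist, MonoidAlgebra.lift_single, one_smul]
    rfl
  rw [AlgHom.comp_apply, h1, map_smul, evalAt_of, ← MonoidAlgebra.of_apply, evalAt_of]
  rfl

theorem exists_evalAt_ne_zero {O : Set (CharVar G)} (hO : IsOpen O) {ρ : CharVar G} (hρ : ρ ∈ O) :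
    ∃ a : MonoidAlgebra ℂ G, ρ.evalAt a ≠ 0 ∧ ∀ ρ' : CharVar G, ρ'.evalAt a ≠ 0 → ρ' ∈ O := by
  obtain ⟨S, hS⟩ := hO
  have hρ' : ρ ∉ zeroLocus S := by
    rw [← hS]
    exact fun h => h hρ
  simp only [zeroLocus, Set.mem_ofPred_eq, not_forall] at hρ'
  obtain ⟨a, ha, ha'⟩ := hρ'
  refine ⟨a, ha', fun ρ' h => ?_⟩
  by_contra hcon
  have : ρ' ∈ zeroLocus S := by
    rw [← hS]
    exact hcon
  exact h (this a ha)

theorem continuous_mul_comap (c : CharVar G) (f : G →* H) :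
    Continuous fun ρ : CharVar H => c * comap f ρ := by
  refine ⟨fun O hO => isOpen_iff_forall_mem_open.mpr fun ρ hρ => ?_⟩
  obtain ⟨a, ha, ha'⟩ := exists_evalAt_ne_zero hO hρ
  rw [← evalAt_twist] at ha
  refine ⟨_, fun ρ' h => ha' _ ?_, isOpen_evalAt_ne_zero (twist c f a), ha⟩
  rw [← evalAt_twist]
  exact h

theorem continuous_comap (f : G →* H) : Continuous (comap f) := by
  simpa using continuous_mul_comap 1 f

theorem continuous_mul_const (c : CharVar G) : Continuous fun ρ : CharVar G => ρ * c := by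
  have h := continuous_mul_comap c (MonoidHom.id G)
  convert h using 2 with ρ
  exact mul_comm ρ c

/-- On an irreducible set of characters, the value at an element is constant if it is a root of
unity of bounded order. -/
theorem eq_of_isIrreducible {T : Set (CharVar G)} (hT : IsIrreducible T) {g : G} {e : ℕ}
    (he : 0 < e) (h : ∀ ρ ∈ T, ρ.toHom g ^ e = 1) {ρ ρ' : CharVar G} (hρ : ρ ∈ T) (hρ' : ρ' ∈ T) :
    ρ.toHom g = ρ'.toHom g := by
  classical
  let Z (z : ℂ) : Set (CharVar G) := {ρ | (ρ.toHom g : ℂ) = z}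
  have hZ (z : ℂ) : IsClosed (Z z) := by
    have := (isOpen_evalAt_ne_zero (MonoidAlgebra.of ℂ G g - algebraMap ℂ _ z)).isClosed_compl
    convert this using 1
    ext ρ
    rw [Set.mem_compl_iff, Set.mem_ofPred_eq, Set.mem_ofPred_eq, not_not, map_sub, evalAt_of,
      AlgHom.commutes, sub_eq_zero]
    rfl
  obtain ⟨_, hz, hTz⟩ := isIrreducible_iff_sUnion_isClosed.mp hT
    ((Polynomial.nthRootsFinset e (1 : ℂ)).image Z)
    (by
      intro W hW
      obtain ⟨z, -, rfl⟩ := Finset.mem_image.mp hW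
      exact hZ z)
    (by
      intro χ hχ
      refine ⟨Z (χ.toHom g), ?_, rfl⟩
      rw [Finset.mem_coe, Finset.mem_image]
      refine ⟨_, ?_, rfl⟩
      rw [Polynomial.mem_nthRootsFinset he, ← Units.val_pow_eq_pow_val, h χ hχ, Units.val_one])
  obtain ⟨z, -, rfl⟩ := Finset.mem_image.mp hz
  have h1 : (ρ.toHom g : ℂ) = z := hTz hρ
  have h2 : (ρ'.toHom g : ℂ) = z := hTz hρ'
  exact Units.ext (h1.trans h2.symm)

section Torus

variable {d : ℕ} (m : G →* Multiplicative (Fin d → ℤ))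

/-- The homomorphism from a torus to the character variety dual to a homomorphism `m : G → ℤ^d`. -/
def torusMap : (Fin d → ℂˣ) →* CharVar G where
  toFun t :=
    ({ toFun := fun g => ∏ j, t j ^ (m g).toAdd j
       map_one' := by simp
       map_mul' := fun g h => by simp [zpow_add, Finset.prod_mul_distrib] } : G →* ℂˣ)
  map_one' := MonoidHom.ext fun g => by
    change ∏ j, (1 : ℂˣ) ^ (m g).toAdd j = 1
    simp
  map_mul' s t := MonoidHom.ext fun g => by
    change ∏ j, (s j * t j) ^ (m g).toAdd j =
      (∏ j, s j ^ (m g).toAdd j) * ∏ j, t j ^ (m g).toAdd j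
    simp [mul_zpow, Finset.prod_mul_distrib]

theorem torusMap_toHom (t : Fin d → ℂˣ) (g : G) :
    (torusMap m t).toHom g = ∏ j, t j ^ (m g).toAdd j := rfl

theorem prod_mulSingle_zpow (j : Fin d) (u : ℂˣ) (a : Fin d → ℤ) :
    ∏ l, (Pi.mulSingle j u : Fin d → ℂˣ) l ^ a l = u ^ a j := by
  rw [Finset.prod_eq_single j]
  · simp
  · intro l _ hl
    simp [hl]
  · simp

/-- Laurent monomials with the same values are equal. -/
theorem eq_of_prod_zpow_eq {a b : Fin d → ℤ}
    (h : ∀ t : Fin d → ℂˣ, ∏ j, t j ^ a j = ∏ j, t j ^ b j) : a = b := by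
  funext j
  have := h (Pi.mulSingle j (Units.mk0 2 two_ne_zero))
  rw [prod_mulSingle_zpow, prod_mulSingle_zpow] at this
  have h2 : (2 : ℝ) ^ a j = 2 ^ b j := by
    have := congrArg (fun u : ℂˣ => ‖(u : ℂ)‖) this
    simpa using this
  exact zpow_right_injective₀ two_pos (by norm_num) h2

variable {m} in
theorem torusMap_injective (hm : Function.Surjective m) : Function.Injective (torusMap m) := by
  intro s t h
  funext j
  obtain ⟨g, hg⟩ := hm (Multiplicative.ofAdd (Pi.single j 1))
  have := congrArg (fun χ : CharVar G => χ.toHom g) h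
  simp only [torusMap_toHom, hg, toAdd_ofAdd] at this
  simpa [Pi.single_apply] using this

variable {m} in
theorem isSubtorus_range_torusMap (hm : Function.Surjective m) :
    IsSubtorus (Set.range (torusMap m)) :=
  ⟨d, torusMap m, fun g => ⟨(m g).toAdd, fun _ => rfl⟩, torusMap_injective hm, rfl⟩

theorem divisible_units_complex : Module.Baer ℤ (Additive ℂˣ) := by
  have : DivisibleBy (Additive ℂˣ) ℕ := divisibleByOfSMulRightSurj _ _ fun {n} hn u => by
    obtain ⟨z, hz⟩ := IsAlgClosed.exists_pow_nat_eq (u.toMul : ℂ) (Nat.pos_of_ne_zero hn)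
    have hz0 : z ≠ 0 := by
      rintro rfl
      rw [zero_pow hn] at hz
      exact Units.ne_zero _ hz.symm
    exact ⟨Additive.ofMul (Units.mk0 z hz0), congrArg Additive.ofMul (Units.ext hz)⟩
  have : DivisibleBy (Additive ℂˣ) ℤ := AddGroup.divisibleByIntOfDivisibleByNat _
  exact Module.Baer.of_divisible _

/-- As `ℂ*` is divisible, the characters of the image of `m` extend to `ℤ^d`. -/
theorem mem_range_torusMap {χ : CharVar G} :
    χ ∈ Set.range (torusMap m) ↔ ∀ g, m g = 1 → χ.toHom g = 1 := by
  constructor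
  · rintro ⟨t, rfl⟩ g hg
    rw [torusMap_toHom, hg]
    simp
  · intro h
    let χ' : m.range →* ℂˣ := MonoidHom.liftOfSurjective m.rangeRestrict m.rangeRestrict_surjective
      ⟨χ.toHom, fun g hg => h g (congrArg Subtype.val hg)⟩
    have hχ' (g : G) : χ' (m.rangeRestrict g) = χ.toHom g :=
      MonoidHom.liftOfRightInverse_comp_apply _ _ _ _ _
    obtain ⟨E, hE⟩ := divisible_units_complex.extension_property_addMonoidHom
      (M := Additive m.range) (N := Fin d → ℤ) (MonoidHom.toAdditiveLeft m.range.subtype)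
      (fun a b hab => Subtype.ext hab) (MonoidHom.toAdditive χ')
    refine ⟨fun j => (E (Pi.single j 1)).toMul, MonoidHom.ext fun g => ?_⟩
    have h1 : E (m g).toAdd = Additive.ofMul (χ' (m.rangeRestrict g)) :=
      DFunLike.congr_fun hE (Additive.ofMul (m.rangeRestrict g))
    have h2 : E (m g).toAdd = ∑ j, (m g).toAdd j • E (Pi.single j 1) := by
      conv_lhs => rw [pi_eq_sum_univ' (m g).toAdd, map_sum]
      refine Finset.sum_congr rfl fun j _ => ?_
      rw [map_zsmul]
    change ∏ j, (E (Pi.single j 1)).toMul ^ (m g).toAdd j = χ.toHom g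
    rw [← hχ', ← toMul_ofMul (χ' _), ← h1, h2, toMul_sum]
    rfl

/-- A subtorus consists of the characters that are trivial on the kernel of a homomorphism to a
lattice. -/
theorem IsSubtorus.exists_eq_range_torusMap {S : Set (CharVar G)} (hS : IsSubtorus S) :
    ∃ (d : ℕ) (m : G →* Multiplicative (Fin d → ℤ)), S = Set.range (torusMap m) := by
  obtain ⟨d, φ, hφ, -, rfl⟩ := hS
  choose a ha using hφ
  let m : G →* Multiplicative (Fin d → ℤ) :=
    { toFun := fun g => Multiplicative.ofAdd (a g)
      map_one' := by
        refine congrArg Multiplicative.ofAdd (eq_of_prod_zpow_eq (b := 0) fun t => ?_)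
        rw [← ha, map_one]
        simp
      map_mul' := fun g h => by
        rw [← ofAdd_add]
        refine congrArg Multiplicative.ofAdd (eq_of_prod_zpow_eq fun t => ?_)
        rw [← ha, map_mul, ha, ha]
        simp [zpow_add, Finset.prod_mul_distrib] }
  refine ⟨d, m, congrArg Set.range (funext fun t => MonoidHom.ext fun g => ?_)⟩
  exact ha g t

/-- A translate of the image of a torus is irreducible, as the ring of Laurent polynomials is a
domain. -/
theorem isIrreducible_mul_torusMap (c : CharVar G) :
    IsIrreducible (Set.range fun t => c * torusMap m t) := by
  have heval (t : Fin d → ℂˣ) (a : MonoidAlgebra ℂ G) : (c * torusMap m t).evalAt a =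
      (torusMap (MonoidHom.id (Multiplicative (Fin d → ℤ))) t).evalAt (twist c m a) := by
    rw [evalAt_twist]
    rfl
  have hne (a : MonoidAlgebra ℂ (Multiplicative (Fin d → ℤ))) (ha : a ≠ 0) :
      ∃ t, (torusMap (MonoidHom.id (Multiplicative (Fin d → ℤ))) t).evalAt a ≠ 0 := by
    by_contra! hcon
    let M (x : Multiplicative (Fin d → ℤ)) : (Fin d → ℂˣ) →* ℂ :=
      (Units.coeHom ℂ).comp
        { toFun := fun t => ∏ j, t j ^ x.toAdd j
          map_one' := by simp
          map_mul' := fun s t => by simp [mul_zpow, Finset.prod_mul_distrib] }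
    have hM : Function.Injective M := fun x y h =>
      congrArg Multiplicative.ofAdd (eq_of_prod_zpow_eq fun t =>
        Units.ext (DFunLike.congr_fun h t))
    have hli := linearIndependent_iff'.mp ((linearIndependent_monoidHom (Fin d → ℂˣ) ℂ).comp M hM)
      a.coeff.support (fun x => a.coeff x) (by
        funext t
        have h := hcon t
        rw [evalAt, MonoidAlgebra.lift_apply] at h
        rw [Finset.sum_apply]
        exact h)
    refine ha (MonoidAlgebra.ext (Finsupp.ext fun x => ?_))
    by_cases hx : x ∈ a.coeff.support
    · exact hli x hx
    · exact Finsupp.notMem_support_iff.mp hx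
  refine ⟨⟨_, 1, rfl⟩, ?_⟩
  rintro O O' hO hO' ⟨_, ⟨t, rfl⟩, ht⟩ ⟨_, ⟨t', rfl⟩, ht'⟩
  obtain ⟨a, ha, haO⟩ := exists_evalAt_ne_zero hO ht
  obtain ⟨b, hb, hbO⟩ := exists_evalAt_ne_zero hO' ht'
  have ha0 : twist c m a ≠ 0 := by
    intro h
    rw [heval, h, map_zero] at ha
    exact ha rfl
  have hb0 : twist c m b ≠ 0 := by
    intro h
    rw [heval, h, map_zero] at hb
    exact hb rfl
  obtain ⟨s, hs⟩ := hne _ (mul_ne_zero ha0 hb0)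
  rw [map_mul, ← heval, ← heval] at hs
  exact ⟨_, ⟨s, rfl⟩, haO _ (left_ne_zero_of_mul hs), hbO _ (right_ne_zero_of_mul hs)⟩

end Torus

/-- Irreducible subsets are contained in irreducible components. -/
theorem exists_isIrredComponent {Z T : Set (CharVar G)} (hT : IsIrreducible T) (hTZ : T ⊆ Z) :
    ∃ W, IsIrredComponent Z W ∧ T ⊆ W := by
  obtain ⟨W, hTW, hW⟩ := zorn_subset_nonempty {W : Set (CharVar G) | IsIrreducible W ∧ W ⊆ Z} (by
    intro c hc hchain hne
    refine ⟨⋃₀ c, ⟨⟨?_, ?_⟩, Set.sUnion_subset fun W hW => (hc hW).2⟩,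
      fun W hW => Set.subset_sUnion_of_mem hW⟩
    · obtain ⟨W, hW⟩ := hne
      exact (hc hW).1.nonempty.mono (Set.subset_sUnion_of_mem hW)
    · rintro O O' hO hO' ⟨x, ⟨W, hW, hxW⟩, hx⟩ ⟨x', ⟨W', hW', hxW'⟩, hx'⟩
      rcases hchain.total hW hW' with h | h
      · obtain ⟨y, hy, hy'⟩ := (hc hW').1.2 O O' hO hO' ⟨x, h hxW, hx⟩ ⟨x', hxW', hx'⟩
        exact ⟨y, ⟨W', hW', hy⟩, hy'⟩
      · obtain ⟨y, hy, hy'⟩ := (hc hW).1.2 O O' hO hO' ⟨x, hxW, hx⟩ ⟨x', h hxW', hx'⟩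
        exact ⟨y, ⟨W, hW, hy⟩, hy'⟩) T ⟨hT, hTZ⟩
  exact ⟨W, hW, hTW⟩

end CharVar

/-! ### Finitely generated abelian groups -/

section FiniteGeneration

theorem Group.fg_of_finite_quotient {G : Type*} [Group G] (S : Subgroup G) (hS : S.FG)
    [Finite (G ⧸ S)] : Group.FG G := by
  obtain ⟨s, rfl⟩ := hS
  rw [Group.fg_iff]
  refine ⟨s ∪ Set.range (Quotient.out : G ⧸ Subgroup.closure (s : Set G) → G), ?_,
    s.finite_toSet.union (Set.finite_range _)⟩
  rw [eq_top_iff]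
  intro g _
  have h : (g : G ⧸ Subgroup.closure (s : Set G)).out⁻¹ * g ∈ Subgroup.closure (s : Set G) := by
    rw [← QuotientGroup.eq]
    exact QuotientGroup.out_eq' _
  rw [← mul_inv_cancel_left (g : G ⧸ Subgroup.closure (s : Set G)).out g]
  exact mul_mem (Subgroup.subset_closure (Or.inr ⟨_, rfl⟩))
    (Subgroup.closure_mono Set.subset_union_left h)

/-- A finitely generated abelian group maps onto a lattice with torsion kernel. -/
theorem CommGroup.exists_surjective_lattice (Q : Type*) [CommGroup Q] [Group.FG Q] :
    ∃ (r : ℕ) (p : Q →* Multiplicative (Fin r → ℤ)), Function.Surjective p ∧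
      ∀ x, p x = 1 → IsOfFinOrder x := by
  have : AddGroup.FG (Additive Q) := inferInstance
  have : Module.Finite ℤ (Additive Q) := Module.Finite.iff_addGroup_fg.mpr inferInstance
  let L := Additive Q ⧸ Submodule.torsion ℤ (Additive Q)
  have : Module.Free ℤ L := inferInstance
  let e : L ≃ₗ[ℤ] (Fin (Module.finrank ℤ L) → ℤ) := (Module.finBasis ℤ L).equivFun
  refine ⟨_, AddMonoidHom.toMultiplicativeRight
    (e.toLinearMap ∘ₗ (Submodule.torsion ℤ (Additive Q)).mkQ).toAddMonoidHom, ?_, ?_⟩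
  · intro v
    obtain ⟨x, hx⟩ := (e.surjective.comp (Submodule.mkQ_surjective _)) v.toAdd
    exact ⟨x.toMul, hx⟩
  · intro x hx
    have h : e ((Submodule.torsion ℤ (Additive Q)).mkQ (Additive.ofMul x)) = 0 := hx
    rw [LinearEquiv.map_eq_zero_iff, Submodule.mkQ_apply, Submodule.Quotient.mk_eq_zero,
      Submodule.mem_torsion_iff] at h
    obtain ⟨n, hn⟩ := h
    rw [isOfFinOrder_iff_zpow_eq_one]
    exact ⟨n, nonZeroDivisors.ne_zero n.2, hn⟩

universe u

/-- The characters of `G` that vanish on the image of the kernel of `m : H → ℤ^d` are the characters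
of a finitely generated abelian group if the image of `H` in `G` has finite index. -/
theorem exists_fg_quotient {G : Type u} {H : Type*} [Group G] [Group H] (F : H →* G)
    (K : Subgroup G) (hK : F.range = K) [Finite (G ⧸ K)] {d : ℕ}
    (m : H →* Multiplicative (Fin d → ℤ)) :
    ∃ (Q : Type u) (_ : CommGroup Q) (_ : Group.FG Q) (q : G →* Q), Function.Surjective q ∧
      (∀ h, m h = 1 → q (F h) = 1) ∧
      ∀ ρ : CharVar G, (∀ h, m h = 1 → ρ.toHom (F h) = 1) → ∃ ψ, CharVar.comap q ψ = ρ := by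
  let B : Subgroup (Abelianization G) := m.ker.map (Abelianization.of.comp F)
  let q : G →* Abelianization G ⧸ B := (QuotientGroup.mk' B).comp Abelianization.of
  have hq : Function.Surjective q :=
    (QuotientGroup.mk'_surjective B).comp (QuotientGroup.mk'_surjective _)
  have hqF (h : H) (hh : m h = 1) : q (F h) = 1 :=
    (QuotientGroup.eq_one_iff _).mpr ⟨h, hh, rfl⟩
  refine ⟨Abelianization G ⧸ B, inferInstance, ?_, q, hq, hqF, fun ρ hρ => ?_⟩
  · have hfg : (q.comp F).range.FG := by
      have hker : m.ker ≤ (q.comp F).ker := fun h hh => hqF h hh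
      let φ : H ⧸ m.ker →* Abelianization G ⧸ B := QuotientGroup.lift m.ker (q.comp F) hker
      have hφ : φ.range = (q.comp F).range := by
        ext x
        constructor
        · rintro ⟨y, rfl⟩
          obtain ⟨h, rfl⟩ := QuotientGroup.mk_surjective y
          exact ⟨h, rfl⟩
        · rintro ⟨h, rfl⟩
          exact ⟨(h : H ⧸ m.ker), rfl⟩
      have hm : Group.FG m.range := by
        have h := Module.Finite.of_injective
          (MonoidHom.toAdditiveLeft m.range.subtype).toIntLinearMap
          (fun a b hab => Subtype.ext hab)
        exact GroupFG.iff_add_fg.mpr (Module.Finite.iff_addGroup_fg.mp h)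
      have : Group.FG (H ⧸ m.ker) :=
        Group.fg_of_surjective
          (f := (QuotientGroup.quotientKerEquivRange m).symm.toMonoidHom)
          (QuotientGroup.quotientKerEquivRange m).symm.surjective
      rw [← hφ]
      exact (Group.fg_iff_subgroup_fg _).mp (Group.fg_range φ)
    have hfin : Finite ((Abelianization G ⧸ B) ⧸ (q.comp F).range) := by
      have : K ≤ (q.comp F).range.comap q := by
        rw [← hK]
        rintro _ ⟨h, rfl⟩
        exact ⟨h, rfl⟩
      have h1 : Function.Surjective (Quotient.map' (s₁ := QuotientGroup.leftRel K)
          (s₂ := QuotientGroup.leftRel (q.comp F).range) q fun a b hab => by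
            rw [QuotientGroup.leftRel_apply] at hab ⊢
            rw [← map_inv, ← map_mul]
            exact this hab) := by
        intro x
        obtain ⟨y, rfl⟩ := QuotientGroup.mk_surjective x
        obtain ⟨g, rfl⟩ := hq y
        exact ⟨(g : G ⧸ K), rfl⟩
      exact Finite.of_surjective (α := G ⧸ K) _ h1
    exact Group.fg_of_finite_quotient _ hfg
  · refine ⟨(QuotientGroup.lift B (Abelianization.lift ρ.toHom) ?_ : _ →* ℂˣ), rfl⟩
    rintro _ ⟨h, hh, rfl⟩
    exact hρ h hh

end FiniteGeneration

end

/-! ### Translated components of the jump loci -/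

noncomputable section

theorem exists_natCast_isLeast {α : Type*} {T : Set α} {R : α → Cardinal} {t : α} (ht : t ∈ T)
    {n : ℕ} (h : R t = n) : ∃ (m : ℕ), ∃ s ∈ T, R s = m ∧ ∀ s' ∈ T, m ≤ R s' := by
  obtain ⟨_, ⟨s, hs, rfl⟩, hmin⟩ := Cardinal.lt_wf.has_min (R '' T) ⟨_, t, ht, rfl⟩
  have hle (s' : α) (hs' : s' ∈ T) : R s ≤ R s' := not_lt.mp (hmin _ ⟨s', hs', rfl⟩)
  obtain ⟨m, hm⟩ := Cardinal.lt_aleph0.mp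
    ((h ▸ hle t ht).trans_lt (Cardinal.natCast_lt_aleph0 (n := n)))
  exact ⟨m, s, hs, hm, fun s' hs' => hm ▸ hle s' hs'⟩

/-- Let finitely many upper semicontinuous functions with finite values be given on an irreducible
set, whose sum is nowhere smaller than the sum of one value of each of them. Then these values are
the minima, because generically each function is at most its given value. -/
theorem IsIrreducible.le_of_sum_le {Y : Type*} [TopologicalSpace Y] {D : Set Y}
    (hD : IsIrreducible D) {n : ℕ} {R : Fin n → Y → Cardinal} {h : Fin n → ℕ}
    (hR : ∀ j y, ∃ (O : Set Y) (m : ℕ), IsOpen O ∧ y ∈ O ∧ R j y = m ∧ ∀ y' ∈ O, R j y' ≤ m)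
    (hh : ∀ j, ∃ y ∈ D, R j y = h j)
    (hsum : ∀ y ∈ D, ∀ r : Fin n → ℕ, (∀ j, R j y = r j) → ∑ j, h j ≤ ∑ j, r j)
    (j : Fin n) {y : Y} (hy : y ∈ D) : h j ≤ R j y := by
  classical
  choose x hxD hx using hh
  choose O m hO hmem hm hle using hR
  obtain ⟨z, hzD, hz⟩ := isIrreducible_iff_sInter.mp hD
    (insert (O j y) (Finset.univ.image fun l => O l (x l)))
    (by
      intro W hW
      rcases Finset.mem_insert.mp hW with rfl | hW
      · exact hO _ _
      · obtain ⟨l, -, rfl⟩ := Finset.mem_image.mp hW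
        exact hO _ _)
    (by
      intro W hW
      rcases Finset.mem_insert.mp hW with rfl | hW
      · exact ⟨y, hy, hmem _ _⟩
      · obtain ⟨l, -, rfl⟩ := Finset.mem_image.mp hW
        exact ⟨x l, hxD l, hmem _ _⟩)
  have hzl (l : Fin n) : m l z ≤ h l := by
    have h1 := hle l (x l) z (hz _ (Finset.mem_insert_of_mem
      (Finset.mem_image_of_mem _ (Finset.mem_univ l))))
    rw [hm l z, ← hm l (x l), hx l] at h1
    exact_mod_cast h1
  have heq := (Finset.sum_eq_sum_iff_of_le fun l _ => hzl l).mp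
    (le_antisymm (Finset.sum_le_sum fun l _ => hzl l) (hsum z hzD _ fun l => hm l z))
  have hzy := hle j y z (hz _ (Finset.mem_insert_self _ _))
  rw [hm j z, heq j (Finset.mem_univ j), ← hm j y] at hzy
  exact hzy

section CoveringTranslate

universe u v

variable {U : Type u} [TopologicalSpace U] [T2Space U] [CWComplex (Set.univ : Set U)]
  [RelCWComplex.FiniteType (Set.univ : Set U)] {V : Type v} [TopologicalSpace V] {f : C(V, U)}
  {v₀ : V} {τ : CharVar (FundamentalGroup U (f v₀))}

/-- The cohomology of a CW complex of finite type twisted by a power of a torsion character is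
finite-dimensional, as the character factors through a finite group. -/
theorem exists_rank_twistedCohomology_eq_natCast (hτ : IsOfFinOrder τ)
    (hV : (FundamentalGroup.mapOfEq f (rfl : f v₀ = f v₀)).range = τ.toHom.ker) (i j : ℕ) :
    ∃ m : ℕ, Module.rank ℂ (TwistedCohomology (τ * τ ^ j) i) = m := by
  have := finite_quotient_ker hτ
  obtain ⟨Q, _, _, q, -, -, hq⟩ := exists_fg_quotient (FundamentalGroup.mapOfEq f rfl) τ.toHom.ker
    hV (1 : FundamentalGroup V v₀ →* Multiplicative (Fin 0 → ℤ))
  obtain ⟨ψ, hψ⟩ := hq (τ * τ ^ j) fun h _ => by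
    have h1 : τ.toHom (FundamentalGroup.mapOfEq f rfl h) = 1 :=
      MonoidHom.mem_ker.mp (hV ▸ ⟨h, rfl⟩)
    change τ.toHom _ * τ.toHom _ ^ j = 1
    rw [h1, one_pow, one_mul]
  obtain ⟨O, m, -, -, hm, -⟩ := CharVar.exists_isOpen_rank_le (f v₀) q i ψ
  exact ⟨m, hψ ▸ hm⟩

theorem rank_twistedCohomology_mul_pow_zero {X : Type*} [TopologicalSpace X] {x₀ : X}
    (ρ τ : CharVar (FundamentalGroup X x₀)) (i : ℕ) :
    Module.rank ℂ (TwistedCohomology (ρ * τ ^ 0) i) = Module.rank ℂ (TwistedCohomology ρ i) :=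
  congrArg (fun χ => Module.rank ℂ (TwistedCohomology χ i)) (by rw [pow_zero, mul_one])

/-- If the components through `1` of the jump loci of the covering associated with a torsion
character `τ` are subtori, then the components through `τ` of the jump loci of the base are
translates of subtori. -/
theorem CharVar.IsIrredComponent.isSubtorusTranslate (hf : IsCoveringMap f) (hτ : IsOfFinOrder τ)
    (hV : (FundamentalGroup.mapOfEq f (rfl : f v₀ = f v₀)).range = τ.toHom.ker) {i k : ℕ}
    (hk : 0 < k)
    (H : ∀ k : ℕ, 0 < k → ∀ S : Set (CharVar (FundamentalGroup V v₀)),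
      CharVar.IsIrredComponent (jumpLocus v₀ i k) S → 1 ∈ S → CharVar.IsSubtorus S)
    {T : Set (CharVar (FundamentalGroup U (f v₀)))}
    (hT : CharVar.IsIrredComponent (jumpLocus (f v₀) i k) T) (hτT : τ ∈ T) :
    CharVar.IsSubtorusTranslate T := by
  have hn : 0 < orderOf τ := hτ.orderOf_pos
  have hrτ : restrictChar f v₀ τ = 1 := by
    have := restrictChar_mul_pow hV 1 1
    rwa [one_mul, pow_one, map_one] at this
  -- the generic dimensions along `T` of the cohomology twisted by the powers of `τ`
  have hmin (j : Fin (orderOf τ)) : ∃ m : ℕ, ∃ ρ ∈ T,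
      Module.rank ℂ (TwistedCohomology (ρ * τ ^ (j : ℕ)) i) = m ∧
      ∀ ρ' ∈ T, m ≤ Module.rank ℂ (TwistedCohomology (ρ' * τ ^ (j : ℕ)) i) := by
    obtain ⟨m, hm⟩ := exists_rank_twistedCohomology_eq_natCast hτ hV i j
    exact exists_natCast_isLeast
      (R := fun ρ => Module.rank ℂ (TwistedCohomology (ρ * τ ^ (j : ℕ)) i)) hτT hm
  choose h ρ hρT hρ hle using hmin
  have hk0 : k ≤ h ⟨0, hn⟩ := by
    have h1 : (k : Cardinal) ≤ Module.rank ℂ (TwistedCohomology (ρ ⟨0, hn⟩) i) :=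
      hT.prop.2 (hρT _)
    rw [← rank_twistedCohomology_mul_pow_zero _ τ, hρ ⟨0, hn⟩] at h1
    exact_mod_cast h1
  have hN : 0 < ∑ j, h j :=
    hk.trans_le (hk0.trans (Finset.single_le_sum (f := h) (fun _ _ => Nat.zero_le _)
      (Finset.mem_univ _)))
  -- a component of a jump locus of the covering that contains the restriction of `T`
  obtain ⟨W, hW, hTW⟩ := CharVar.exists_isIrredComponent
    (hT.prop.1.image (restrictChar f v₀) (CharVar.continuous_comap _).continuousOn)
    (Z := jumpLocus v₀ i (∑ j, h j)) (by
      rintro _ ⟨χ, hχ, rfl⟩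
      exact le_rank_twistedCohomology_restrictChar hf hV χ hτ fun j => hle j χ hχ)
  obtain ⟨d, m, rfl⟩ := (H _ hN W hW (hTW ⟨τ, hτT, hrτ⟩)).exists_eq_range_torusMap
  have hTm (χ : CharVar (FundamentalGroup U (f v₀))) (hχ : χ ∈ T) (g : FundamentalGroup V v₀)
      (hg : m g = 1) : χ.toHom (FundamentalGroup.mapOfEq f rfl g) = 1 :=
    (CharVar.mem_range_torusMap m).mp (hTW ⟨χ, hχ, rfl⟩) g hg
  have := finite_quotient_ker hτ
  obtain ⟨Q, _, _, q, hq, hqF, hqψ⟩ :=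
    exists_fg_quotient (FundamentalGroup.mapOfEq f rfl) τ.toHom.ker hV m
  obtain ⟨r, p, hp, hptor⟩ := CommGroup.exists_surjective_lattice Q
  obtain ⟨σ, rfl⟩ := hqψ τ (hTm τ hτT)
  -- the characters of `Q` that agree with `σ` on the torsion
  let D : Set (CharVar Q) := Set.range fun t => σ * CharVar.torusMap p t
  have hD : IsIrreducible D := CharVar.isIrreducible_mul_torusMap p σ
  have hTD (χ : CharVar (FundamentalGroup U (f v₀))) (hχ : χ ∈ T) :
      ∃ ψ ∈ D, CharVar.comap q ψ = χ := by
    obtain ⟨ψ, rfl⟩ := hqψ χ (hTm χ hχ)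
    refine ⟨ψ, ?_, rfl⟩
    obtain ⟨t, ht⟩ := (CharVar.mem_range_torusMap p (χ := σ⁻¹ * ψ)).mpr fun x hx => by
      obtain ⟨g, rfl⟩ := hq x
      have h1 : (CharVar.comap q σ).toHom g = (CharVar.comap q ψ).toHom g :=
        CharVar.eq_of_isIrreducible hT.prop.1 (g := g) (hptor _ hx).orderOf_pos (by
          intro χ' hχ'
          obtain ⟨ψ', rfl⟩ := hqψ χ' (hTm χ' hχ')
          change ψ'.toHom (q g) ^ _ = 1
          rw [← map_pow, pow_orderOf_eq_one, map_one]) hτT hχ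
      change (σ.toHom (q g))⁻¹ * ψ.toHom (q g) = 1
      rw [inv_mul_eq_one]
      exact h1
    exact ⟨t, by
      change σ * CharVar.torusMap p t = ψ
      rw [ht, mul_inv_cancel_left]⟩
  have hDW (ψ : CharVar Q) :
      restrictChar f v₀ (CharVar.comap q ψ) ∈ jumpLocus v₀ i (∑ j, h j) := by
    refine hW.prop.2 ((CharVar.mem_range_torusMap m).mpr fun g hg => ?_)
    change ψ.toHom (q (FundamentalGroup.mapOfEq f rfl g)) = 1
    rw [hqF g hg, map_one]
  have hDk (ψ : CharVar Q) (hψ : ψ ∈ D) : CharVar.comap q ψ ∈ jumpLocus (f v₀) i k := by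
    have h1 := hD.le_of_sum_le (R := fun (j : Fin (orderOf (CharVar.comap q σ))) ψ =>
        Module.rank ℂ (TwistedCohomology (CharVar.comap q ψ * CharVar.comap q σ ^ (j : ℕ)) i))
      (h := h) (fun j χ => by
        obtain ⟨O, m', hO, hmem, hm, hOm⟩ :=
          CharVar.exists_isOpen_rank_le (f v₀) q i (χ * σ ^ (j : ℕ))
        have hj (χ' : CharVar Q) :
            Module.rank ℂ (TwistedCohomology (CharVar.comap q (χ' * σ ^ (j : ℕ))) i) =
              Module.rank ℂ (TwistedCohomology
                (CharVar.comap q χ' * CharVar.comap q σ ^ (j : ℕ)) i) :=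
          congrArg (fun χ => Module.rank ℂ (TwistedCohomology χ i)) (by rw [map_mul, map_pow])
        exact ⟨(fun χ' => χ' * σ ^ (j : ℕ)) ⁻¹' O, m',
          hO.preimage (CharVar.continuous_mul_const _), hmem,
          (hj χ).symm.trans hm, fun χ' hχ' => (hj χ').symm.trans_le (hOm _ hχ')⟩)
      (fun j => by
        obtain ⟨χ, hχ, hχρ⟩ := hTD (ρ j) (hρT j)
        exact ⟨χ, hχ, by rw [hχρ]; exact hρ j⟩)
      (fun χ _ r hr => by
        have h2 : ((∑ j, h j : ℕ) : Cardinal) ≤ _ := hDW χ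
        rw [rank_twistedCohomology_restrictChar_eq hf hV (CharVar.comap q χ) hτ hr] at h2
        exact_mod_cast h2)
      ⟨0, hn⟩ hψ
    exact (Nat.cast_le.mpr hk0).trans (h1.trans (rank_twistedCohomology_mul_pow_zero _ _ i).le)
  have hTeq : T = CharVar.comap q '' D := by
    refine (hT.eq_of_subset ⟨hD.image _ (CharVar.continuous_comap q).continuousOn, ?_⟩ hTD)
    rintro _ ⟨ψ, hψ, rfl⟩
    exact hDk ψ hψ
  refine ⟨CharVar.comap q σ, _, CharVar.isSubtorus_range_torusMap (m := p.comp q) (hp.comp hq), ?_⟩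
  rw [hTeq, ← Set.range_comp, ← Set.range_comp]
  rfl

end CoveringTranslate

end

theorem proposition3p1 {U : Type*} [TopologicalSpace U] [T2Space U] [ConnectedSpace U]
    [CWComplex (Set.univ : Set U)] [CWComplex.FiniteType (Set.univ : Set U)]
    (u₀ : U) (τ : CharVar (FundamentalGroup U u₀)) (hτ : IsOfFinOrder τ)
    -- `f : (V, v₀) → (U, u₀)` is the connected covering with `f_* π₁(V, v₀) = ker τ`
    {V : Type*} [TopologicalSpace V] [ConnectedSpace V]
    (f : C(V, U)) (hf : IsCoveringMap f) (v₀ : V) (hv₀ : f v₀ = u₀)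
    (hV : (FundamentalGroup.mapOfEq f hv₀).range = τ.toHom.ker)
    (i : ℕ)
    (H : ∀ k : ℕ, 0 < k → ∀ S : Set (CharVar (FundamentalGroup V v₀)),
      CharVar.IsIrredComponent (jumpLocus v₀ i k) S → 1 ∈ S → CharVar.IsSubtorus S) :
    ∀ k : ℕ, 0 < k → ∀ T : Set (CharVar (FundamentalGroup U u₀)),
      CharVar.IsIrredComponent (jumpLocus u₀ i k) T → τ ∈ T → CharVar.IsSubtorusTranslate T := by
  subst hv₀
  exact fun k hk T hT hτT => hT.isSubtorusTranslate hf hτ hV hk H hτT
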